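/- **Quantum coordinator model.** There are a referee and $r$ parties $P_0,\dots,P_{r-1}$; party $P_i$ holds a private matrix $A_i\in\mathbb R^{m_i\times n}$. Let $m=\sum_i m_i$, let $A\in\mathbb R^{m\times n}$ be the vertical stack of $A_0,\dots,A_{r-1}$, and let $\bar A=\begin{pmatrix}0&A\\A^\dagger&0\end{pmatrix}$. The referee holds a qubit $\mathsf C$, an $(m+n)$-dimensional register $\mathsf I$ and ancilla qubits, and every party holds private qubits; all ancilla and private qubits start in $|0\rangle$. A protocol is a finite sequence of steps. In each step, either the referee applies a unitary to everything he holds, or he sends some of his ancilla qubits to one party $P_i$, who applies to them and to his private qubits a unitary and sends them back. The unitaries of $P_i$ may depend on $A_i$ and on public parameters only, those of the referee on public parameters only. The number of qubits of communication is the total number of qubits sent, in both directions. Public parameters are $r,n,m_0,\dots,m_{r-1},\varphi,\varepsilon$ and numbers $\alpha_i\ge\|A_i\|$ (spectral norm; for instance $\alpha_i=\|A_i\|$), not all zero; put $\alpha=\sqrt{\sum_i\alpha_i^2}$. **Gapped phase estimation.** Let $\varepsilon>0$ and $0<\varphi<1$. A protocol *implements $GPE(\varphi,\varepsilon)$* if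 for every spectral decomposition $\bar A=\sum_u\lambda_u|\phi_u\rangle\langle\phi_u|$ (with $(\phi_u)$ an orthonormal basis) there are unit vectors $|\xi_u\rangle\in\mathbb C^2$ with $$\begin{cases}\||\xi_u\rangle-|0\rangle\|\le\varepsilon & \text{if }\lambda_u/\alpha\in[\varphi,1],\\ \||\xi_u\rangle-i|1\rangle\|\le\varepsilon & \text{if }\lambda_u/\alpha\in[-\varphi/2,\varphi/2],\\ \||\xi_u\rangle+|0\rangle\|\le\varepsilon & \text{if }\lambda_u/\alpha\in[-1,-\varphi],\end{cases}$$ such that the protocol performs the isometry $|0\rangle_{\mathsf C}|\phi_u\rangle_{\mathsf I}\mapsto|\xi_u\rangle_{\mathsf C}|\phi_u\rangle_{\mathsf I}$ (for all $u$, extended linearly) within accuracy $\varepsilon$: for each vector $v$ in $\mathsf I$, the final joint vector of the protocol started on $|0\rangle_{\mathsf C}\,v$ is within distance $\varepsilon\|v\|$ of $\sum_u\langle\phi_u|v\rangle\,|\xi_u\rangle_{\mathsf C}|\phi_u\rangle_{\mathsf I}$ with all ancilla and private qubits in $|0\rangle$. **Theorem (GPE in the quantum coordinator model).** There is an absolute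 constant $C>0$ such that for all $r,n,m_0,\dots,m_{r-1}$, all public $\alpha_i\ge 0$, not all zero, all $0<\varphi<1$ and all $\varepsilon>0$, there is a protocol in the coordinator model that uses at most $$C\cdot\frac r\varphi\cdot\max\{1,\log_2(mn)\}\cdot\max\{1,\log_2(1/\varepsilon)\}$$ qubits of communication (where $\log_2 0$ is read as $0$) and implements $GPE(\varphi,\varepsilon)$ for all matrices $A_i\in\mathbb R^{m_i\times n}$ with $\|A_i\|\le\alpha_i$. In particular, for $mn\ge2$ and $\varepsilon\le1/2$ the communication is $O\big(\frac r\varphi\log(mn)\log\frac1\varepsilon\big)$. -/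

import Mathlib

open scoped Matrix.Norms.L2Operator

noncomputable section

namespace Coordinator

/-! ### The quantum coordinator model

A referee and `r` parties. Party `i` has a private classical input in `X i`. The referee holds a
register `R` (given by its computational basis) and `k` ancilla qubits, party `i` holds `p i`
private qubits. All ancilla and private qubits start in the state `|0⟩`. -/

variable {r : ℕ}

/-- Computational basis of the joint system: referee's register, referee's ancilla qubits,
private qubits of all the parties. -/
abbrev Basis (R : Type) (k : ℕ) (p : Fin r → ℕ) : Type :=
  R × (Fin k → Fin 2) × (∀ i, Fin (p i) → Fin 2)

/-- One step of a protocol. Either the referee applies a unitary, which cannot depend on the inputs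
of the parties, to everything that he holds; or he sends the ancilla qubits in `S` to party `i`,
who applies to them and to the private qubits of that party a unitary that depends on the input
of party `i` only, and sends the qubits in `S` back. -/
inductive Step (X : Fin r → Type) (R : Type) [Fintype R] [DecidableEq R] (k : ℕ)
    (p : Fin r → ℕ) : Type
  | referee (U : Matrix.unitaryGroup (R × (Fin k → Fin 2)) ℂ) : Step X R k p
  | exchange (i : Fin r) (S : Finset (Fin k))
      (V : X i → Matrix.unitaryGroup ((S → Fin 2) × (Fin (p i) → Fin 2)) ℂ) : Step X R k p

namespace Step

variable {X : Fin r → Type} {R : Type} [Fintype R] [DecidableEq R] {k : ℕ} {p : Fin r → ℕ}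

/-- Number of qubits communicated in a step, both directions counted. -/
def qubits : Step X R k p → ℕ
  | referee _ => 0
  | exchange _ S _ => 2 * S.card

/-- The operator on the joint system performed by a step on inputs `x`: the local unitary tensored
with the identity on all that the acting player does not hold. -/
def op (x : ∀ i, X i) : Step X R k p → Matrix (Basis R k p) (Basis R k p) ℂ
  | referee U => Matrix.of fun s t =>
      if s.2.2 = t.2.2 then U.1 (s.1, s.2.1) (t.1, t.2.1) else 0
  | exchange i S V => Matrix.of fun s t =>
      if s.1 = t.1 ∧ (∀ q, q ∉ S → s.2.1 q = t.2.1 q) ∧ (∀ j, j ≠ i → s.2.2 j = t.2.2 j) then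
        (V (x i)).1 (fun q => s.2.1 q, s.2.2 i) (fun q => t.2.1 q, t.2.2 i)
      else 0

end Step

/-- A protocol in the quantum coordinator model, in which party `i` has an input in `X i` and the
referee holds an input/output register with computational basis `R`. -/
structure Protocol (X : Fin r → Type) (R : Type) [Fintype R] [DecidableEq R] where
  /-- number of ancilla qubits of the referee -/
  ancillas : ℕ
  /-- number of private qubits of each party -/
  priv : Fin r → ℕ
  /-- the steps, in the order in which they are performed -/
  steps : List (Step X R ancillas priv)

namespace Protocol

variable {X : Fin r → Type} {R : Type} [Fintype R] [DecidableEq R] (Q : Protocol X R)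

/-- Total number of qubits of communication. -/
def qubits : ℕ := (Q.steps.map Step.qubits).sum

/-- The operator on the joint system performed by the protocol on inputs `x`. -/
def op (x : ∀ i, X i) :
    Matrix (Basis R Q.ancillas Q.priv) (Basis R Q.ancillas Q.priv) ℂ :=
  Q.steps.foldl (fun M s => s.op x * M) 1

/-- The joint state `ψ ⊗ |0⋯0⟩`: the register of the referee is in the state `ψ`, all ancilla
qubits and all private qubits are in the state `|0⟩`. -/
def withZeros (ψ : EuclideanSpace ℂ R) :
    EuclideanSpace ℂ (Basis R Q.ancillas Q.priv) :=
  WithLp.toLp 2 fun s => if s.2 = 0 then ψ s.1 else 0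

/-- The final joint state when the protocol is run on inputs `x` and the register of the referee
starts in the state `ψ`. -/
def run (x : ∀ i, X i) (ψ : EuclideanSpace ℂ R) :
    EuclideanSpace ℂ (Basis R Q.ancillas Q.priv) :=
  Matrix.toEuclideanLin (Q.op x) (Q.withZeros ψ)

end Protocol

/-! ### The distributed matrix -/

variable {n : ℕ} {m : Fin r → ℕ}

/-- The matrix obtained by stacking the matrices of the parties. -/
def stack (A : ∀ i, Matrix (Fin (m i)) (Fin n) ℝ) : Matrix (Σ i, Fin (m i)) (Fin n) ℝ :=
  Matrix.of fun s j => A s.1 s.2 j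

/-- Index set of the Hermitian dilation, of cardinality `m + n`. -/
abbrev Idx (m : Fin r → ℕ) (n : ℕ) : Type := (Σ i, Fin (m i)) ⊕ Fin n

/-- The Hermitian dilation `[[0, A], [A†, 0]]` of the stacked matrix. -/
def hermDilation (A : ∀ i, Matrix (Fin (m i)) (Fin n) ℝ) : Matrix (Idx m n) (Idx m n) ℂ :=
  (Matrix.fromBlocks 0 (stack A) (stack A).transpose 0).map Complex.ofReal

/-! ### Gapped phase estimation -/

/-- The computational basis states of a qubit. -/
def ket (b : Fin 2) : EuclideanSpace ℂ (Fin 2) := EuclideanSpace.single b 1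

/-- The product state `x ⊗ y`. -/
def tensor {B D : Type} (x : EuclideanSpace ℂ B) (y : EuclideanSpace ℂ D) :
    EuclideanSpace ℂ (B × D) :=
  WithLp.toLp 2 fun s => x s.1 * y s.2

/-- The state `ξ` that gapped phase estimation attaches to an eigenvector whose normalized
eigenvalue is `t`. -/
structure IsGPEState (φ ε t : ℝ) (ξ : EuclideanSpace ℂ (Fin 2)) : Prop where
  norm_eq : ‖ξ‖ = 1
  large_pos : t ∈ Set.Icc φ 1 → ‖ξ - ket 0‖ ≤ ε
  small : t ∈ Set.Icc (-(φ / 2)) (φ / 2) → ‖ξ - Complex.I • ket 1‖ ≤ ε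
  large_neg : t ∈ Set.Icc (-1) (-φ) → ‖ξ - (-ket 0)‖ ≤ ε

/-- The protocol, run on the matrices `A`, implements `GPE(φ, ε)` with normalization `α`, that is,
the map `|0⟩ ⊗ |e_u⟩ ↦ |ξ_u⟩ ⊗ |e_u⟩` for every spectral decomposition
`∑ u, lam u |e_u⟩⟨e_u|` of the Hermitian dilation. The implementation is coherent: it has accuracy
`ε` in operator norm over all superpositions of eigenvectors, with all ancilla qubits of the
referee and all private qubits of the parties returned to `|0⟩`. -/
def ImplementsGPE (A : ∀ i, Matrix (Fin (m i)) (Fin n) ℝ) (α φ ε : ℝ)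
    (Q : Protocol (fun i => Matrix (Fin (m i)) (Fin n) ℝ) (Fin 2 × Idx m n)) : Prop :=
  ∀ (ι : Type) [Fintype ι] (e : OrthonormalBasis ι ℂ (EuclideanSpace ℂ (Idx m n)))
    (lam : ι → ℝ),
    (∀ u, Matrix.toEuclideanLin (hermDilation A) (e u) = (lam u : ℂ) • e u) →
    ∃ ξ : ι → EuclideanSpace ℂ (Fin 2),
      (∀ u, IsGPEState φ ε (lam u / α) (ξ u)) ∧
      ∀ v : EuclideanSpace ℂ (Idx m n),
        ‖Q.run A (tensor (ket 0) v) -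
          Q.withZeros (∑ u, inner ℂ (e u) v • tensor (ξ u) (e u))‖ ≤ ε * ‖v‖

end Coordinator

end

/-!
Gapped phase estimation applies a function of the Hermitian dilation `H` of the stacked matrix,
divided by `α`, to the register: it sends `|0⟩ ⊗ v` to `∑ b, |b⟩ ⊗ p_b(H) v`, where the vector of
functions `(p₀, p₁)` is close to `|0⟩`, `i|1⟩` or `-|0⟩` in the three regions of the spectrum. The
proof finds polynomials `p_b` of degree `O(log(1/ε) / φ)` and evaluates them with communication
`O(r log(m n))` for each degree.

*Block encoding.* Party `i` can perform a Hermitian unitary dilation `V_i` of the dilation of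
`A_i / a_i` on `O(log(m n))` qubits (`exists_party_unitary`). The referee distributes a vector
`(y, x)` by the isometry `J` that gives `y_i` and the copy `(a_i / α) x` to party `i`; because
`∑ (a_i / α)² = 1`, compression gives exactly `Jᴴ (⊕ V_i) J = H` (`distribute_compress`). One
exchange with each party performs `⊕ V_i`, also under control by a coin (`Simulates.exchange_all`).
Each such exchange sends the zero string unless party `i` has to act, so that the control is
coherent and needs no additional qubits.

*Qubitization and signal processing.* A Hermitian unitary `U` with corner `H` and the reflection `R`
that fixes the corner give the walk operator `W = R U`, for which `(W + W⁻¹) / 2` has corner `H`. A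
polynomial `p(H)` thus is a Laurent polynomial in `W` (`aeval_walk_homogenize`). A family of
polynomials of degree `N` whose vector of values has norm one on the unit circle is the result of
`N` controlled uses of the signal, interleaved with unitaries on the coin (`reachable_of_unit`). The
family `(p₀, p₁)` is completed to such a family by one further polynomial, which the Fejér–Riesz
theorem provides (`exists_unit_completion`).

*The polynomials.* Separating the three regions with constant quality takes a polynomial `x(t)` of
degree `O(1/φ)`, built from the antiderivative of the square of a Chebyshev polynomial divided by
its argument (`exists_three_level_poly`). High quality then costs only a factor `log(1/ε)`: a curve
of unit vectors whose components are trigonometric polynomials of degree `O(log(1/ε))` rests at the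
three target states near the angles `1`, `0`, `-1`, and by Taylor expansion of the exponentials it
is approximated by polynomials (`exists_trig_curve`). Composition with `x` gives
`exists_gpe_polynomials`.

*Accuracy.* The ideal states `γ` have norm one for every eigenvalue, also in the gaps between the
regions. The final state and the ideal one thus have equal norm, and the bound on the real part of
their overlap bounds their distance, including the component with the additional coin level. No
separate estimate of the completing polynomial is needed.
-/

namespace Coordinator

set_option linter.unusedSectionVars false

/-! ### Unit families of polynomials and the Fejér–Riesz theorem -/

section

open Polynomial ComplexConjugate

/-- The conjugate reversal `∑ k, conj (c k) X ^ (N - k)` of a polynomial `∑ k, c k X ^ k` of degree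
at most `N`. On the unit circle its value is `z ^ N` times the conjugate of the value of the
polynomial. -/
noncomputable def conjReflect (N : ℕ) (p : ℂ[X]) : ℂ[X] :=
  reflect N (p.map (starRingEnd ℂ))

theorem coeff_conjReflect (N : ℕ) (p : ℂ[X]) (k : ℕ) :
    (conjReflect N p).coeff k = conj (p.coeff (revAt N k)) := by
  simp [conjReflect, coeff_reflect]

theorem conjReflect_C_mul (N : ℕ) (a : ℂ) (p : ℂ[X]) :
    conjReflect N (C a * p) = C (conj a) * conjReflect N p := by
  simp [conjReflect, reflect_C_mul]

theorem conjReflect_sum {ι : Type*} (N : ℕ) (s : Finset ι) (f : ι → ℂ[X]) :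
    conjReflect N (∑ i ∈ s, f i) = ∑ i ∈ s, conjReflect N (f i) := by
  ext k
  simp [coeff_conjReflect]

theorem conjReflect_mul {M N : ℕ} {p q : ℂ[X]} (hp : p.natDegree ≤ M) (hq : q.natDegree ≤ N) :
    conjReflect (M + N) (p * q) = conjReflect M p * conjReflect N q := by
  rw [conjReflect, Polynomial.map_mul, reflect_mul _ _ (by simpa using hp) (by simpa using hq)]
  rfl

theorem natDegree_conjReflect_le {N : ℕ} {p : ℂ[X]} (hp : p.natDegree ≤ N) :
    (conjReflect N p).natDegree ≤ N := by
  rw [natDegree_le_iff_coeff_eq_zero]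
  intro k hk
  rw [coeff_conjReflect, revAt_eq_self_of_lt hk, coeff_eq_zero_of_natDegree_lt (by omega)]
  simp

theorem conjReflect_succ {N : ℕ} {p : ℂ[X]} (hp : p.natDegree ≤ N) :
    conjReflect (N + 1) p = X * conjReflect N p := by
  have h := conjReflect_mul (M := 1) (N := N) (p := 1) (by simp) hp
  rw [one_mul, add_comm] at h
  rw [h]
  simp [conjReflect, reflect_one]

theorem conjReflect_X_mul {N : ℕ} {p : ℂ[X]} (hp : p.natDegree ≤ N) :
    conjReflect (N + 1) (X * p) = conjReflect N p := by
  rw [add_comm, conjReflect_mul (M := 1) natDegree_X_le hp]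
  simp [conjReflect]

theorem eval_conjReflect {N : ℕ} {p : ℂ[X]} (hp : p.natDegree ≤ N) {z : ℂ} (hz : z ≠ 0) :
    (conjReflect N p).eval z = z ^ N * conj (p.eval (conj z)⁻¹) := by
  have hz' : z⁻¹ ≠ 0 := inv_ne_zero hz
  let _ := invertibleOfNonzero hz'
  have h := eval₂_reflect_mul_pow (RingHom.id ℂ) z⁻¹ N (p.map (starRingEnd ℂ)) (by simpa using hp)
  have h2 : eval₂ (RingHom.id ℂ) z⁻¹ (p.map (starRingEnd ℂ)) = conj (p.eval (conj z)⁻¹) := by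
    rw [← Polynomial.eval, eval_map, ← Complex.conj_conj z⁻¹, eval₂_at_apply, map_inv₀]
  rw [h2] at h
  rw [← h]
  simp only [invOf_eq_inv, inv_inv, eval, conjReflect]
  rw [inv_pow, mul_comm (z ^ N), inv_mul_cancel_right₀ (pow_ne_zero N hz)]

theorem inv_conj_of_norm_eq_one {z : ℂ} (hz : ‖z‖ = 1) : (conj z)⁻¹ = z := by
  rw [Complex.inv_def]; simp [Complex.normSq_eq_norm_sq, hz]

theorem ne_zero_of_norm_eq_one {z : ℂ} (hz : ‖z‖ = 1) : z ≠ 0 := by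
  rintro rfl; simp at hz

theorem eval_conjReflect_of_norm_eq_one {N : ℕ} {p : ℂ[X]} (hp : p.natDegree ≤ N) {z : ℂ}
    (hz : ‖z‖ = 1) : (conjReflect N p).eval z = z ^ N * conj (p.eval z) := by
  rw [eval_conjReflect hp (ne_zero_of_norm_eq_one hz), inv_conj_of_norm_eq_one hz]

theorem infinite_unit_circle : {z : ℂ | ‖z‖ = 1}.Infinite := by
  have : Set.InjOn (fun t : ℝ => Complex.exp (t * Complex.I)) (Set.Ioo 0 1) := by
    intro s hs t ht h
    have := congrArg Complex.im h
    simp only [Complex.exp_ofReal_mul_I_im] at this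
    refine Real.injOn_sin ⟨?_, ?_⟩ ⟨?_, ?_⟩ this <;>
      linarith [hs.1, hs.2, ht.1, ht.2, Real.pi_gt_three]
  refine ((Set.Ioo_infinite (zero_lt_one' ℝ)).image this).mono ?_
  rintro _ ⟨t, -, rfl⟩
  simp [Complex.norm_exp_ofReal_mul_I]

theorem eq_of_eval_eq_on_circle {p q : ℂ[X]} (h : ∀ z : ℂ, ‖z‖ = 1 → p.eval z = q.eval z) :
    p = q :=
  eq_of_infinite_eval_eq p q (infinite_unit_circle.mono fun z hz => h z hz)

theorem conjReflect_linear_factor (a : ℂ) :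
    conjReflect 1 (X - C a) = 1 - C (conj a) * X := by
  ext k
  rcases k with _ | _ | k
  · simp [coeff_conjReflect]
  · simp [coeff_conjReflect, revAt_le, coeff_one]
  · rw [coeff_conjReflect, revAt_eq_self_of_lt (by omega)]
    simp [coeff_X, coeff_one]

/-- The Fejér–Riesz theorem for trigonometric polynomials that are strictly positive on the unit
circle. No root lies on the circle, so the roots come in pairs `a`, `1 / conj a`, and one root of
each pair is given to the factor `R`. -/
theorem exists_fejer_riesz_factor (N : ℕ) : ∀ P : ℂ[X], P.natDegree ≤ 2 * N →
    (∀ z : ℂ, ‖z‖ = 1 → ∃ ρ : ℝ, 0 < ρ ∧ P.eval z = ρ * z ^ N) →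
    ∃ R : ℂ[X], R.natDegree ≤ N ∧ P = R * conjReflect N R := by
  induction N with
  | zero =>
    intro P hP h
    obtain ⟨ρ, hρ, hr⟩ := h 1 (by simp)
    have hP' : P = C (ρ : ℂ) := by
      rw [eq_C_of_natDegree_le_zero (p := P) (by simpa using hP)] at hr ⊢
      simpa using hr
    refine ⟨C (Real.sqrt ρ : ℂ), by simp, ?_⟩
    rw [hP', conjReflect, Polynomial.map_C, reflect_C, pow_zero, mul_one, ← C_mul,
      Complex.conj_ofReal, ← Complex.ofReal_mul, Real.mul_self_sqrt hρ.le]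
  | succ N ih =>
    intro P hP h
    -- Real values of `P / z ^ (N + 1)` on the circle make `P` equal to its own reversal.
    have hself : conjReflect (2 * (N + 1)) P = P := by
      refine eq_of_eval_eq_on_circle fun z hz => ?_
      obtain ⟨ρ, -, hr⟩ := h z hz
      rw [eval_conjReflect_of_norm_eq_one hP hz, hr]
      have : conj z = z⁻¹ := by
        rw [← inv_conj_of_norm_eq_one hz, inv_inv, inv_conj_of_norm_eq_one hz]
      have hz0 := ne_zero_of_norm_eq_one hz
      simp only [map_mul, map_pow, this, Complex.conj_ofReal]
      rw [inv_pow, two_mul, pow_add]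
      field_simp
    -- Both cases divide `P` by a factor which on the circle is `z` times a positive number.
    have key : ∀ q Q S : ℂ[X], P = q * Q → (∀ z : ℂ, ‖z‖ = 1 → ∃ s : ℝ, 0 < s ∧ q.eval z = s * z) →
        Q.natDegree ≤ 2 * N → S.natDegree ≤ 1 → q = S * conjReflect 1 S →
        ∃ R : ℂ[X], R.natDegree ≤ N + 1 ∧ P = R * conjReflect (N + 1) R := by
      intro q Q S hPq hq hQ hS hqS
      obtain ⟨R, hR, hQR⟩ := ih Q hQ (by
        intro z hz
        obtain ⟨ρ, hρ, hr⟩ := h z hz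
        obtain ⟨s, hs, hr'⟩ := hq z hz
        have hz0 := ne_zero_of_norm_eq_one hz
        have hs0 : (s : ℂ) ≠ 0 := by exact_mod_cast hs.ne'
        refine ⟨ρ / s, div_pos hρ hs, ?_⟩
        rw [hPq, eval_mul, hr'] at hr
        have hsz : (s : ℂ) * z ≠ 0 := mul_ne_zero hs0 hz0
        apply mul_left_cancel₀ hsz
        rw [hr]
        push_cast
        field_simp
        ring)
      refine ⟨S * R, ?_, ?_⟩
      · exact natDegree_mul_le.trans (by omega)
      · rw [add_comm N 1, conjReflect_mul hS hR, hPq, hqS]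
        conv_lhs => rw [hQR]
        ring
    by_cases hdeg : P.coeff (2 * (N + 1)) = 0
    · have h0 : P.coeff 0 = 0 := by
        rw [← hself, coeff_conjReflect, revAt_zero, hdeg, map_zero]
      obtain ⟨Q, hQ⟩ := X_dvd_iff.2 h0
      refine key X Q 1 hQ (fun z _ => ⟨1, one_pos, by simp⟩) ?_ (by simp)
        (by simp [conjReflect, reflect_one])
      rw [natDegree_le_iff_coeff_eq_zero]
      intro k hk
      have : P.coeff (k + 1) = 0 := by
        rcases Nat.lt_or_ge (2 * (N + 1)) (k + 1) with h1 | h1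
        · exact coeff_eq_zero_of_natDegree_lt (by omega)
        · rw [show k + 1 = 2 * (N + 1) by omega, hdeg]
      rwa [hQ, coeff_X_mul] at this
    · have hcoeff0 : P.coeff 0 ≠ 0 := by
        rw [← hself, coeff_conjReflect, revAt_zero]
        simpa using hdeg
      have hPdeg : P.natDegree = 2 * (N + 1) := le_antisymm hP (le_natDegree_of_ne_zero hdeg)
      obtain ⟨a, ha⟩ := IsAlgClosed.exists_root P (by
        intro h0
        have := natDegree_eq_of_degree_eq_some h0
        rw [hPdeg] at this
        simp at this)
      have ha0 : a ≠ 0 := by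
        rintro rfl
        exact hcoeff0 (by simpa [IsRoot, ← coeff_zero_eq_eval_zero] using ha)
      have hoff : ∀ z : ℂ, ‖z‖ = 1 → P.eval z ≠ 0 := by
        intro z hz h0
        obtain ⟨ρ, hρ, hr⟩ := h z hz
        rw [h0] at hr
        exact mul_ne_zero (by exact_mod_cast hρ.ne') (pow_ne_zero _ (ne_zero_of_norm_eq_one hz))
          hr.symm
      have hca0 : conj a ≠ 0 := by simpa using ha0
      have hb : P.IsRoot (conj a)⁻¹ := by
        rw [IsRoot, ← hself, eval_conjReflect hP (inv_ne_zero hca0)]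
        have : (conj (conj a)⁻¹)⁻¹ = a := by simp
        rw [this, ha.eq_zero]
        simp
      have hab : a ≠ (conj a)⁻¹ := by
        intro hab
        refine hoff a ?_ ha
        have h1 : a * conj a = 1 := by
          nth_rewrite 1 [hab]
          exact inv_mul_cancel₀ hca0
        rw [Complex.mul_conj, Complex.normSq_eq_norm_sq] at h1
        have h2 : ‖a‖ ^ 2 = 1 := by exact_mod_cast h1
        exact (pow_eq_one_iff_of_nonneg (norm_nonneg a) two_ne_zero).1 h2
      obtain ⟨Q, hQ⟩ := (IsCoprime.mul_dvd (isCoprime_X_sub_C_of_isUnit_sub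
        (sub_ne_zero.2 hab).isUnit) (dvd_iff_isRoot.2 ha) (dvd_iff_isRoot.2 hb))
      have hfac : (X - C a) * conjReflect 1 (X - C a) =
          C (-conj a) * ((X - C a) * (X - C (conj a)⁻¹)) := by
        have : (C (conj a) : ℂ[X]) * C (conj a)⁻¹ = 1 := by
          rw [← C_mul, mul_inv_cancel₀ hca0, C_1]
        rw [conjReflect_linear_factor, C_neg]
        linear_combination (-(X - C a)) * this
      have hPq : P = (X - C a) * conjReflect 1 (X - C a) * (C (-(conj a)⁻¹) * Q) := by
        have : (C (-conj a) : ℂ[X]) * C (-(conj a)⁻¹) = 1 := by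
          rw [← C_mul, neg_mul_neg, mul_inv_cancel₀ hca0, C_1]
        rw [hfac]
        linear_combination hQ - (X - C a) * (X - C (conj a)⁻¹) * Q * this
      refine key _ (C (-(conj a)⁻¹) * Q) (X - C a) hPq ?_ ?_ (natDegree_X_sub_C_le a) rfl
      · intro z hz
        have hza : z ≠ a := by
          rintro rfl
          exact hoff _ hz ha
        refine ⟨Complex.normSq (z - a), Complex.normSq_pos.2 (sub_ne_zero.2 hza), ?_⟩
        rw [eval_mul, eval_conjReflect_of_norm_eq_one (natDegree_X_sub_C_le a) hz,
          Complex.normSq_eq_conj_mul_self]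
        simp
        ring
      · have hQ0 : Q ≠ 0 := by
          rintro rfl
          rw [mul_zero] at hQ
          simp [hQ] at hdeg
        have hd := congrArg natDegree hQ
        rw [natDegree_mul (mul_ne_zero (X_sub_C_ne_zero _) (X_sub_C_ne_zero _)) hQ0,
          natDegree_mul (X_sub_C_ne_zero _) (X_sub_C_ne_zero _), natDegree_X_sub_C,
          natDegree_X_sub_C, hPdeg] at hd
        exact (natDegree_C_mul_le _ _).trans (by omega)

/-- A finite family of polynomials whose vector of values has norm less than one at each point of
the unit circle can be completed by one polynomial to a family of unit norm on the circle. -/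
theorem exists_unit_completion {ι : Type} [Fintype ι] (N : ℕ) (F : ι → ℂ[X])
    (hF : ∀ i, (F i).natDegree ≤ N)
    (h : ∀ z : ℂ, ‖z‖ = 1 → ∑ i, ‖(F i).eval z‖ ^ 2 < 1) :
    ∃ G : Option ι → ℂ[X], (∀ i, G (some i) = F i) ∧ (∀ c, (G c).natDegree ≤ N) ∧
      ∑ c, G c * conjReflect N (G c) = X ^ N := by
  obtain ⟨R, hR, hPR⟩ := exists_fejer_riesz_factor N (X ^ N - ∑ i, F i * conjReflect N (F i)) (by
      refine (natDegree_sub_le _ _).trans (max_le (by simp; omega) ?_)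
      refine natDegree_sum_le_of_forall_le _ _ fun i _ => natDegree_mul_le.trans ?_
      have := natDegree_conjReflect_le (hF i)
      have := hF i
      omega) (by
    intro z hz
    refine ⟨1 - ∑ i, ‖(F i).eval z‖ ^ 2, by linarith [h z hz], ?_⟩
    simp only [eval_sub, eval_pow, eval_X, eval_finsetSum, eval_mul]
    push_cast
    rw [sub_mul, one_mul, Finset.sum_mul]
    congr 1
    refine Finset.sum_congr rfl fun i _ => ?_
    rw [eval_conjReflect_of_norm_eq_one (hF i) hz, ← Complex.mul_conj']
    ring)
  refine ⟨fun c => c.elim R F, fun i => rfl, fun c => ?_, ?_⟩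
  · cases c with
    | none => exact hR
    | some i => exact hF i
  · rw [Fintype.sum_option]
    change R * conjReflect N R + ∑ i, F i * conjReflect N (F i) = X ^ N
    rw [← hPR]
    ring

/-- The polynomial form of Parseval's identity. -/
theorem sum_norm_coeff_sq_eq_one {ι : Type*} [Fintype ι] {N : ℕ} {F : ι → ℂ[X]}
    (h : ∑ i, F i * conjReflect N (F i) = X ^ N) :
    ∑ i, ∑ k ∈ Finset.range (N + 1), ‖(F i).coeff k‖ ^ 2 = 1 := by
  have h1 := congrArg (fun p => p.coeff N) h
  simp only [finsetSum_coeff, coeff_X_pow, if_true, coeff_mul,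
    Finset.Nat.sum_antidiagonal_eq_sum_range_succ_mk, coeff_conjReflect] at h1
  have h2 : ∀ i, ∀ k ∈ Finset.range (N + 1), (F i).coeff k * conj ((F i).coeff (revAt N (N - k))) =
      ((‖(F i).coeff k‖ ^ 2 : ℝ) : ℂ) := by
    intro i k hk
    rw [revAt_le (by omega), show N - (N - k) = k by simp at hk; omega, Complex.mul_conj']
    simp
  rw [Finset.sum_congr rfl fun i _ => Finset.sum_congr rfl (h2 i)] at h1
  exact_mod_cast h1

theorem norm_coeff_le_one {ι : Type*} [Fintype ι] {N : ℕ} {F : ι → ℂ[X]}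
    (h : ∑ i, F i * conjReflect N (F i) = X ^ N) (hF : ∀ i, (F i).natDegree ≤ N) (i : ι) (k : ℕ) :
    ‖(F i).coeff k‖ ≤ 1 := by
  rcases Nat.lt_or_ge N k with hk | hk
  · rw [coeff_eq_zero_of_natDegree_lt ((hF i).trans_lt hk)]
    simp
  have h1 := sum_norm_coeff_sq_eq_one h
  have h2 : ‖(F i).coeff k‖ ^ 2 ≤ ∑ k ∈ Finset.range (N + 1), ‖(F i).coeff k‖ ^ 2 :=
    Finset.single_le_sum (f := fun k => ‖(F i).coeff k‖ ^ 2) (fun _ _ => by positivity)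
      (by simp; omega)
  have h3 : ∑ k ∈ Finset.range (N + 1), ‖(F i).coeff k‖ ^ 2 ≤
      ∑ i, ∑ k ∈ Finset.range (N + 1), ‖(F i).coeff k‖ ^ 2 :=
    Finset.single_le_sum (f := fun i => ∑ k ∈ Finset.range (N + 1), ‖(F i).coeff k‖ ^ 2)
      (fun _ _ => by positivity) (Finset.mem_univ i)
  nlinarith [norm_nonneg ((F i).coeff k)]

theorem sum_norm_eval_sq_eq_one {ι : Type*} [Fintype ι] {N : ℕ} {F : ι → ℂ[X]}
    (h : ∑ i, F i * conjReflect N (F i) = X ^ N) (hF : ∀ i, (F i).natDegree ≤ N) {z : ℂ}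
    (hz : ‖z‖ = 1) : ∑ i, ‖(F i).eval z‖ ^ 2 = 1 := by
  have h1 := congrArg (eval z) h
  have hz0 := pow_ne_zero N (ne_zero_of_norm_eq_one hz)
  simp only [eval_finsetSum, eval_mul, eval_pow, eval_X] at h1
  have h2 : ∀ i, (F i).eval z * (conjReflect N (F i)).eval z =
      z ^ N * ((‖(F i).eval z‖ ^ 2 : ℝ) : ℂ) := by
    intro i
    rw [eval_conjReflect_of_norm_eq_one (hF i) hz]
    push_cast
    rw [← Complex.mul_conj']
    ring
  simp only [h2, ← Finset.mul_sum] at h1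
  have h3 := mul_left_cancel₀ hz0 (h1.trans (mul_one _).symm)
  exact_mod_cast h3

end

/-! ### Quantum signal processing with a coin -/

section

open Polynomial ComplexConjugate

section SignalProcessing

variable {κ : Type} [Fintype κ] [DecidableEq κ] (c₀ : κ)

/-- `Reachable c₀ N F` says that the coin state whose amplitudes are the polynomials `F c` in the
signal `X` arises from the basis state `c₀` by unitaries on the coin and at most `N` applications
of the signal controlled on the coin state `c₀`. -/
inductive Reachable : ℕ → (κ → ℂ[X]) → Prop
  | init : Reachable 0 (Pi.single c₀ 1)
  | rotate {N : ℕ} {F : κ → ℂ[X]} (U : Matrix.unitaryGroup κ ℂ) (h : Reachable N F) :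
      Reachable N fun c => ∑ c', C (U.1 c c') * F c'
  | signal {N : ℕ} {F : κ → ℂ[X]} (h : Reachable N F) :
      Reachable (N + 1) (Function.update F c₀ (X * F c₀))
  | mono {N : ℕ} {F : κ → ℂ[X]} (h : Reachable N F) : Reachable (N + 1) F

/-- Every unit vector is the first column of a unitary matrix. -/
theorem exists_unitary_column (v : κ → ℂ) (hv : ∑ c, v c * conj (v c) = 1) :
    ∃ U : Matrix.unitaryGroup κ ℂ, ∀ c, U.1 c c₀ = v c := by
  let w : EuclideanSpace ℂ κ := WithLp.toLp 2 v
  have hw : ‖w‖ = 1 := by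
    have : ‖w‖ ^ 2 = 1 := by
      rw [EuclideanSpace.norm_sq_eq]
      simp only [Complex.mul_conj'] at hv
      exact_mod_cast hv
    exact (pow_eq_one_iff_of_nonneg (norm_nonneg w) two_ne_zero).1 this
  have ho : Orthonormal ℂ (({c₀} : Set κ).domRestrict fun _ : κ => w) := by
    refine ⟨fun _ => hw, fun i j hij => (hij ?_).elim⟩
    exact Subtype.ext (i.2.trans j.2.symm)
  obtain ⟨b, hb⟩ := ho.exists_orthonormalBasis_extension_of_card_eq (by simp)
  refine ⟨⟨Matrix.of fun c c' => b c' c, ?_⟩, fun c => ?_⟩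
  · rw [Matrix.mem_unitaryGroup_iff']
    ext i j
    have := orthonormal_iff_ite.1 b.orthonormal i j
    simp only [Matrix.mul_apply, Matrix.star_apply, Matrix.of_apply, Matrix.one_apply]
    rw [← this, EuclideanSpace.inner_eq_star_dotProduct, dotProduct]
    refine Finset.sum_congr rfl fun c _ => ?_
    simp [mul_comm]
  · simp [hb c₀ rfl, w]

/-- Quantum signal processing with a coin of any dimension: every tuple of polynomials of degree at
most `N` with unit norm on the circle is reachable with `N` uses of the signal. The vectors of
leading and of constant coefficients are orthogonal. In an orthonormal basis of the coin that
contains the direction of the leading vector, only the component in that direction has full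
degree, and this component is divisible by the signal. -/
theorem reachable_of_unit (N : ℕ) : ∀ F : κ → ℂ[X], (∀ c, (F c).natDegree ≤ N) →
    ∑ c, F c * conjReflect N (F c) = X ^ N → Reachable c₀ N F := by
  induction N with
  | zero =>
    intro F hF h
    have hC : ∀ c, F c = C ((F c).coeff 0) := fun c =>
      eq_C_of_natDegree_le_zero (hF c)
    obtain ⟨U, hU⟩ := exists_unitary_column c₀ (fun c => (F c).coeff 0) (by
      have := congrArg (fun p => p.coeff 0) h
      simpa [finsetSum_coeff, mul_coeff_zero, coeff_conjReflect] using this)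
    have := Reachable.rotate U (Reachable.init (c₀ := c₀))
    convert this using 1
    funext c
    rw [hC c]
    simp [Pi.single_apply, hU]
  | succ N ih =>
    intro F hF h
    by_cases htop : ∀ c, (F c).coeff (N + 1) = 0
    · have hF' : ∀ c, (F c).natDegree ≤ N := by
        intro c
        rw [natDegree_le_iff_coeff_eq_zero]
        intro k hk
        rcases Nat.lt_or_ge (N + 1) k with h1 | h1
        · exact coeff_eq_zero_of_natDegree_lt ((hF c).trans_lt h1)
        · rw [show k = N + 1 by omega, htop]
      refine (ih F hF' ?_).mono
      apply mul_left_cancel₀ (X_ne_zero (R := ℂ))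
      rw [Finset.mul_sum, ← pow_succ', ← h]
      refine Finset.sum_congr rfl fun c _ => ?_
      rw [conjReflect_succ (hF' c)]
      ring
    · obtain ⟨d, hd⟩ := not_forall.1 htop
      let top : κ → ℂ := fun c => (F c).coeff (N + 1)
      let s : ℝ := ∑ c, ‖top c‖ ^ 2
      have hs : 0 < s := by
        have : ‖top d‖ ^ 2 ≤ s :=
          Finset.single_le_sum (f := fun c => ‖top c‖ ^ 2) (fun _ _ => by positivity)
            (Finset.mem_univ d)
        have : 0 < ‖top d‖ := norm_pos_iff.2 hd
        nlinarith
      have hs' : (Real.sqrt s : ℂ) ≠ 0 := by exact_mod_cast (Real.sqrt_pos.2 hs).ne'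
      have hsum : ∑ c, top c * conj (top c) = (s : ℂ) := by
        simp only [Complex.mul_conj', s]
        push_cast
        rfl
      obtain ⟨U, hU⟩ := exists_unitary_column c₀ (fun c => top c / Real.sqrt s) (by
        simp only [map_div₀, Complex.conj_ofReal, div_mul_div_comm]
        rw [← Finset.sum_div, hsum, ← Complex.ofReal_mul, Real.mul_self_sqrt hs.le]
        exact div_self (by exact_mod_cast hs.ne'))
      have hUU : ∀ i j, ∑ c, conj (U.1 c i) * U.1 c j = if i = j then 1 else 0 := by
        intro i j
        have := congrFun (congrFun (Matrix.mem_unitaryGroup_iff'.1 U.2) i) j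
        simpa [Matrix.mul_apply, Matrix.one_apply] using this
      have hUU' : ∀ i j, ∑ c, U.1 i c * conj (U.1 j c) = if i = j then 1 else 0 := by
        intro i j
        have := congrFun (congrFun (Matrix.mem_unitaryGroup_iff.1 U.2) i) j
        simpa [Matrix.mul_apply, Matrix.one_apply] using this
      -- The family in the coordinates of the new basis of the coin.
      let G : κ → ℂ[X] := fun c => ∑ c', C (conj (U.1 c' c)) * F c'
      have hG : ∀ c, (G c).natDegree ≤ N + 1 := fun c =>
        natDegree_sum_le_of_forall_le _ _ fun c' _ => (natDegree_C_mul_le _ _).trans (hF c')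
      have hGF : ∀ c, F c = ∑ c', C (U.1 c c') * G c' := by
        intro c
        simp only [G, Finset.mul_sum, ← mul_assoc, ← C_mul]
        rw [Finset.sum_comm]
        simp only [← Finset.sum_mul, ← map_sum, hUU']
        simp
      have hGsum : ∑ c, G c * conjReflect (N + 1) (G c) = X ^ (N + 1) := by
        have h1 : ∀ c, G c * conjReflect (N + 1) (G c) = ∑ a, ∑ b,
            C (U.1 b c * conj (U.1 a c)) * (F a * conjReflect (N + 1) (F b)) := by
          intro c
          simp only [G, conjReflect_sum, conjReflect_C_mul, Complex.conj_conj,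
            Finset.sum_mul_sum, C_mul]
          refine Finset.sum_congr rfl fun a _ => Finset.sum_congr rfl fun b _ => by ring
        rw [Finset.sum_congr rfl fun c _ => h1 c, Finset.sum_comm, ← h]
        refine Finset.sum_congr rfl fun a _ => ?_
        rw [Finset.sum_comm]
        simp only [← Finset.sum_mul, ← map_sum, hUU']
        simp
      -- The coefficient `0` of the unit norm identity is the orthogonality of the constant and the
      -- leading coefficients.
      have hG0 : (G c₀).coeff 0 = 0 := by
        have h1 := congrArg (fun p => p.coeff 0) h
        simp only [finsetSum_coeff, mul_coeff_zero, coeff_conjReflect, revAt_zero,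
          coeff_X_pow] at h1
        simp only [G, finsetSum_coeff, coeff_C_mul, hU, map_div₀, Complex.conj_ofReal]
        have h2 : ∑ c, (F c).coeff 0 * conj (top c) = 0 := by simpa using h1
        calc _ = (∑ c, (F c).coeff 0 * conj (top c)) / Real.sqrt s := by
              rw [Finset.sum_div]
              exact Finset.sum_congr rfl fun c _ => by ring
          _ = 0 := by rw [h2, zero_div]
      have hGtop : ∀ c, c ≠ c₀ → (G c).coeff (N + 1) = 0 := by
        intro c hc
        simp only [G, finsetSum_coeff, coeff_C_mul]
        have h1 : ∀ c', (F c').coeff (N + 1) = U.1 c' c₀ * Real.sqrt s := by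
          intro c'
          rw [hU, div_mul_cancel₀ _ hs']
        simp only [h1, ← mul_assoc]
        rw [← Finset.sum_mul, hUU, if_neg hc, zero_mul]
      obtain ⟨Q, hQ⟩ := X_dvd_iff.2 hG0
      have hGdeg : ∀ c, c ≠ c₀ → (G c).natDegree ≤ N := by
        intro c hc
        rw [natDegree_le_iff_coeff_eq_zero]
        intro k hk
        rcases Nat.lt_or_ge (N + 1) k with h1 | h1
        · exact coeff_eq_zero_of_natDegree_lt ((hG c).trans_lt h1)
        · rw [show k = N + 1 by omega, hGtop c hc]
      have hQdeg : Q.natDegree ≤ N := by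
        rw [natDegree_le_iff_coeff_eq_zero]
        intro k hk
        rw [← coeff_X_mul, ← hQ]
        exact coeff_eq_zero_of_natDegree_lt ((hG c₀).trans_lt (by omega))
      -- Undoing one use of the signal.
      let G' : κ → ℂ[X] := Function.update G c₀ Q
      have hG'deg : ∀ c, (G' c).natDegree ≤ N := by
        intro c
        by_cases hc : c = c₀
        · subst hc; simpa [G'] using hQdeg
        · simpa [G', hc] using hGdeg c hc
      have hG'sum : ∑ c, G' c * conjReflect N (G' c) = X ^ N := by
        apply mul_left_cancel₀ (X_ne_zero (R := ℂ))
        rw [Finset.mul_sum, ← pow_succ', ← hGsum]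
        refine Finset.sum_congr rfl fun c _ => ?_
        by_cases hc : c = c₀
        · subst hc
          rw [hQ, conjReflect_X_mul hQdeg]
          simp [G']
          ring
        · simp only [G', Function.update_of_ne hc]
          rw [conjReflect_succ (hGdeg c hc)]
          ring
      have hreach := (Reachable.signal (ih G' hG'deg hG'sum)).rotate U
      have hupd : Function.update G' c₀ (X * G' c₀) = G := by
        simp [G', ← hQ]
      rw [hupd] at hreach
      convert hreach using 1
      funext c
      exact hGF c

end SignalProcessing

end

/-! ### Polynomial approximations of the sign function -/

section

open Polynomial ComplexConjugate

theorem exists_antiderivative (k : ℝ[X]) :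
    ∃ G : ℝ[X], derivative G = k ∧ G.eval 0 = 0 ∧ G.natDegree ≤ k.natDegree + 1 := by
  refine ⟨∑ i ∈ Finset.range (k.natDegree + 1), C (k.coeff i / (i + 1)) * X ^ (i + 1), ?_, ?_, ?_⟩
  · conv_rhs => rw [k.as_sum_range_C_mul_X_pow]
    rw [derivative_sum]
    refine Finset.sum_congr rfl fun i _ => ?_
    rw [derivative_C_mul_X_pow]
    have : (i + 1 : ℝ) ≠ 0 := by positivity
    simp [div_mul_cancel₀ _ this]
  · simp [eval_finsetSum]
  · refine natDegree_sum_le_of_forall_le _ _ fun i hi => (natDegree_C_mul_X_pow_le _ _).trans ?_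
    simp at hi
    omega

/-- The normalized antiderivative of a nonnegative even polynomial is a polynomial step: it is
odd, increases from `-1` to `1` on `[-1, 1]`, and is close to `1` where the antiderivative has
almost reached its final value. -/
theorem exists_step (k : ℝ[X]) (heven : ∀ u, k.eval (-u) = k.eval u)
    (hk : ∀ u, |u| ≤ 1 → 0 ≤ k.eval u)
    (τ θ : ℝ) (hτ : 0 < τ)
    (hmass : ∀ G : ℝ[X], derivative G = k → MonotoneOn (fun u => G.eval u) (Set.Icc (-1) 1) →
      τ ≤ G.eval 1 - G.eval 0)
    (v₀ : ℝ) (hv₀ : v₀ ∈ Set.Icc (0 : ℝ) 1)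
    (htail : ∀ G : ℝ[X], derivative G = k → G.eval 1 - G.eval v₀ ≤ θ) :
    ∃ g : ℝ[X], g.natDegree ≤ k.natDegree + 1 ∧ (∀ u, |u| ≤ 1 → |g.eval u| ≤ 1) ∧
      (∀ u, g.eval (-u) = -g.eval u) ∧
      ∀ u, v₀ ≤ u → u ≤ 1 → 1 - θ / τ ≤ g.eval u := by
  obtain ⟨G, hG, hG0, hGdeg⟩ := exists_antiderivative k
  have hodd : ∀ u, G.eval (-u) = -G.eval u := by
    have hcomp : G.comp (-X) + G = 0 := by
      have hd : derivative (G.comp (-X) + G) = 0 := by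
        rw [derivative_add, derivative_comp, hG]
        refine Polynomial.funext fun u => ?_
        simp [eval_comp, heven]
      have h2 := derivative_eq_zero.1 hd
      rw [eq_C_of_natDegree_eq_zero h2, coeff_zero_eq_eval_zero]
      simp [eval_comp, hG0]
    intro u
    have := congrArg (eval u) hcomp
    simp [eval_comp] at this
    linarith
  have hmono : MonotoneOn (fun u => G.eval u) (Set.Icc (-1) 1) := by
    refine monotoneOn_of_deriv_nonneg (convex_Icc _ _) G.continuous.continuousOn
      G.differentiable.differentiableOn fun u hu => ?_
    rw [Polynomial.deriv, hG]
    rw [interior_Icc] at hu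
    exact hk u (abs_le.2 ⟨hu.1.le, hu.2.le⟩)
  have hG1 : τ ≤ G.eval 1 := by simpa [hG0] using hmass G hG hmono
  have hG1pos : 0 < G.eval 1 := hτ.trans_le hG1
  refine ⟨C (G.eval 1)⁻¹ * G, (natDegree_C_mul_le _ _).trans hGdeg, fun u hu => ?_, fun u => ?_,
    fun u hu hu1 => ?_⟩
  · have hu' := abs_le.1 hu
    have h1 : G.eval u ≤ G.eval 1 := hmono ⟨hu'.1, hu'.2⟩ ⟨by norm_num, le_rfl⟩ hu'.2
    have h2 : G.eval (-1) ≤ G.eval u := hmono ⟨le_rfl, by norm_num⟩ ⟨hu'.1, hu'.2⟩ hu'.1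
    rw [hodd] at h2
    rw [eval_mul, eval_C, abs_mul, abs_inv, abs_of_pos hG1pos, inv_mul_le_iff₀ hG1pos, mul_one]
    exact abs_le.2 ⟨h2, h1⟩
  · simp [hodd]
  · have h1 : G.eval v₀ ≤ G.eval u :=
      hmono ⟨by linarith [hv₀.1], hv₀.2⟩ ⟨by linarith [hv₀.1], hu1⟩ hu
    have h2 := htail G hG
    have hθ : 0 ≤ θ := by
      refine le_trans ?_ h2
      have : G.eval v₀ ≤ G.eval 1 :=
        hmono ⟨by linarith [hv₀.1], hv₀.2⟩ ⟨by norm_num, le_rfl⟩ hv₀.2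
      linarith
    have h3 : θ / G.eval 1 ≤ θ / τ := by gcongr
    rw [eval_mul, eval_C]
    have h4 : 1 - θ / G.eval 1 ≤ (G.eval 1)⁻¹ * G.eval u := by
      rw [← sub_nonneg]
      have : (G.eval 1)⁻¹ * G.eval u - (1 - θ / G.eval 1) =
        (G.eval 1)⁻¹ * (θ - (G.eval 1 - G.eval u)) := by
        field_simp
        ring
      rw [this]
      exact mul_nonneg (inv_nonneg.2 hG1pos.le) (by linarith)
    linarith

theorem increment_le_of_deriv_le {f g f' g' : ℝ → ℝ} {a b : ℝ} (hab : a ≤ b)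
    (hf : ContinuousOn f (Set.Icc a b)) (hg : ContinuousOn g (Set.Icc a b))
    (hf' : ∀ u ∈ Set.Ioo a b, HasDerivAt f (f' u) u)
    (hg' : ∀ u ∈ Set.Ioo a b, HasDerivAt g (g' u) u)
    (h : ∀ u ∈ Set.Ioo a b, f' u ≤ g' u) : f b - f a ≤ g b - g a := by
  have hmono : MonotoneOn (fun u => g u - f u) (Set.Icc a b) := by
    refine monotoneOn_of_deriv_nonneg (convex_Icc _ _) (hg.sub hf) (fun u hu => ?_) fun u hu => ?_
    · rw [interior_Icc] at hu
      exact ((hg' u hu).sub (hf' u hu)).differentiableAt.differentiableWithinAt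
    · rw [interior_Icc] at hu
      rw [show (fun u => g u - f u) = g - f from rfl, ((hg' u hu).sub (hf' u hu)).deriv]
      linarith [h u hu]
  have := hmono ⟨le_rfl, hab⟩ ⟨hab, le_rfl⟩ hab
  simp only at this
  linarith

/-- A step of high quality: for `n` large, the normalized antiderivative of `(1 - u²)ⁿ` is
exponentially close to the sign function away from the origin. -/
theorem exists_sharp_step (n : ℕ) (v₀ : ℝ) (hv₀ : v₀ ∈ Set.Icc (0 : ℝ) 1) :
    ∃ g : ℝ[X], g.natDegree ≤ 2 * n + 1 ∧ (∀ u, |u| ≤ 1 → |g.eval u| ≤ 1) ∧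
      (∀ u, g.eval (-u) = -g.eval u) ∧
      ∀ u, v₀ ≤ u → u ≤ 1 → 1 - (n + 1) * (1 - v₀ ^ 2) ^ n ≤ g.eval u := by
  have hpos : (0 : ℝ) < n + 1 := by positivity
  obtain ⟨g, h1, h2, h3, h4⟩ := exists_step ((1 - X ^ 2) ^ n) (by simp) (by
      intro u hu
      have : u ^ 2 ≤ 1 := by rw [sq_le_one_iff_abs_le_one]; exact hu
      simp only [eval_pow, eval_sub, eval_one, eval_X]
      exact pow_nonneg (by linarith) n)
    (1 / (n + 1)) ((1 - v₀ ^ 2) ^ n) (by positivity) (by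
      intro G hG hmono
      have := increment_le_of_deriv_le (f := fun u => -((1 - u) ^ (n + 1) / (n + 1)))
        (f' := fun u => (1 - u) ^ n) (g := fun u => G.eval u)
        (g' := fun u => (derivative G).eval u) (a := 0) (b := 1) zero_le_one (by fun_prop)
        G.continuous.continuousOn (by
          intro u _
          have h := ((((hasDerivAt_id' u).const_sub 1).fun_pow (n + 1)).div_const
            (n + 1 : ℝ)).fun_neg
          refine h.congr_deriv ?_
          push_cast
          field_simp) (fun u _ => G.hasDerivAt u) (by
          intro u hu
          rw [hG]
          simp only [eval_pow, eval_sub, eval_one, eval_X]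
          have hu1 : u ^ 2 ≤ u := by nlinarith [hu.1, hu.2]
          exact pow_le_pow_left₀ (by linarith [hu.2]) (by linarith) n)
      simpa using this)
    v₀ hv₀ (by
      intro G hG
      have := increment_le_of_deriv_le (g := fun u => (1 - v₀ ^ 2) ^ n * u)
        (g' := fun _ => (1 - v₀ ^ 2) ^ n) (f := fun u => G.eval u)
        (f' := fun u => (derivative G).eval u) (a := v₀) (b := 1) hv₀.2
        G.continuous.continuousOn (by fun_prop) (fun u _ => G.hasDerivAt u)
        (fun u _ => by simpa using (hasDerivAt_id u).const_mul ((1 - v₀ ^ 2) ^ n)) (by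
          intro u hu
          rw [hG]
          simp only [eval_pow, eval_sub, eval_one, eval_X]
          refine pow_le_pow_left₀ ?_ ?_ n <;> nlinarith [hu.1, hu.2, hv₀.1])
      refine this.trans ?_
      have h0 : 0 ≤ (1 - v₀ ^ 2) ^ n := pow_nonneg (by nlinarith [hv₀.1, hv₀.2]) n
      nlinarith [hv₀.1])
  refine ⟨g, h1.trans ?_, h2, h3, fun u hu hu1 => ?_⟩
  · have : ((1 - X ^ 2 : ℝ[X]) ^ n).natDegree ≤ n * 2 := by
      refine natDegree_pow_le_of_le n ((natDegree_sub_le _ _).trans ?_)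
      simp
    omega
  · have := h4 u hu hu1
    rwa [div_div_eq_mul_div, div_one, mul_comm] at this

open Polynomial.Chebyshev in
theorem sq_eval_T_sin (M : ℕ) (θ : ℝ) :
    (T ℝ (2 * M + 1 : ℕ)).eval (Real.sin θ) ^ 2 = Real.sin ((2 * M + 1) * θ) ^ 2 := by
  rw [← Real.cos_pi_div_two_sub, T_real_cos]
  have : (((2 * M + 1 : ℕ) : ℤ) : ℝ) * (Real.pi / 2 - θ) =
      (Real.pi / 2 - (2 * M + 1) * θ) + M * Real.pi := by
    push_cast
    ring
  rw [this, Real.cos_add_nat_mul_pi, Real.cos_pi_div_two_sub, mul_pow, ← pow_mul, mul_comm M 2,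
    pow_mul]
  simp

open Polynomial.Chebyshev in
/-- A step of constant quality and width `v₀`, of degree `O(1 / v₀)`: the normalized antiderivative
of the kernel `(T_N(u) / (N u))²`, where `T_N` is a Chebyshev polynomial of odd degree. This kernel
is at least `1 / 4` for `|u| ≤ 1 / N`, and at most `1 / (N u)²` everywhere. -/
theorem exists_wide_step (M : ℕ) (v₀ : ℝ) (hv₀ : 0 < v₀) (hv₁ : v₀ ≤ 1) :
    ∃ g : ℝ[X], g.natDegree ≤ 4 * M + 1 ∧ (∀ u, |u| ≤ 1 → |g.eval u| ≤ 1) ∧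
      (∀ u, g.eval (-u) = -g.eval u) ∧
      ∀ u, v₀ ≤ u → u ≤ 1 → 1 - 4 / ((2 * M + 1) * v₀) ≤ g.eval u := by
  set N : ℝ := 2 * M + 1 with hN
  have hNpos : 0 < N := by positivity
  have hN1 : 1 ≤ N := by rw [hN]; linarith [(Nat.cast_nonneg M : (0 : ℝ) ≤ M)]
  have hroot : (T ℝ (2 * M + 1 : ℕ)).coeff 0 = 0 := by
    rw [coeff_zero_eq_eval_zero]
    simp
  obtain ⟨D, hD⟩ := X_dvd_iff.2 hroot
  have hTD : ∀ u, (T ℝ (2 * M + 1 : ℕ)).eval u = u * D.eval u := fun u => by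
    rw [hD]; simp
  have hDdeg : D.natDegree ≤ 2 * M := by
    have h1 : (T ℝ (2 * M + 1 : ℕ)).natDegree = 2 * M + 1 := by
      simp [natDegree_T]
      omega
    by_cases h0 : D = 0
    · simp [h0]
    · rw [hD, natDegree_X_mul h0] at h1
      omega
  have hparity : ∀ u, D.eval (-u) ^ 2 = D.eval u ^ 2 := by
    have hpoly : (D.comp (-X)) ^ 2 = D ^ 2 := by
      have hX : (X : ℝ[X]) ^ 2 ≠ 0 := pow_ne_zero _ X_ne_zero
      apply mul_left_cancel₀ hX
      refine eq_of_infinite_eval_eq _ _ ((Set.Icc_infinite (show (-1 : ℝ) < 1 by norm_num)).mono ?_)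
      intro u hu
      have h1 := sq_eval_T_sin M (Real.arcsin u)
      have h2 := sq_eval_T_sin M (Real.arcsin (-u))
      rw [Real.sin_arcsin hu.1 hu.2, hTD] at h1
      rw [Real.sin_arcsin (by linarith [hu.2]) (by linarith [hu.1]), Real.arcsin_neg, mul_neg,
        Real.sin_neg, hTD] at h2
      simp only [Set.mem_ofPred_eq, eval_mul, eval_pow, eval_X, eval_comp, eval_neg]
      nlinarith
    intro u
    have := congrArg (eval u) hpoly
    simpa [eval_comp] using this
  have hupper : ∀ u, 0 < u → u ≤ 1 → D.eval u ^ 2 ≤ 1 / u ^ 2 := by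
    intro u hu hu1
    have := abs_eval_T_real_le_one ((2 * M + 1 : ℕ) : ℤ) (x := u) (abs_le.2 ⟨by linarith, hu1⟩)
    rw [hTD, ← sq_le_one_iff_abs_le_one, mul_pow] at this
    rw [le_div_iff₀ (by positivity)]
    linarith
  have hlower : ∀ u, 0 < u → u ≤ 1 / N → N ^ 2 / 4 ≤ D.eval u ^ 2 := by
    intro u hu hu1
    have hu2 : u ≤ 1 := hu1.trans (by rw [div_le_one hNpos]; exact hN1)
    set θ := Real.arcsin u with hθ
    have hsin : Real.sin θ = u := Real.sin_arcsin (by linarith) hu2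
    have hθ0 : 0 < θ := Real.arcsin_pos.2 hu
    have hθ1 : θ ≤ Real.pi / 2 := Real.arcsin_le_pi_div_two u
    have h1 : u ≤ θ := by rw [← hsin]; exact Real.sin_le hθ0.le
    have h2 : 2 / Real.pi * θ ≤ u := by rw [← hsin]; exact Real.mul_le_sin hθ0.le hθ1
    have hpi := Real.pi_pos
    have hpi4 : Real.pi ≤ 4 := Real.pi_le_four
    have h3 : N * θ ≤ Real.pi / 2 := by
      have : N * u ≤ 1 := by rwa [le_div_iff₀ hNpos, mul_comm] at hu1
      have h5 : N * (2 / Real.pi * θ) ≤ 1 := (mul_le_mul_of_nonneg_left h2 hNpos.le).trans this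
      have h6 : N * (2 / Real.pi * θ) = (N * θ) / (Real.pi / 2) := by field_simp
      rw [h6, div_le_one (by positivity)] at h5
      exact h5
    have h4 : 2 / Real.pi * (N * θ) ≤ Real.sin (N * θ) := Real.mul_le_sin (by positivity) h3
    have h5 : (1 / 2) * (N * u) ≤ Real.sin (N * θ) := by
      refine le_trans ?_ h4
      have h7 : (1 : ℝ) / 2 ≤ 2 / Real.pi := by
        rw [div_le_div_iff₀ two_pos hpi]
        linarith
      gcongr
    have h8 := sq_eval_T_sin M θ
    rw [hsin, hTD, ← hN] at h8
    have h9 : ((1 / 2) * (N * u)) ^ 2 ≤ (u * D.eval u) ^ 2 := by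
      rw [h8]
      exact pow_le_pow_left₀ (by positivity) h5 2
    have h10 : 0 < u ^ 2 := by positivity
    have h11 : u ^ 2 * (N ^ 2 / 4) ≤ u ^ 2 * D.eval u ^ 2 := by
      calc _ = ((1 / 2) * (N * u)) ^ 2 := by ring
        _ ≤ _ := h9
        _ = _ := by ring
    exact le_of_mul_le_mul_left h11 h10
  obtain ⟨g, h1, h2, h3, h4⟩ := exists_step (D ^ 2) (by simpa using hparity)
    (fun u _ => by rw [eval_pow]; positivity) (N / 4) (1 / v₀) (by positivity) (by
      intro G hG hmono
      have hle : (0 : ℝ) ≤ 1 / N := by positivity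
      have hle1 : 1 / N ≤ 1 := by rw [div_le_one hNpos]; exact hN1
      have := increment_le_of_deriv_le (f := fun u => N ^ 2 / 4 * u)
        (f' := fun _ => N ^ 2 / 4) (g := fun u => G.eval u)
        (g' := fun u => (derivative G).eval u) (a := 0) (b := 1 / N) hle (by fun_prop)
        G.continuous.continuousOn
        (fun u _ => by simpa using (hasDerivAt_id u).const_mul (N ^ 2 / 4))
        (fun u _ => G.hasDerivAt u) (by
          intro u hu
          rw [hG, eval_pow]
          exact hlower u hu.1 hu.2.le)
      have h5 : G.eval (1 / N) ≤ G.eval 1 :=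
        hmono ⟨by linarith, hle1⟩ ⟨by norm_num, le_rfl⟩ hle1
      have h6 : N ^ 2 / 4 * (1 / N) = N / 4 := by field_simp
      linarith)
    v₀ ⟨hv₀.le, hv₁⟩ (by
      intro G hG
      have := increment_le_of_deriv_le (g := fun u => -u⁻¹)
        (g' := fun u => (u ^ 2)⁻¹) (f := fun u => G.eval u)
        (f' := fun u => (derivative G).eval u) (a := v₀) (b := 1) hv₁
        G.continuous.continuousOn (by
          refine (continuousOn_inv₀.mono ?_).neg
          intro u hu
          exact (hv₀.trans_le hu.1).ne')
        (fun u _ => G.hasDerivAt u)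
        (fun u hu => by simpa using (hasDerivAt_inv (hv₀.trans hu.1).ne').fun_neg) (by
          intro u hu
          rw [hG, eval_pow, ← one_div]
          exact hupper u (hv₀.trans hu.1) hu.2.le)
      rw [one_div]
      linarith)
  refine ⟨g, h1.trans ?_, h2, h3, fun u hu hu1 => ?_⟩
  · have := natDegree_pow_le_of_le 2 hDdeg
    omega
  · have := h4 u hu hu1
    have h5 : 1 / v₀ / (N / 4) = 4 / (N * v₀) := by field_simp
    rwa [h5] at this

/-- A polynomial of degree `O(1 / φ)` that separates the three regions of gapped phase estimation
with constant quality. -/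
theorem exists_three_level_poly (φ : ℝ) (h0 : 0 < φ) (h1 : φ < 1) :
    ∃ x : ℝ[X], (x.natDegree : ℝ) ≤ 520 / φ ∧ (∀ t, |t| ≤ 1 → |x.eval t| ≤ 1) ∧
      (∀ t ∈ Set.Icc φ 1, 7 / 8 ≤ x.eval t) ∧
      (∀ t ∈ Set.Icc (-(φ / 2)) (φ / 2), |x.eval t| ≤ 1 / 8) ∧
      ∀ t ∈ Set.Icc (-1) (-φ), x.eval t ≤ -(7 / 8) := by
  set M := ⌈128 / φ⌉₊ with hM
  have hM1 : 128 / φ ≤ M := Nat.le_ceil _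
  have hM2 : (M : ℝ) < 128 / φ + 1 := Nat.ceil_lt_add_one (by positivity)
  obtain ⟨g, hg1, hg2, hg3, hg4⟩ := exists_wide_step M (φ / 8) (by positivity) (by linarith)
  have hq : 4 / ((2 * M + 1) * (φ / 8)) ≤ 1 / 8 := by
    rw [div_le_iff₀ h0] at hM1
    rw [div_le_div_iff₀ (by positivity) (by norm_num)]
    nlinarith
  have hg5 : ∀ u, φ / 8 ≤ u → u ≤ 1 → 7 / 8 ≤ g.eval u := fun u hu hu1 => by
    linarith [hg4 u hu hu1]
  have hg6 : ∀ u, u ≤ -(φ / 8) → -1 ≤ u → g.eval u ≤ -(7 / 8) := fun u hu hu1 => by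
    have := hg5 (-u) (by linarith) (by linarith)
    rw [hg3] at this
    linarith
  -- Two steps of width `φ / 8`, at `3 φ / 4` and at `-3 φ / 4`; the halved arguments stay
  -- in `[-1, 1]`.
  let x : ℝ[X] := C (1 / 2) * (g.comp (C (1 / 2) * (X - C (3 * φ / 4))) +
    g.comp (C (1 / 2) * (X + C (3 * φ / 4))))
  have hx : ∀ t, x.eval t =
      (g.eval ((t - 3 * φ / 4) / 2) + g.eval ((t + 3 * φ / 4) / 2)) / 2 := by
    intro t
    simp only [x, eval_mul, eval_C, eval_add, eval_comp, eval_sub, eval_X]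
    rw [show 1 / 2 * (t - 3 * φ / 4) = (t - 3 * φ / 4) / 2 by ring,
      show 1 / 2 * (t + 3 * φ / 4) = (t + 3 * φ / 4) / 2 by ring]
    ring
  have hb : ∀ u, -1 ≤ u → u ≤ 1 → -1 ≤ g.eval u ∧ g.eval u ≤ 1 := fun u hu hu' =>
    abs_le.1 (hg2 u (abs_le.2 ⟨hu, hu'⟩))
  refine ⟨x, ?_, ?_, ?_, ?_, ?_⟩
  · have hd : x.natDegree ≤ 4 * M + 1 := by
      refine (natDegree_C_mul_le _ _).trans ((natDegree_add_le _ _).trans (max_le ?_ ?_))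
      · refine natDegree_comp_le.trans ?_
        have : (C (1 / 2) * (X - C (3 * φ / 4)) : ℝ[X]).natDegree ≤ 1 :=
          (natDegree_C_mul_le _ _).trans (natDegree_X_sub_C_le _)
        nlinarith
      · refine natDegree_comp_le.trans ?_
        have : (C (1 / 2) * (X + C (3 * φ / 4)) : ℝ[X]).natDegree ≤ 1 :=
          (natDegree_C_mul_le _ _).trans (by rw [natDegree_X_add_C])
        nlinarith
    have hd' : (x.natDegree : ℝ) ≤ 4 * M + 1 := by exact_mod_cast hd
    have h8 : 1 ≤ 1 / φ := by rw [le_div_iff₀ h0]; linarith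
    calc (x.natDegree : ℝ) ≤ 4 * (128 / φ + 1) + 1 := by linarith
      _ ≤ 520 / φ := by
        rw [show 520 / φ = 520 * (1 / φ) by ring, show 128 / φ = 128 * (1 / φ) by ring]
        linarith
  · intro t ht
    rw [hx]
    have ht' := abs_le.1 ht
    have h2 := hb ((t - 3 * φ / 4) / 2) (by linarith) (by linarith)
    have h3 := hb ((t + 3 * φ / 4) / 2) (by linarith) (by linarith)
    exact abs_le.2 ⟨by linarith, by linarith⟩
  · intro t ht
    rw [hx]
    have h2 := hg5 ((t - 3 * φ / 4) / 2) (by linarith [ht.1]) (by linarith [ht.2])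
    have h3 := hg5 ((t + 3 * φ / 4) / 2) (by linarith [ht.1]) (by linarith [ht.2])
    linarith
  · intro t ht
    rw [hx]
    have h2 := hg6 ((t - 3 * φ / 4) / 2) (by linarith [ht.2]) (by linarith [ht.1])
    have h3 := hg5 ((t + 3 * φ / 4) / 2) (by linarith [ht.1]) (by linarith [ht.2])
    have h4 := hb ((t - 3 * φ / 4) / 2) (by linarith [ht.1]) (by linarith [ht.2])
    have h5 := hb ((t + 3 * φ / 4) / 2) (by linarith [ht.1]) (by linarith [ht.2])
    exact abs_le.2 ⟨by linarith, by linarith⟩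
  · intro t ht
    rw [hx]
    have h2 := hg6 ((t - 3 * φ / 4) / 2) (by linarith [ht.2]) (by linarith [ht.1])
    have h3 := hg6 ((t + 3 * φ / 4) / 2) (by linarith [ht.2]) (by linarith [ht.1])
    linarith

end

/-! ### Homogenization and approximation of trigonometric polynomials -/

section

open Polynomial ComplexConjugate

/-- For `p` of degree at most `d`, the polynomial whose value at an invertible `w` is
`w ^ d * p (q(w) / w)`. -/
noncomputable def homogenize (d : ℕ) (p q : ℂ[X]) : ℂ[X] :=
  ∑ k ∈ Finset.range (d + 1), C (p.coeff k) * q ^ k * X ^ (d - k)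

theorem natDegree_homogenize_le (d : ℕ) (p : ℂ[X]) {q : ℂ[X]} (hq : q.natDegree ≤ 2) :
    (homogenize d p q).natDegree ≤ 2 * d := by
  refine natDegree_sum_le_of_forall_le _ _ fun k hk => ?_
  have hk' : k ≤ d := by simpa [Nat.lt_succ_iff] using hk
  have h1 := natDegree_pow_le_of_le k hq
  have h2 : (C (p.coeff k) * q ^ k).natDegree ≤ k * 2 := (natDegree_C_mul_le _ _).trans h1
  refine natDegree_mul_le.trans ?_
  rw [natDegree_X_pow]
  omega

theorem aeval_homogenize {A : Type*} [Ring A] [Algebra ℂ A] {d : ℕ} {p : ℂ[X]}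
    (hp : p.natDegree ≤ d) (q : ℂ[X]) {w w' : A} (h : w * w' = 1) (h' : w' * w = 1) :
    aeval w (homogenize d p q) = w ^ d * aeval (aeval w q * w') p := by
  have hcomm : Commute w w' := h.trans h'.symm
  have hq : Commute (aeval w q) w := by
    have := (Commute.all q X).map (aeval w)
    rwa [aeval_X] at this
  have hq' : Commute (aeval w q) w' := by
    calc aeval w q * w' = w' * w * (aeval w q) * w' := by rw [h', one_mul]
      _ = w' * (aeval w q * (w * w')) := by rw [mul_assoc w', ← hq.eq]; simp only [mul_assoc]
      _ = w' * aeval w q := by rw [h, mul_one]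
  rw [aeval_eq_sum_range' (Nat.lt_succ_of_le hp), homogenize, map_sum, Finset.mul_sum]
  refine Finset.sum_congr rfl fun k hk => ?_
  have hk' : k ≤ d := by simpa [Nat.lt_succ_iff] using hk
  have h1 : w ^ (d - k) = w ^ d * w' ^ k := by
    conv_rhs => rw [← Nat.sub_add_cancel hk', pow_add, mul_assoc, ← hcomm.mul_pow, h, one_pow,
      mul_one]
  rw [map_mul, map_mul, aeval_C, map_pow, map_pow, aeval_X, hq'.mul_pow, h1, mul_smul_comm,
    Algebra.smul_def, mul_assoc]
  congr 1
  rw [← mul_assoc, (hq.pow_pow k d).eq, mul_assoc]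

theorem eval_homogenize {d : ℕ} {p : ℂ[X]} (hp : p.natDegree ≤ d) (q : ℂ[X]) {z : ℂ}
    (hz : z ≠ 0) : (homogenize d p q).eval z = z ^ d * p.eval (q.eval z / z) := by
  have := aeval_homogenize (A := ℂ) hp q (mul_inv_cancel₀ hz) (inv_mul_cancel₀ hz)
  simpa only [coe_aeval_eq_eval, div_eq_mul_inv] using this

/-- The Taylor polynomial of degree `6 D - 1` of the exponential function has error at most
`2 · 2⁻⁶ᴰ` on the disk of radius `D`. -/
theorem norm_exp_sub_taylor_le (D : ℕ) (z : ℂ) (hz : ‖z‖ ≤ D) :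
    ‖Complex.exp z - ∑ m ∈ Finset.range (6 * D), z ^ m / m.factorial‖ ≤ 2 * (1 / 2) ^ (6 * D) := by
  rcases Nat.eq_zero_or_pos D with rfl | hD
  · have : z = 0 := by simpa using hz
    simp [this]
  have hD' : (0 : ℝ) < D := by exact_mod_cast hD
  refine (Complex.exp_bound' ?_).trans ?_
  · rw [div_le_iff₀ (by positivity)]
    push_cast
    linarith
  · have h1 : ((6 * D : ℕ) : ℝ) ^ (6 * D) / (6 * D).factorial ≤ Real.exp (6 * D : ℕ) :=
      Real.pow_div_factorial_le_exp _ (by positivity) _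
    have h2 : Real.exp (6 * D : ℕ) ≤ 3 ^ (6 * D) := by
      rw [← mul_one ((6 * D : ℕ) : ℝ), Real.exp_nat_mul]
      gcongr
      linarith [Real.exp_one_lt_d9]
    have h3 : ((6 * D : ℕ) : ℝ) ^ (6 * D) = 6 ^ (6 * D) * (D : ℝ) ^ (6 * D) := by
      push_cast
      rw [mul_pow]
    have h4 : (D : ℝ) ^ (6 * D) / (6 * D).factorial ≤ (1 / 2) ^ (6 * D) := by
      have h5 : (6 : ℝ) ^ (6 * D) * ((D : ℝ) ^ (6 * D) / (6 * D).factorial) ≤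
          6 ^ (6 * D) * (1 / 2) ^ (6 * D) := by
        rw [← mul_pow, show (6 * (1 / 2) : ℝ) = 3 by norm_num, ← mul_div_assoc, ← h3]
        exact h1.trans h2
      exact le_of_mul_le_mul_left h5 (by positivity)
    have h6 : ‖z‖ ^ (6 * D) / (6 * D).factorial ≤ (D : ℝ) ^ (6 * D) / (6 * D).factorial := by
      gcongr
    linarith

/-- A trigonometric polynomial with frequencies in `[-D, D]` and coefficients of absolute value at
most one is approximated on `[-1, 1]`, up to `2⁻ᴰ`, by a polynomial of degree less than `6 D`. -/
theorem exists_poly_near_trig {D : ℕ} (hD : 0 < D) (P : ℂ[X]) (hP : P.natDegree ≤ D)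
    (hcoeff : ∀ k, ‖P.coeff k‖ ≤ 1) (s : ℕ) (hs : s ≤ D) :
    ∃ T : ℂ[X], T.natDegree ≤ 6 * D ∧ ∀ x : ℝ, |x| ≤ 1 →
      ‖T.eval (x : ℂ) -
        (Complex.exp (x * Complex.I) ^ s)⁻¹ * P.eval (Complex.exp (x * Complex.I))‖ ≤
          (1 / 2) ^ D := by
  let E : ℂ → ℂ[X] := fun a => ∑ m ∈ Finset.range (6 * D), C (a ^ m / m.factorial) * X ^ m
  have hE : ∀ a x : ℂ, (E a).eval x = ∑ m ∈ Finset.range (6 * D), (a * x) ^ m / m.factorial := by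
    intro a x
    simp only [E, eval_finsetSum, eval_mul, eval_C, eval_pow, eval_X]
    exact Finset.sum_congr rfl fun m _ => by ring
  refine ⟨∑ k ∈ Finset.range (D + 1), C (P.coeff k) * E (((k : ℝ) - s : ℝ) * Complex.I), ?_, ?_⟩
  · refine natDegree_sum_le_of_forall_le _ _ fun k _ => (natDegree_C_mul_le _ _).trans ?_
    refine natDegree_sum_le_of_forall_le _ _ fun m hm => (natDegree_C_mul_X_pow_le _ _).trans ?_
    simp at hm
    omega
  · intro x hx
    have hexp : (Complex.exp (x * Complex.I) ^ s)⁻¹ * P.eval (Complex.exp (x * Complex.I)) =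
        ∑ k ∈ Finset.range (D + 1),
          P.coeff k * Complex.exp (((k : ℝ) - s : ℝ) * Complex.I * x) := by
      rw [eval_eq_sum_range' (Nat.lt_succ_of_le hP), Finset.mul_sum]
      refine Finset.sum_congr rfl fun k _ => ?_
      rw [← Complex.exp_nat_mul, ← Complex.exp_nat_mul, ← Complex.exp_neg, mul_left_comm,
        ← Complex.exp_add]
      congr 2
      push_cast
      ring
    rw [hexp, eval_finsetSum, ← Finset.sum_sub_distrib]
    have hterm : ∀ k ∈ Finset.range (D + 1),
        ‖(C (P.coeff k) * E (((k : ℝ) - s : ℝ) * Complex.I)).eval (x : ℂ) -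
          P.coeff k * Complex.exp (((k : ℝ) - s : ℝ) * Complex.I * x)‖ ≤
            2 * (1 / 2) ^ (6 * D) := by
      intro k hk
      have hk' : k ≤ D := by simpa [Nat.lt_succ_iff] using hk
      rw [eval_mul, eval_C, ← mul_sub, norm_mul, hE, norm_sub_rev]
      have hz : ‖(((k : ℝ) - s : ℝ) * Complex.I * x : ℂ)‖ ≤ D := by
        rw [norm_mul, norm_mul, Complex.norm_I, Complex.norm_real, Complex.norm_real,
          Real.norm_eq_abs, Real.norm_eq_abs, mul_one]
        have h1 : |(k : ℝ) - s| ≤ D := by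
          have h2 : (k : ℝ) ≤ D := by exact_mod_cast hk'
          have h3 : (s : ℝ) ≤ D := by exact_mod_cast hs
          exact abs_le.2 ⟨by linarith [(Nat.cast_nonneg k : (0 : ℝ) ≤ k)],
            by linarith [(Nat.cast_nonneg s : (0 : ℝ) ≤ s)]⟩
        calc |(k : ℝ) - s| * |x| ≤ D * 1 := by gcongr
          _ = D := mul_one _
      exact (mul_le_mul (hcoeff k) (norm_exp_sub_taylor_le D _ hz) (norm_nonneg _)
        zero_le_one).trans_eq (one_mul _)
    refine (norm_sum_le _ _).trans ((Finset.sum_le_sum hterm).trans ?_)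
    rw [Finset.sum_const, Finset.card_range, nsmul_eq_mul]
    have h1 : ((D + 1 : ℕ) : ℝ) ≤ 2 ^ D := by exact_mod_cast Nat.lt_two_pow_self
    have h2 : (2 : ℝ) ≤ 2 ^ D := by
      calc (2 : ℝ) = 2 ^ 1 := by norm_num
        _ ≤ 2 ^ D := pow_le_pow_right₀ (by norm_num) hD
    calc ((D + 1 : ℕ) : ℝ) * (2 * (1 / 2) ^ (6 * D)) ≤ 2 ^ D * (2 ^ D * (1 / 2) ^ (6 * D)) := by
          gcongr
      _ = (1 / 2) ^ (4 * D) := by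
        rw [show 6 * D = D + D + 4 * D by ring, pow_add, pow_add]
        have : (2 : ℝ) ^ D * (1 / 2) ^ D = 1 := by rw [← mul_pow]; norm_num
        linear_combination ((2 : ℝ) ^ D * (1 / 2) ^ D + 1) * (1 / 2) ^ (4 * D) * this
      _ ≤ (1 / 2) ^ D := pow_le_pow_of_le_one (by norm_num) (by norm_num) (by omega)

/-- The trigonometric polynomial `x ↦ g (sin (x + β))` is, up to a power of `e^{ix}`, a polynomial
in `e^{ix}`. -/
theorem exists_shifted_sine_poly (K : ℕ) (g : ℝ[X]) (hg : g.natDegree ≤ K) (β : ℝ) :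
    ∃ P : ℂ[X], P.natDegree ≤ 2 * K ∧ ∀ x : ℝ, P.eval (Complex.exp (x * Complex.I)) =
      Complex.exp (x * Complex.I) ^ K * (g.eval (Real.sin (x + β)) : ℝ) := by
  let q : ℂ[X] := C (Complex.exp (β * Complex.I) / (2 * Complex.I)) * X ^ 2 -
    C (Complex.exp (-(β * Complex.I)) / (2 * Complex.I))
  have hq : q.natDegree ≤ 2 := by
    refine (natDegree_sub_le _ _).trans (max_le (natDegree_C_mul_X_pow_le _ _) (by simp))
  refine ⟨homogenize K (g.map Complex.ofRealHom) q, natDegree_homogenize_le _ _ hq, fun x => ?_⟩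
  have hz : Complex.exp (x * Complex.I) ≠ 0 := Complex.exp_ne_zero _
  rw [eval_homogenize (by simpa using hg) q hz]
  have hsin : q.eval (Complex.exp (x * Complex.I)) / Complex.exp (x * Complex.I) =
      ((Real.sin (x + β) : ℝ) : ℂ) := by
    rw [Complex.ofReal_sin, Complex.sin]
    push_cast
    rw [show -((x : ℂ) + β) * Complex.I = -(x * Complex.I) + -(β * Complex.I) by ring,
      show ((x : ℂ) + β) * Complex.I = x * Complex.I + β * Complex.I by ring, Complex.exp_add,
      Complex.exp_add, Complex.exp_neg (x * Complex.I)]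
    simp only [q, eval_sub, eval_mul, eval_C, eval_pow, eval_X]
    generalize Complex.exp (x * Complex.I) = e at hz
    generalize Complex.exp (β * Complex.I) = b
    generalize Complex.exp (-(β * Complex.I)) = b'
    have hI : Complex.I⁻¹ = -Complex.I := Complex.inv_I
    rw [div_eq_mul_inv b, div_eq_mul_inv b', mul_inv, hI]
    field_simp
    ring
  rw [hsin]
  congr 1
  exact eval_map_apply Complex.ofRealHom _

end

/-! ### Polynomials for gapped phase estimation -/

section

open Polynomial ComplexConjugate

theorem sin_lower_bound {y : ℝ} (h1 : 3 / 8 ≤ y) (h2 : y ≤ 3 / 2) : 9 / 25 ≤ Real.sin y := by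
  have h3 := Real.sin_gt_sub_cube (x := 3 / 8) (by norm_num)
  have h4 : Real.sin (3 / 8) ≤ Real.sin y :=
    Real.sin_le_sin_of_le_of_le_pi_div_two (by linarith [Real.pi_gt_three])
      (by linarith [Real.pi_gt_three]) h1
  norm_num at h3
  linarith

/-- An odd trigonometric step in the angle `y`, of degree `O(j)` and with error `2⁻ʲ`. -/
theorem exists_sine_step (j : ℕ) :
    ∃ g : ℝ[X], g.natDegree ≤ 80 * j + 1 ∧ (∀ y, |g.eval (Real.sin y)| ≤ 1) ∧
      (∀ y, 3 / 8 ≤ y → y ≤ 3 / 2 → 1 - (1 / 2) ^ j ≤ g.eval (Real.sin y)) ∧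
      ∀ y, y ≤ -(3 / 8) → -(3 / 2) ≤ y → g.eval (Real.sin y) ≤ -(1 - (1 / 2) ^ j) := by
  obtain ⟨g, h1, h2, h3, h4⟩ := exists_sharp_step (40 * j) (9 / 25) ⟨by norm_num, by norm_num⟩
  -- `(1 - (9 / 25)²)⁴⁰ ≤ 1 / 256` absorbs the factor `40 j + 1 ≤ 128 ^ j`.
  have hq : (((40 * j : ℕ) : ℝ) + 1) * (1 - (9 / 25) ^ 2) ^ (40 * j) ≤ (1 / 2) ^ j := by
    have h5 : ((40 * j : ℕ) : ℝ) + 1 ≤ 128 ^ j := by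
      have := one_add_mul_le_pow (show (-2 : ℝ) ≤ 127 by norm_num) j
      push_cast
      norm_num at this
      linarith [(Nat.cast_nonneg j : (0 : ℝ) ≤ j)]
    have h6 : (1 - (9 / 25) ^ 2 : ℝ) ^ (40 * j) ≤ (1 / 256) ^ j := by
      rw [pow_mul]
      exact pow_le_pow_left₀ (by positivity) (by norm_num) j
    calc _ ≤ (128 : ℝ) ^ j * (1 / 256) ^ j :=
          mul_le_mul h5 h6 (pow_nonneg (by norm_num) _) (by positivity)
      _ = (1 / 2) ^ j := by rw [← mul_pow]; norm_num
  have h5 : ∀ y, 3 / 8 ≤ y → y ≤ 3 / 2 → 1 - (1 / 2) ^ j ≤ g.eval (Real.sin y) := fun y hy hy' =>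
    (sub_le_sub_left hq 1).trans (h4 _ (sin_lower_bound hy hy') (Real.sin_le_one y))
  refine ⟨g, by omega, fun y => h2 _ (Real.abs_sin_le_one y), h5, fun y hy hy' => ?_⟩
  have := h5 (-y) (by linarith) (by linarith)
  rw [Real.sin_neg, h3] at this
  linarith

/-- A closed curve of states of a qubit, of unit norm at each angle `x`, whose components are
trigonometric polynomials of degree `O(j)`. Up to `2⁻ʲ`, it rests at `|0⟩`, `i|1⟩`, `-|0⟩` when the
angle is near `1`, `0`, `-1`. The components `c = Re γ₀` and `s = Im γ₁` are explicit, and the other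
two real components come from the Fejér–Riesz factor of `1 - c² - s²`. -/
theorem exists_trig_curve (j : ℕ) (hj : 1 ≤ j) :
    ∃ (γ : ℝ → EuclideanSpace ℂ (Fin 2)) (T : Fin 2 → ℂ[X]),
      (∀ x, ‖γ x‖ = 1) ∧
      (∀ x, 7 / 8 ≤ x → x ≤ 1 → 1 - 2 * (1 / 2) ^ j ≤ (γ x 0).re) ∧
      (∀ x, |x| ≤ 1 / 8 → 1 - 2 * (1 / 2) ^ j ≤ (γ x 1).im) ∧
      (∀ x, x ≤ -(7 / 8) → -1 ≤ x → (γ x 0).re ≤ -(1 - 2 * (1 / 2) ^ j)) ∧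
      (∀ i, (T i).natDegree ≤ 6 * (2 * (80 * j + 1))) ∧
      ∀ (i : Fin 2) (x : ℝ), |x| ≤ 1 → ‖(T i).eval (x : ℂ) - γ x i‖ ≤ 2 * (1 / 2) ^ j := by
  obtain ⟨g, hgdeg, hgle, hgpos, hgneg⟩ := exists_sine_step j
  set η : ℝ := (1 / 2) ^ j with hη
  have hη0 : 0 < η := by positivity
  have hη1 : η ≤ 1 / 2 := by
    calc η ≤ (1 / 2) ^ 1 := pow_le_pow_of_le_one (by norm_num) (by norm_num) hj
      _ = 1 / 2 := pow_one _
  set K := 80 * j + 1 with hK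
  set D := 2 * K with hD
  obtain ⟨P₁, hP₁, hP₁e⟩ := exists_shifted_sine_poly K g hgdeg (-(1 / 2))
  obtain ⟨P₂, hP₂, hP₂e⟩ := exists_shifted_sine_poly K g hgdeg (1 / 2)
  let a : ℝ → ℝ := fun x => g.eval (Real.sin (x + -(1 / 2)))
  let b : ℝ → ℝ := fun x => g.eval (Real.sin (x + 1 / 2))
  -- The factor `1 - η` makes `c² + s² < 1`, as the completion requires.
  let c : ℝ → ℝ := fun x => (1 - η) / 2 * (a x + b x)
  let s : ℝ → ℝ := fun x => (1 - η) / 2 * (b x - a x)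
  let F : Fin 2 → ℂ[X] := ![C (((1 - η) / 2 : ℝ) : ℂ) * (P₁ + P₂),
    C (((1 - η) / 2 : ℝ) : ℂ) * (P₂ - P₁)]
  let w : ℝ → ℂ := fun x => Complex.exp (x * Complex.I)
  have hw : ∀ x, ‖w x‖ = 1 := fun x => Complex.norm_exp_ofReal_mul_I x
  have hw0 : ∀ x, w x ≠ 0 := fun x => Complex.exp_ne_zero _
  have hF0 : ∀ x, (F 0).eval (w x) = w x ^ K * (c x : ℂ) := by
    intro x
    simp only [F, Matrix.cons_val_zero, eval_mul, eval_C, eval_add, w, hP₁e, hP₂e, c, a, b]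
    push_cast
    ring
  have hF1 : ∀ x, (F 1).eval (w x) = w x ^ K * (s x : ℂ) := by
    intro x
    simp only [F, Matrix.cons_val_one, Matrix.cons_val_fin_one, eval_mul, eval_C, eval_sub, w, hP₁e,
      hP₂e, s, a, b]
    push_cast
    ring
  have hFdeg : ∀ i, (F i).natDegree ≤ D := by
    intro i
    fin_cases i
    · exact (natDegree_C_mul_le _ _).trans ((natDegree_add_le _ _).trans (max_le hP₁ hP₂))
    · exact (natDegree_C_mul_le _ _).trans ((natDegree_sub_le _ _).trans (max_le hP₂ hP₁))
  have hab : ∀ x, |a x| ≤ 1 ∧ |b x| ≤ 1 := fun x => ⟨hgle _, hgle _⟩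
  obtain ⟨G, hGF, hGdeg, hGsum⟩ := exists_unit_completion D F hFdeg (by
    intro z hz
    have hzx : z = w z.arg := by
      have := Complex.norm_mul_exp_arg_mul_I z
      rw [hz] at this
      simpa using this.symm
    rw [hzx, Fin.sum_univ_two, hF0, hF1, norm_mul, norm_mul, norm_pow, hw, one_pow, one_mul,
      one_mul, Complex.norm_real, Complex.norm_real, Real.norm_eq_abs, Real.norm_eq_abs, sq_abs,
      sq_abs]
    obtain ⟨h1, h2⟩ := hab z.arg
    rw [← sq_le_one_iff_abs_le_one] at h1 h2
    have h3 : c z.arg ^ 2 + s z.arg ^ 2 = (1 - η) ^ 2 * ((a z.arg ^ 2 + b z.arg ^ 2) / 2) := by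
      simp only [c, s]
      ring
    rw [h3]
    have h4 : (1 - η) ^ 2 < 1 := by nlinarith
    nlinarith [sq_nonneg (1 - η)])
  let R := G none
  have hnorm : ∀ x, c x ^ 2 + s x ^ 2 + ((R.eval (w x)).re ^ 2 + (R.eval (w x)).im ^ 2) = 1 := by
    intro x
    have := sum_norm_eval_sq_eq_one hGsum hGdeg (hw x)
    rw [Fintype.sum_option, Fin.sum_univ_two, hGF, hGF, hF0, hF1, norm_mul, norm_mul, norm_pow, hw,
      one_pow, one_mul, one_mul, Complex.norm_real, Complex.norm_real, Real.norm_eq_abs,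
      Real.norm_eq_abs, sq_abs, sq_abs, Complex.sq_norm, Complex.normSq_apply] at this
    linarith
  have hcoeff := norm_coeff_le_one hGsum hGdeg
  have hDpos : 0 < D := by omega
  obtain ⟨Tc, hTc, hTc'⟩ := exists_poly_near_trig hDpos (G (some 0)) (hGdeg _) (hcoeff _) K
    (by omega)
  obtain ⟨Ts, hTs, hTs'⟩ := exists_poly_near_trig hDpos (G (some 1)) (hGdeg _) (hcoeff _) K
    (by omega)
  obtain ⟨Tr, hTr, hTr'⟩ := exists_poly_near_trig hDpos R (hGdeg _) (hcoeff _) 0 (by omega)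
  -- The conjugate of `R` on the circle is the trigonometric polynomial given by the reversal.
  obtain ⟨Tq, hTq, hTq'⟩ := exists_poly_near_trig hDpos (conjReflect D R)
    (natDegree_conjReflect_le (hGdeg _)) (by
      intro k
      rw [coeff_conjReflect, RCLike.norm_conj]
      exact hcoeff _ _) D le_rfl
  have hηD : ((1 : ℝ) / 2) ^ D ≤ η := pow_le_pow_of_le_one (by norm_num) (by norm_num) (by omega)
  have ec : ∀ x : ℝ, |x| ≤ 1 → ‖Tc.eval (x : ℂ) - c x‖ ≤ η := by
    intro x hx
    have := (hTc' x hx).trans hηD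
    rwa [hGF, show Complex.exp (x * Complex.I) = w x from rfl, hF0,
      inv_mul_cancel_left₀ (pow_ne_zero _ (hw0 x))] at this
  have es : ∀ x : ℝ, |x| ≤ 1 → ‖Ts.eval (x : ℂ) - s x‖ ≤ η := by
    intro x hx
    have := (hTs' x hx).trans hηD
    rwa [hGF, show Complex.exp (x * Complex.I) = w x from rfl, hF1,
      inv_mul_cancel_left₀ (pow_ne_zero _ (hw0 x))] at this
  have er : ∀ x : ℝ, |x| ≤ 1 → ‖Tr.eval (x : ℂ) - R.eval (w x)‖ ≤ η := by
    intro x hx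
    have := (hTr' x hx).trans hηD
    rwa [pow_zero, inv_one, one_mul] at this
  have eq : ∀ x : ℝ, |x| ≤ 1 → ‖Tq.eval (x : ℂ) - conj (R.eval (w x))‖ ≤ η := by
    intro x hx
    have := (hTq' x hx).trans hηD
    rwa [show Complex.exp (x * Complex.I) = w x from rfl,
      eval_conjReflect_of_norm_eq_one (hGdeg _) (hw x),
      inv_mul_cancel_left₀ (pow_ne_zero _ (hw0 x))] at this
  let γ : ℝ → EuclideanSpace ℂ (Fin 2) := fun x =>
    !₂[(⟨c x, (R.eval (w x)).re⟩ : ℂ), (⟨(R.eval (w x)).im, s x⟩ : ℂ)]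
  have hre : ∀ z : ℂ, (z.re : ℂ) = (z + conj z) / 2 := fun z => by
    rw [Complex.add_conj]; simp
  have him : ∀ z : ℂ, (z.im : ℂ) = -Complex.I / 2 * (z - conj z) := fun z => by
    rw [Complex.sub_conj]
    push_cast
    linear_combination (z.im : ℂ) * Complex.I_sq
  have hγ0 : ∀ x, γ x 0 = c x + Complex.I / 2 * (R.eval (w x) + conj (R.eval (w x))) := fun x => by
    rw [show γ x 0 = (⟨c x, (R.eval (w x)).re⟩ : ℂ) from rfl, Complex.mk_eq_add_mul_I, hre]
    ring
  have hγ1 : ∀ x, γ x 1 = -Complex.I / 2 * (R.eval (w x) - conj (R.eval (w x))) +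
      Complex.I * s x := fun x => by
    rw [show γ x 1 = (⟨(R.eval (w x)).im, s x⟩ : ℂ) from rfl, Complex.mk_eq_add_mul_I, him]
    ring
  have hhalf : ‖Complex.I / 2‖ = 1 / 2 := by simp
  have hhalf' : ‖-Complex.I / 2‖ = 1 / 2 := by simp
  refine ⟨γ, ![Tc + C (Complex.I / 2) * (Tr + Tq), C (-Complex.I / 2) * (Tr - Tq) +
    C Complex.I * Ts], fun x => ?_, fun x hx hx' => ?_, fun x hx => ?_, fun x hx hx' => ?_,
    fun i => ?_, fun i x hx => ?_⟩
  · have : ‖γ x‖ ^ 2 = 1 := by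
      rw [EuclideanSpace.norm_sq_eq, Fin.sum_univ_two,
        show γ x 0 = (⟨c x, (R.eval (w x)).re⟩ : ℂ) from rfl,
        show γ x 1 = (⟨(R.eval (w x)).im, s x⟩ : ℂ) from rfl, Complex.sq_norm, Complex.sq_norm,
        Complex.normSq_mk, Complex.normSq_mk]
      linarith [hnorm x]
    exact (pow_eq_one_iff_of_nonneg (norm_nonneg _) two_ne_zero).1 this
  · change 1 - 2 * η ≤ (1 - η) / 2 * (a x + b x)
    have h1 : 1 - η ≤ a x := hgpos _ (by linarith) (by linarith)
    have h2 : 1 - η ≤ b x := hgpos _ (by linarith) (by linarith)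
    nlinarith
  · have hx' := abs_le.1 hx
    change 1 - 2 * η ≤ (1 - η) / 2 * (b x - a x)
    have h1 : a x ≤ -(1 - η) := hgneg _ (by linarith) (by linarith)
    have h2 : 1 - η ≤ b x := hgpos _ (by linarith) (by linarith)
    nlinarith
  · change (1 - η) / 2 * (a x + b x) ≤ -(1 - 2 * η)
    have h1 : a x ≤ -(1 - η) := hgneg _ (by linarith) (by linarith)
    have h2 : b x ≤ -(1 - η) := hgneg _ (by linarith) (by linarith)
    nlinarith
  · fin_cases i
    · exact (natDegree_add_le _ _).trans (max_le hTc ((natDegree_C_mul_le _ _).trans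
        ((natDegree_add_le _ _).trans (max_le hTr hTq))))
    · exact (natDegree_add_le _ _).trans (max_le ((natDegree_C_mul_le _ _).trans
        ((natDegree_sub_le _ _).trans (max_le hTr hTq))) ((natDegree_C_mul_le _ _).trans hTs))
  · have h1 := ec x hx
    have h2 := es x hx
    have h3 := er x hx
    have h4 := eq x hx
    fin_cases i
    · simp only [Fin.zero_eta, Matrix.cons_val_zero, eval_add, eval_mul, eval_C, hγ0]
      calc _ = ‖(Tc.eval (x : ℂ) - c x) + Complex.I / 2 * ((Tr.eval (x : ℂ) - R.eval (w x)) +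
            (Tq.eval (x : ℂ) - conj (R.eval (w x))))‖ := by congr 1; ring
        _ ≤ η + 1 / 2 * (η + η) := by
          refine norm_add_le_of_le h1 ?_
          rw [norm_mul, hhalf]
          gcongr
          exact norm_add_le_of_le h3 h4
        _ = 2 * η := by ring
    · simp only [Fin.mk_one, Matrix.cons_val_one, Matrix.cons_val_fin_one, eval_add, eval_sub,
        eval_mul, eval_C, hγ1]
      calc _ = ‖-Complex.I / 2 * ((Tr.eval (x : ℂ) - R.eval (w x)) -
            (Tq.eval (x : ℂ) - conj (R.eval (w x)))) + Complex.I * (Ts.eval (x : ℂ) - s x)‖ := by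
            congr 1; ring
        _ ≤ 1 / 2 * (η + η) + η := by
          refine norm_add_le_of_le ?_ ?_
          · rw [norm_mul, hhalf']
            gcongr
            exact norm_sub_le_of_le h3 h4
          · rw [norm_mul, Complex.norm_I, one_mul]
            exact h2
        _ = 2 * η := by ring

/-- The norm of the difference of two unit vectors is determined by the real part of their
overlap. -/
theorem isGPEState_of_re {φ η t : ℝ} {ξ : EuclideanSpace ℂ (Fin 2)}
    (hξ : ‖ξ‖ = 1) (h1 : t ∈ Set.Icc φ 1 → 1 - η ≤ (ξ 0).re)
    (h2 : t ∈ Set.Icc (-(φ / 2)) (φ / 2) → 1 - η ≤ (ξ 1).im)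
    (h3 : t ∈ Set.Icc (-1) (-φ) → (ξ 0).re ≤ -(1 - η)) :
    IsGPEState φ (Real.sqrt (2 * η)) t ξ := by
  have hsq : (ξ 0).re ^ 2 + (ξ 0).im ^ 2 + ((ξ 1).re ^ 2 + (ξ 1).im ^ 2) = 1 := by
    have : ‖ξ‖ ^ 2 = 1 := by rw [hξ, one_pow]
    rw [EuclideanSpace.norm_sq_eq, Fin.sum_univ_two, Complex.sq_norm, Complex.sq_norm,
      Complex.normSq_apply, Complex.normSq_apply] at this
    linarith
  refine ⟨hξ, fun ht => ?_, fun ht => ?_, fun ht => ?_⟩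
  · refine Real.le_sqrt_of_sq_le ?_
    rw [EuclideanSpace.norm_sq_eq, Fin.sum_univ_two, Complex.sq_norm, Complex.sq_norm,
      Complex.normSq_apply, Complex.normSq_apply]
    simp [ket]
    linarith [h1 ht]
  · refine Real.le_sqrt_of_sq_le ?_
    rw [EuclideanSpace.norm_sq_eq, Fin.sum_univ_two, Complex.sq_norm, Complex.sq_norm,
      Complex.normSq_apply, Complex.normSq_apply]
    simp [ket]
    linarith [h2 ht]
  · refine Real.le_sqrt_of_sq_le ?_
    rw [EuclideanSpace.norm_sq_eq, Fin.sum_univ_two, Complex.sq_norm, Complex.sq_norm,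
      Complex.normSq_apply, Complex.normSq_apply]
    simp [ket]
    linarith [h3 ht]

/-- The states `γ t` solve gapped phase estimation with accuracy `√(18 · 2⁻ʲ)`, and on `[-1, 1]`
they are approximated by the values of two polynomials of degree `O(j / φ)` in the normalized
eigenvalue `t`. -/
theorem exists_gpe_polynomials (φ : ℝ) (h0 : 0 < φ) (h1 : φ < 1) (j : ℕ) (hj : 1 ≤ j) :
    ∃ (γ : ℝ → EuclideanSpace ℂ (Fin 2)) (p : Fin 2 → ℂ[X]) (d : ℕ),
      (d : ℝ) ≤ 1000000 * j / φ ∧ (∀ i, (p i).natDegree ≤ d) ∧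
      (∀ t, IsGPEState φ (Real.sqrt (2 * (9 * (1 / 2) ^ j))) t (γ t)) ∧
      (∀ t : ℝ, |t| ≤ 1 → ∑ i, ‖(p i).eval (t : ℂ)‖ ^ 2 < 1) ∧
      ∀ t : ℝ, |t| ≤ 1 → 1 - 9 * (1 / 2) ^ j ≤ (∑ i, conj (γ t i) * (p i).eval (t : ℂ)).re := by
  obtain ⟨x, hxdeg, hx1, hx2, hx3, hx4⟩ := exists_three_level_poly φ h0 h1
  obtain ⟨Γ, T, hΓ, hΓ1, hΓ2, hΓ3, hT, hTΓ⟩ := exists_trig_curve j hj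
  set η : ℝ := (1 / 2) ^ j with hη
  have hη0 : 0 < η := by positivity
  have hs : 0 < 1 + 5 * η := by linarith
  -- The values of `T` have norm at most `1 + 4 η`; after division by `1 + 5 η` it is less than one.
  let p : Fin 2 → ℂ[X] := fun i =>
    C (((1 + 5 * η)⁻¹ : ℝ) : ℂ) * (T i).comp (x.map Complex.ofRealHom)
  have hp : ∀ i (t : ℝ), (p i).eval (t : ℂ) =
      ((1 + 5 * η)⁻¹ : ℝ) * (T i).eval ((x.eval t : ℝ) : ℂ) := by
    intro i t
    have : (x.map Complex.ofRealHom).eval (t : ℂ) = ((x.eval t : ℝ) : ℂ) :=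
      eval_map_apply Complex.ofRealHom _
    simp only [p, eval_mul, eval_C, eval_comp, this]
  have hγsum : ∀ t, ‖Γ t 0‖ ^ 2 + ‖Γ t 1‖ ^ 2 = 1 := by
    intro t
    have : ‖Γ t‖ ^ 2 = 1 := by rw [hΓ, one_pow]
    rwa [EuclideanSpace.norm_sq_eq, Fin.sum_univ_two] at this
  have hγle : ∀ t (i : Fin 2), ‖Γ t i‖ ≤ 1 := by
    intro t i
    have h2 := hγsum t
    have h3 : ‖Γ t i‖ ^ 2 ≤ 1 := by
      fin_cases i <;> simp only [Fin.zero_eta, Fin.mk_one] <;>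
        nlinarith [sq_nonneg ‖Γ t 0‖, sq_nonneg ‖Γ t 1‖]
    exact (sq_le_one_iff₀ (norm_nonneg _)).1 h3
  refine ⟨fun t => Γ (x.eval t), p, 6 * (2 * (80 * j + 1)) * x.natDegree, ?_, fun i => ?_,
    fun t => ?_, fun t ht => ?_, fun t ht => ?_⟩
  · have hj' : (1 : ℝ) ≤ j := by exact_mod_cast hj
    push_cast
    calc (6 * (2 * (80 * (j : ℝ) + 1))) * x.natDegree ≤ (6 * (2 * (80 * j + 1))) * (520 / φ) := by
          gcongr
      _ = (6 * (2 * (80 * j + 1)) * 520) / φ := by ring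
      _ ≤ 1000000 * j / φ := div_le_div_of_nonneg_right (by linarith) h0.le
  · refine (natDegree_C_mul_le _ _).trans (natDegree_comp_le.trans ?_)
    rw [natDegree_map]
    exact Nat.mul_le_mul_right _ (hT i)
  · refine isGPEState_of_re (hΓ _) (fun h => ?_) (fun h => ?_) (fun h => ?_)
    · have := hΓ1 _ (hx2 t h) (abs_le.1 (hx1 t (abs_le.2 ⟨by linarith [h.1], h.2⟩))).2
      linarith
    · have := hΓ2 _ (hx3 t h)
      linarith
    · have := hΓ3 _ (hx4 t h) (abs_le.1 (hx1 t (abs_le.2 ⟨h.1, by linarith [h.2]⟩))).1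
      linarith
  · have hle : ∀ i, ‖(T i).eval ((x.eval t : ℝ) : ℂ)‖ ≤ ‖Γ (x.eval t) i‖ + 2 * η := fun i => by
      have h2 := hTΓ i _ (hx1 t ht)
      have h3 := norm_sub_norm_le ((T i).eval ((x.eval t : ℝ) : ℂ)) (Γ (x.eval t) i)
      linarith
    simp only [hp, norm_mul, Complex.norm_real, Real.norm_eq_abs, abs_inv, abs_of_pos hs, mul_pow,
      ← Finset.mul_sum, inv_pow]
    rw [inv_mul_lt_iff₀ (by positivity), mul_one, Fin.sum_univ_two]
    have h2 := pow_le_pow_left₀ (norm_nonneg _) (hle 0) 2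
    have h3 := pow_le_pow_left₀ (norm_nonneg _) (hle 1) 2
    nlinarith [hγsum (x.eval t), hγle (x.eval t) 0, hγle (x.eval t) 1]
  · have hterm : ∀ i, conj (Γ (x.eval t) i) * (T i).eval ((x.eval t : ℝ) : ℂ) =
        ((‖Γ (x.eval t) i‖ ^ 2 : ℝ) : ℂ) +
          conj (Γ (x.eval t) i) * ((T i).eval ((x.eval t : ℝ) : ℂ) - Γ (x.eval t) i) := by
      intro i
      push_cast
      rw [← Complex.conj_mul']
      ring
    have herr : ∀ i, -(2 * η) ≤
        (conj (Γ (x.eval t) i) * ((T i).eval ((x.eval t : ℝ) : ℂ) - Γ (x.eval t) i)).re := by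
      intro i
      have h2 : ‖conj (Γ (x.eval t) i) *
          ((T i).eval ((x.eval t : ℝ) : ℂ) - Γ (x.eval t) i)‖ ≤ 1 * (2 * η) := by
        rw [norm_mul, RCLike.norm_conj]
        exact mul_le_mul (hγle _ _) (hTΓ i _ (hx1 t ht)) (norm_nonneg _) zero_le_one
      have h3 := (abs_le.1 (Complex.abs_re_le_norm (conj (Γ (x.eval t) i) *
          ((T i).eval ((x.eval t : ℝ) : ℂ) - Γ (x.eval t) i)))).1
      linarith
    have hsum : (∑ i, conj (Γ (x.eval t) i) * (p i).eval (t : ℂ)).re =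
        (1 + 5 * η)⁻¹ *
          (∑ i, conj (Γ (x.eval t) i) * (T i).eval ((x.eval t : ℝ) : ℂ)).re := by
      rw [← Complex.re_ofReal_mul, Finset.mul_sum]
      congr 1
      refine Finset.sum_congr rfl fun i _ => ?_
      rw [hp]
      ring
    have hlow : 1 - 4 * η ≤
        (∑ i, conj (Γ (x.eval t) i) * (T i).eval ((x.eval t : ℝ) : ℂ)).re := by
      rw [Fin.sum_univ_two, hterm, hterm]
      simp only [Complex.add_re, Complex.ofReal_re]
      linarith [herr 0, herr 1, hγsum (x.eval t)]
    change 1 - 9 * η ≤ (∑ i, conj (Γ (x.eval t) i) * (p i).eval (t : ℂ)).re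
    rw [hsum, le_inv_mul_iff₀ hs]
    nlinarith

end

/-! ### Embedding a small system into the coordinator model -/

section

open Matrix

section Embedding

variable {Y B D : Type} [Fintype Y] [DecidableEq Y] [Fintype B] [DecidableEq B]
  [Fintype D] [DecidableEq D]

/-- The matrix of the linear map that sends the basis vector `y` to the basis vector `f y`. -/
def embMatrix (f : Y → B) : Matrix B Y ℂ := Matrix.of fun s y => if s = f y then 1 else 0

omit [Fintype Y] [DecidableEq Y] [Fintype B] in
theorem embMatrix_apply (f : Y → B) (s : B) (y : Y) :
    embMatrix f s y = if s = f y then 1 else 0 := rfl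

omit [Fintype Y] [DecidableEq Y] in
theorem embMatrix_mul_embMatrix (g : B → D) (f : Y → B) :
    embMatrix g * embMatrix f = embMatrix (g ∘ f) := by
  ext s y
  simp [Matrix.mul_apply, embMatrix_apply]

omit [Fintype Y] in
theorem conjTranspose_embMatrix_mul_self {f : Y → B} (hf : f.Injective) :
    (embMatrix f)ᴴ * embMatrix f = 1 := by
  ext y y'
  simp [Matrix.mul_apply, embMatrix_apply, Matrix.one_apply, hf.eq_iff, eq_comm]

omit [Fintype Y] [DecidableEq Y] in
theorem conjTranspose_embMatrix_mul_of_disjoint {f : Y → B} {g : D → B}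
    (h : ∀ y d, f y ≠ g d) : (embMatrix f)ᴴ * embMatrix g = 0 := by
  ext y d
  have : ∀ y d, g d ≠ f y := fun y d => (h y d).symm
  simp [Matrix.mul_apply, embMatrix_apply, this]

omit [DecidableEq Y] [Fintype B] in
theorem embMatrix_mulVec_apply_self {f : Y → B} (hf : f.Injective) (ψ : Y → ℂ) (y : Y) :
    (embMatrix f *ᵥ ψ) (f y) = ψ y := by
  classical
  simp [Matrix.mulVec, dotProduct, embMatrix_apply, hf.eq_iff]

omit [DecidableEq Y] [Fintype B] in
theorem embMatrix_mulVec_apply_of_notMem {f : Y → B} (ψ : Y → ℂ) {s : B}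
    (hs : ∀ y, s ≠ f y) : (embMatrix f *ᵥ ψ) s = 0 := by
  simp [Matrix.mulVec, dotProduct, embMatrix_apply, hs]

/-- The operator that acts as `V` on the basis vectors in the image of `f`, and as the identity on
the other basis vectors. -/
def extendAlong (f : Y → B) (V : Matrix Y Y ℂ) : Matrix B B ℂ :=
  embMatrix f * V * (embMatrix f)ᴴ + (1 - embMatrix f * (embMatrix f)ᴴ)

omit [DecidableEq Y] in
theorem extendAlong_mul {f : Y → B} (hf : f.Injective) (V W : Matrix Y Y ℂ) :
    extendAlong f (V * W) = extendAlong f V * extendAlong f W := by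
  classical
  have h := conjTranspose_embMatrix_mul_self hf
  have h1 : (embMatrix f * V * (embMatrix f)ᴴ) * (embMatrix f * W * (embMatrix f)ᴴ) =
      embMatrix f * (V * W) * (embMatrix f)ᴴ := by
    calc _ = embMatrix f * V * ((embMatrix f)ᴴ * embMatrix f) * W * (embMatrix f)ᴴ := by
          simp only [Matrix.mul_assoc]
      _ = _ := by rw [h, Matrix.mul_one]; simp only [Matrix.mul_assoc]
  have h2 : (embMatrix f * V * (embMatrix f)ᴴ) * (embMatrix f * (embMatrix f)ᴴ) =
      embMatrix f * V * (embMatrix f)ᴴ := by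
    calc _ = embMatrix f * V * ((embMatrix f)ᴴ * embMatrix f) * (embMatrix f)ᴴ := by
          simp only [Matrix.mul_assoc]
      _ = _ := by rw [h, Matrix.mul_one]
  have h3 : (embMatrix f * (embMatrix f)ᴴ) * (embMatrix f * W * (embMatrix f)ᴴ) =
      embMatrix f * W * (embMatrix f)ᴴ := by
    calc _ = embMatrix f * ((embMatrix f)ᴴ * embMatrix f) * W * (embMatrix f)ᴴ := by
          simp only [Matrix.mul_assoc]
      _ = _ := by rw [h, Matrix.mul_one]
  have h4 : (embMatrix f * (embMatrix f)ᴴ) * (embMatrix f * (embMatrix f)ᴴ) =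
      embMatrix f * (embMatrix f)ᴴ := by
    calc _ = embMatrix f * ((embMatrix f)ᴴ * embMatrix f) * (embMatrix f)ᴴ := by
          simp only [Matrix.mul_assoc]
      _ = _ := by rw [h, Matrix.mul_one]
  simp only [extendAlong, add_mul, mul_add, sub_mul, mul_sub, one_mul, mul_one, h1, h2, h3, h4]
  abel

theorem extendAlong_one (f : Y → B) : extendAlong f (1 : Matrix Y Y ℂ) = 1 := by
  simp [extendAlong]

omit [DecidableEq Y] in
theorem conjTranspose_extendAlong (f : Y → B) (V : Matrix Y Y ℂ) :
    (extendAlong f V)ᴴ = extendAlong f Vᴴ := by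
  simp [extendAlong, Matrix.conjTranspose_mul, Matrix.mul_assoc]

omit [DecidableEq Y] in
theorem extendAlong_mul_embMatrix {f : Y → B} (hf : f.Injective) (V : Matrix Y Y ℂ) :
    extendAlong f V * embMatrix f = embMatrix f * V := by
  classical
  have h := conjTranspose_embMatrix_mul_self hf
  simp [extendAlong, Matrix.add_mul, Matrix.sub_mul, Matrix.mul_assoc, h]

omit [DecidableEq Y] in
theorem extendAlong_mul_embMatrix_of_disjoint {f : Y → B} {g : D → B} (V : Matrix Y Y ℂ)
    (h : ∀ y d, f y ≠ g d) : extendAlong f V * embMatrix g = embMatrix g := by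
  have h := conjTranspose_embMatrix_mul_of_disjoint h
  simp [extendAlong, Matrix.add_mul, Matrix.sub_mul, Matrix.mul_assoc, h]

omit [DecidableEq Y] in
theorem extendAlong_comp {g : B → D} (hg : g.Injective) (f : Y → B) (V : Matrix Y Y ℂ) :
    extendAlong (g ∘ f) V = extendAlong g (extendAlong f V) := by
  have h := conjTranspose_embMatrix_mul_self hg
  simp only [extendAlong, ← embMatrix_mul_embMatrix, Matrix.conjTranspose_mul]
  simp only [Matrix.mul_add, Matrix.add_mul, Matrix.mul_sub, Matrix.sub_mul, Matrix.mul_one,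
    Matrix.mul_assoc]
  abel

theorem extendAlong_mem_unitaryGroup {f : Y → B} (hf : f.Injective)
    (V : Matrix.unitaryGroup Y ℂ) : extendAlong f V.1 ∈ Matrix.unitaryGroup B ℂ := by
  rw [Matrix.mem_unitaryGroup_iff, Matrix.star_eq_conjTranspose, conjTranspose_extendAlong,
    ← extendAlong_mul hf, ← Matrix.star_eq_conjTranspose, Matrix.mem_unitaryGroup_iff.1 V.2,
    extendAlong_one]

omit [DecidableEq Y] in
theorem extendAlong_mulVec_apply_self {f : Y → B} (hf : f.Injective) (V : Matrix Y Y ℂ)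
    (ψ : B → ℂ) (y : Y) : (extendAlong f V *ᵥ ψ) (f y) = (V *ᵥ (ψ ∘ f)) y := by
  classical
  have h : (embMatrix f)ᴴ *ᵥ ψ = ψ ∘ f := by
    funext y
    simp [Matrix.mulVec, dotProduct, embMatrix_apply]
  simp [extendAlong, Matrix.add_mulVec, Matrix.sub_mulVec, ← Matrix.mulVec_mulVec, h,
    embMatrix_mulVec_apply_self hf]

omit [DecidableEq Y] in
theorem extendAlong_mulVec_apply_of_notMem {f : Y → B} (V : Matrix Y Y ℂ)
    (ψ : B → ℂ) {s : B} (hs : ∀ y, s ≠ f y) : (extendAlong f V *ᵥ ψ) s = ψ s := by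
  simp [extendAlong, Matrix.add_mulVec, Matrix.sub_mulVec, ← Matrix.mulVec_mulVec,
    embMatrix_mulVec_apply_of_notMem _ hs]

omit [DecidableEq Y] in
theorem extendAlong_apply_self {f : Y → B} (hf : f.Injective) (V : Matrix Y Y ℂ) (s : B) (y : Y) :
    extendAlong f V s (f y) = ∑ y', if s = f y' then V y' y else 0 := by
  classical
  have := congrFun (congrFun (extendAlong_mul_embMatrix hf V) s) y
  simpa [Matrix.mul_apply, embMatrix_apply] using this

omit [DecidableEq Y] in
theorem extendAlong_apply_of_notMem {f : Y → B} (V : Matrix Y Y ℂ) (s t : B)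
    (ht : ∀ y, f y ≠ t) : extendAlong f V s t = if s = t then 1 else 0 := by
  have := congrFun (congrFun (extendAlong_mul_embMatrix_of_disjoint (g := fun _ : Unit => t) V
    fun y _ => ht y) s) ()
  simpa [Matrix.mul_apply, embMatrix_apply] using this

omit [DecidableEq Y] in
/-- Some permutation of the basis carries one embedding of a system to another one. -/
theorem exists_unitary_mul_embMatrix {f g : Y → B} (hf : f.Injective) (hg : g.Injective) :
    ∃ U : Matrix.unitaryGroup B ℂ,
      U.1 * embMatrix f = embMatrix g ∧ (U⁻¹).1 * embMatrix g = embMatrix f := by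
  classical
  let e : Set.range f ≃ Set.range g :=
    (Equiv.ofInjective f hf).symm.trans (Equiv.ofInjective g hg)
  let π : Equiv.Perm B := Equiv.extendSubtype (p := (· ∈ Set.range f)) (q := (· ∈ Set.range g)) e
  have hπ : ⇑π ∘ f = g := by
    funext y
    have h := Equiv.extendSubtype_apply_of_mem (p := (· ∈ Set.range f)) (q := (· ∈ Set.range g)) e
      (f y) ⟨y, rfl⟩
    have h2 : (⟨f y, ⟨y, rfl⟩⟩ : Set.range f) = Equiv.ofInjective f hf y := rfl
    rw [h2] at h
    simpa [e, π] using h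
  have hmem : embMatrix ⇑π ∈ Matrix.unitaryGroup B ℂ := by
    rw [Matrix.mem_unitaryGroup_iff', Matrix.star_eq_conjTranspose,
      conjTranspose_embMatrix_mul_self π.injective]
  have hmul : embMatrix ⇑π * embMatrix f = embMatrix g := by rw [embMatrix_mul_embMatrix, hπ]
  refine ⟨⟨_, hmem⟩, hmul, ?_⟩
  change (embMatrix ⇑π)ᴴ * embMatrix g = _
  rw [← hmul, ← Matrix.mul_assoc, conjTranspose_embMatrix_mul_self π.injective, Matrix.one_mul]

omit [DecidableEq Y] in
theorem norm_embMatrix_mulVec {f : Y → B} (hf : f.Injective) (ψ : Y → ℂ) :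
    ‖(WithLp.toLp 2 (embMatrix f *ᵥ ψ) : EuclideanSpace ℂ B)‖ =
      ‖(WithLp.toLp 2 ψ : EuclideanSpace ℂ Y)‖ := by
  classical
  rw [EuclideanSpace.norm_eq, EuclideanSpace.norm_eq]
  congr 1
  rw [← Finset.sum_subset (Finset.subset_univ (Finset.univ.image f)), Finset.sum_image hf.injOn]
  · refine Finset.sum_congr rfl fun y _ => ?_
    simp [embMatrix_mulVec_apply_self hf]
  · intro s _ hs
    have : (embMatrix f *ᵥ ψ) s = 0 := embMatrix_mulVec_apply_of_notMem _ (by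
      rintro y rfl
      exact hs (by simp))
    simp [this]

end Embedding

section Simulation

variable {r : ℕ} {X : Fin r → Type} {R : Type} [Fintype R] [DecidableEq R] {k : ℕ}

/-- The basis state of the joint system in which the parties hold no private qubits. -/
def joint (s : R × (Fin k → Fin 2)) : Basis R k (fun _ : Fin r => 0) := (s.1, s.2, 0)

omit [Fintype R] [DecidableEq R] in
theorem joint_injective : (joint (r := r) : R × (Fin k → Fin 2) → _).Injective := by
  rintro ⟨a, b⟩ ⟨c, d⟩ h
  simp only [joint, Prod.mk.injEq, and_true] at h
  exact Prod.ext h.1 h.2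

omit [Fintype R] [DecidableEq R] in
theorem eq_joint (s : Basis R k (fun _ : Fin r => 0)) : s = joint (s.1, s.2.1) :=
  Prod.ext rfl (Prod.ext rfl (Subsingleton.elim _ _))

/-- The operator performed by a list of steps. -/
def stepsOp {p : Fin r → ℕ} (l : List (Step X R k p)) (x : ∀ i, X i) :
    Matrix (Basis R k p) (Basis R k p) ℂ :=
  l.foldl (fun M s => s.op x * M) 1

theorem stepsOp_append {p : Fin r → ℕ} (l l' : List (Step X R k p)) (x : ∀ i, X i) :
    stepsOp (l ++ l') x = stepsOp l' x * stepsOp l x := by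
  have key : ∀ (l : List (Step X R k p)) (M : Matrix (Basis R k p) (Basis R k p) ℂ),
      l.foldl (fun M s => s.op x * M) M = l.foldl (fun M s => s.op x * M) 1 * M := by
    intro l
    induction l with
    | nil => intro M; simp
    | cons s l ih =>
      intro M
      rw [List.foldl_cons, List.foldl_cons, ih (s.op x * M), ih (s.op x * 1), mul_one,
        Matrix.mul_assoc]
  rw [stepsOp, List.foldl_append, key]
  rfl

variable {Y : Type} [Fintype Y] [DecidableEq Y]

/-- `Simulates enc q N` says that some steps with at most `q` qubits of communication perform, on
inputs `x`, the operator `N x` on the system that is embedded by `enc` into the system of the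
referee. -/
def Simulates (enc : Y → R × (Fin k → Fin 2)) (q : ℕ) (N : (∀ i, X i) → Matrix Y Y ℂ) : Prop :=
  ∃ l : List (Step X R k (fun _ => 0)), (l.map Step.qubits).sum ≤ q ∧
    ∀ x, stepsOp l x * embMatrix (joint (r := r) ∘ enc) = embMatrix (joint (r := r) ∘ enc) * N x

variable {enc : Y → R × (Fin k → Fin 2)}

theorem Simulates.one : Simulates enc 0 (fun _ : ∀ i, X i => (1 : Matrix Y Y ℂ)) :=
  ⟨[], by simp, fun x => by simp [stepsOp]⟩

omit [DecidableEq Y] in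
theorem Simulates.mul {q q' : ℕ} {N N' : (∀ i, X i) → Matrix Y Y ℂ} (h : Simulates enc q N)
    (h' : Simulates enc q' N') : Simulates enc (q + q') (fun x => N x * N' x) := by
  obtain ⟨l, hl, hN⟩ := h
  obtain ⟨l', hl', hN'⟩ := h'
  refine ⟨l' ++ l, by simp; omega, fun x => ?_⟩
  rw [stepsOp_append, Matrix.mul_assoc, hN', ← Matrix.mul_assoc, hN, Matrix.mul_assoc]

omit [DecidableEq Y] in
theorem Simulates.mono {q q' : ℕ} {N : (∀ i, X i) → Matrix Y Y ℂ} (h : Simulates enc q N)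
    (hq : q ≤ q') : Simulates enc q' N := by
  obtain ⟨l, hl, hN⟩ := h
  exact ⟨l, hl.trans hq, hN⟩

theorem referee_op_mul_embMatrix (U : Matrix.unitaryGroup (R × (Fin k → Fin 2)) ℂ)
    (x : ∀ i, X i) :
    (Step.referee U : Step X R k (fun _ => 0)).op x * embMatrix (joint (r := r) (R := R) (k := k)) =
      embMatrix (joint (r := r) (R := R) (k := k)) * U.1 := by
  ext s t
  rw [Matrix.mul_apply, Matrix.mul_apply, Finset.sum_eq_single (joint t),
    Finset.sum_eq_single (s.1, s.2.1)]
  · rw [embMatrix_apply, embMatrix_apply, if_pos rfl, if_pos (eq_joint s)]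
    simp only [Step.op, Matrix.of_apply, mul_one, one_mul]
    rw [if_pos (Subsingleton.elim _ _)]
    rfl
  · intro u _ hu
    rw [embMatrix_apply, if_neg, zero_mul]
    rintro rfl
    exact hu rfl
  · simp
  · intro u _ hu
    rw [embMatrix_apply, if_neg hu, mul_zero]
  · simp

/-- The referee can perform each unitary on the embedded system without communication. -/
theorem Simulates.unitary (henc : enc.Injective) (U : Matrix.unitaryGroup Y ℂ) :
    Simulates enc 0 (fun _ : ∀ i, X i => U.1) := by
  refine ⟨[.referee ⟨_, extendAlong_mem_unitaryGroup henc U⟩], by simp [Step.qubits], fun x => ?_⟩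
  rw [← embMatrix_mul_embMatrix]
  simp only [stepsOp, List.foldl_cons, List.foldl_nil, Matrix.mul_one]
  rw [← Matrix.mul_assoc, referee_op_mul_embMatrix, Matrix.mul_assoc,
    extendAlong_mul_embMatrix henc, Matrix.mul_assoc]

/-- The basis state of the referee that consists of a part `b` which is kept and the state `l` of
the qubits in `S`. -/
def join (S : Finset (Fin k)) (b : R × ({q // q ∉ S} → Fin 2)) (l : S → Fin 2) :
    R × (Fin k → Fin 2) :=
  (b.1, fun q => if h : q ∈ S then l ⟨q, h⟩ else b.2 ⟨q, h⟩)

/-- The part of a basis state of the referee that is not sent when the qubits in `S` are sent. -/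
def kept (S : Finset (Fin k)) (s : R × (Fin k → Fin 2)) : R × ({q // q ∉ S} → Fin 2) :=
  (s.1, fun q => s.2 q)

/-- The state of the qubits in `S`. -/
def sent (S : Finset (Fin k)) (s : R × (Fin k → Fin 2)) : S → Fin 2 := fun q => s.2 q

omit [Fintype R] [DecidableEq R] in
@[simp] theorem kept_join (S : Finset (Fin k)) (b : R × ({q // q ∉ S} → Fin 2)) (l : S → Fin 2) :
    kept S (join S b l) = b := by
  refine Prod.ext rfl (funext fun q => ?_)
  simp [kept, join, q.2]

omit [Fintype R] [DecidableEq R] in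
@[simp] theorem sent_join (S : Finset (Fin k)) (b : R × ({q // q ∉ S} → Fin 2)) (l : S → Fin 2) :
    sent S (join S b l) = l := by
  funext q
  simp [sent, join]

omit [Fintype R] [DecidableEq R] in
theorem eq_of_kept_sent {S : Finset (Fin k)} {s t : R × (Fin k → Fin 2)}
    (h : kept S s = kept S t) (h' : sent S s = sent S t) : s = t := by
  refine Prod.ext (congrArg (fun b => b.1) h :) (funext fun q => ?_)
  by_cases hq : q ∈ S
  · exact congrFun h' ⟨q, hq⟩
  · exact congrFun (congrArg (fun b => b.2) h :) ⟨q, hq⟩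

/-- The step in which the qubits in `S` are sent to party `i`, who applies the unitary `V` to them
and sends them back. -/
def exchangeSent (i : Fin r) (S : Finset (Fin k)) (V : X i → Matrix.unitaryGroup (S → Fin 2) ℂ) :
    Step X R k (fun _ => 0) :=
  .exchange i S fun x => ⟨(V x).1.submatrix Prod.fst Prod.fst, by
    rw [Matrix.mem_unitaryGroup_iff, Matrix.star_eq_conjTranspose, Matrix.conjTranspose_submatrix]
    have h := Matrix.submatrix_mul_equiv (V x).1 (V x).1ᴴ
      (Equiv.prodUnique (S → Fin 2) (Fin 0 → Fin 2)) (Equiv.prodUnique (S → Fin 2) (Fin 0 → Fin 2))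
      (Equiv.prodUnique (S → Fin 2) (Fin 0 → Fin 2))
    refine h.trans ?_
    rw [← Matrix.star_eq_conjTranspose, Matrix.mem_unitaryGroup_iff.1 (V x).2]
    exact Matrix.submatrix_one_equiv _⟩

theorem exchangeSent_op_apply (i : Fin r) (S : Finset (Fin k))
    (V : X i → Matrix.unitaryGroup (S → Fin 2) ℂ) (x : ∀ i, X i) (s t : R × (Fin k → Fin 2)) :
    (exchangeSent i S V : Step X R k _).op x (joint s) (joint t) =
      if kept S s = kept S t then (V (x i)).1 (sent S s) (sent S t) else 0 := by
  simp only [exchangeSent, Step.op, Matrix.of_apply, joint, Matrix.submatrix_apply]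
  refine if_congr ?_ rfl rfl
  simp [kept, Prod.ext_iff, funext_iff]

/-- Party `i` can perform any unitary, dependent on the input of that party, on the part `Λ` of the
embedded system: the referee permutes the basis so that this part is encoded into the qubits in `S`
by nonzero strings, while for all other basis states these qubits are in the state zero, which
party `i` leaves alone. -/
theorem Simulates.exchange [Nonempty R] {Λ : Type} [Fintype Λ] [DecidableEq Λ] (i : Fin r)
    (S : Finset (Fin k)) (henc : enc.Injective) (hsent : ∀ y, sent S (enc y) = 0)
    {act : Λ → Y} (hact : act.Injective) {code : Λ → (S → Fin 2)} (hcode : code.Injective)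
    (hcode0 : ∀ l, code l ≠ 0) (V : X i → Matrix.unitaryGroup Λ ℂ) :
    Simulates enc (2 * S.card) (fun x : ∀ i, X i => extendAlong act (V (x i)).1) := by
  classical
  -- The encoding used during the exchange.
  let b₀ : R × ({q // q ∉ S} → Fin 2) := (Classical.arbitrary R, 0)
  let f : Y → R × (Fin k → Fin 2) := fun y =>
    if h : ∃ l, act l = y then join S b₀ (code h.choose) else enc y
  have hf1 : ∀ l, f (act l) = join S b₀ (code l) := by
    intro l
    have h : ∃ l', act l' = act l := ⟨l, rfl⟩
    have h2 : h.choose = l := hact h.choose_spec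
    simp only [f, dif_pos h, h2]
  have hf2 : ∀ y, (∀ l, act l ≠ y) → f y = enc y := by
    intro y hy
    simp only [f, dif_neg (not_exists.2 hy)]
  have hf : f.Injective := by
    intro y y' h
    by_cases hy : ∃ l, act l = y <;> by_cases hy' : ∃ l, act l = y'
    · obtain ⟨l, rfl⟩ := hy
      obtain ⟨l', rfl⟩ := hy'
      rw [hf1, hf1] at h
      have := congrArg (sent S) h
      rw [sent_join, sent_join] at this
      rw [hcode this]
    · obtain ⟨l, rfl⟩ := hy
      rw [hf1, hf2 y' (not_exists.1 hy')] at h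
      have := congrArg (sent S) h
      rw [sent_join, hsent] at this
      exact (hcode0 l this).elim
    · obtain ⟨l, rfl⟩ := hy'
      rw [hf1, hf2 y (not_exists.1 hy)] at h
      have := congrArg (sent S) h
      rw [sent_join, hsent] at this
      exact (hcode0 l this.symm).elim
    · rw [hf2 y (not_exists.1 hy), hf2 y' (not_exists.1 hy')] at h
      exact henc h
  obtain ⟨U, hU1, hU2⟩ := exists_unitary_mul_embMatrix henc hf
  let V' : X i → Matrix.unitaryGroup (S → Fin 2) ℂ := fun x =>
    ⟨_, extendAlong_mem_unitaryGroup hcode (V x)⟩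
  have hmid : ∀ x : ∀ i, X i,
      (exchangeSent i S V' : Step X R k _).op x * embMatrix (joint (r := r) ∘ f) =
        embMatrix (joint (r := r) ∘ f) * extendAlong act (V (x i)).1 := by
    intro x
    ext s y
    obtain ⟨s, rfl⟩ : ∃ s', s = joint s' := ⟨_, eq_joint s⟩
    have hL : ((exchangeSent i S V' : Step X R k _).op x * embMatrix (joint (r := r) ∘ f))
        (joint s) y =
        if kept S s = kept S (f y) then
          extendAlong code (V (x i)).1 (sent S s) (sent S (f y)) else 0 := by
      simp only [Matrix.mul_apply, embMatrix_apply, mul_ite, mul_one, mul_zero,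
        Finset.sum_ite_eq', Finset.mem_univ, if_true, Function.comp]
      exact exchangeSent_op_apply i S V' x s (f y)
    rw [hL]
    simp only [Matrix.mul_apply, embMatrix_apply, Function.comp, joint_injective.eq_iff, ite_mul,
      one_mul, zero_mul]
    by_cases hy : ∃ l, act l = y
    · obtain ⟨l, rfl⟩ := hy
      have hs : ∀ l', s = f (act l') ↔ kept S s = b₀ ∧ sent S s = code l' := by
        intro l'
        rw [hf1]
        refine ⟨?_, fun h => eq_of_kept_sent (S := S) (by simpa using h.1) (by simpa using h.2)⟩
        rintro rfl
        simp
      have hR : ∑ y', (if s = f y' then extendAlong act (V (x i)).1 y' (act l) else 0) =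
          ∑ l', if s = f (act l') then (V (x i)).1 l' l else 0 := by
        have h1 : ∀ y', (if s = f y' then extendAlong act (V (x i)).1 y' (act l) else 0) =
            ∑ l', if y' = act l' then if s = f y' then (V (x i)).1 l' l else 0 else 0 := by
          intro y'
          rw [extendAlong_apply_self hact]
          split_ifs <;> simp
        simp only [h1]
        rw [Finset.sum_comm]
        simp
      rw [hR, hf1, sent_join, kept_join, extendAlong_apply_self hcode]
      by_cases hk : kept S s = b₀ <;> simp [hs, hk]
    · have hy' := not_exists.1 hy
      rw [hf2 y hy', hsent, extendAlong_apply_of_notMem _ _ _ hcode0]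
      simp only [extendAlong_apply_of_notMem _ _ _ hy']
      have hs : s = enc y ↔ kept S s = kept S (enc y) ∧ sent S s = 0 := by
        refine ⟨?_, fun h => eq_of_kept_sent h.1 (by rw [h.2, hsent])⟩
        rintro rfl
        simp [hsent]
      rw [Finset.sum_eq_single y (fun y' _ hne => by rw [if_neg hne, ite_self])
        (fun h => (h (Finset.mem_univ y)).elim), if_pos rfl, hf2 y hy', ← ite_and]
      exact (if_congr hs rfl rfl).symm
  refine ⟨[.referee U, exchangeSent i S V', .referee U⁻¹], by simp [Step.qubits, exchangeSent],
    fun x => ?_⟩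
  simp only [stepsOp, List.foldl_cons, List.foldl_nil, Matrix.mul_one]
  have h1 : (Step.referee U : Step X R k (fun _ => 0)).op x * embMatrix (joint (r := r) ∘ enc) =
      embMatrix (joint (r := r) ∘ f) := by
    rw [← embMatrix_mul_embMatrix, ← embMatrix_mul_embMatrix, ← Matrix.mul_assoc,
      referee_op_mul_embMatrix, Matrix.mul_assoc, hU1]
  have h2 : (Step.referee U⁻¹ : Step X R k (fun _ => 0)).op x * embMatrix (joint (r := r) ∘ f) =
      embMatrix (joint (r := r) ∘ enc) := by
    rw [← embMatrix_mul_embMatrix, ← embMatrix_mul_embMatrix, ← Matrix.mul_assoc,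
      referee_op_mul_embMatrix, Matrix.mul_assoc, hU2]
  rw [Matrix.mul_assoc, Matrix.mul_assoc, h1, hmid, ← Matrix.mul_assoc, h2]

end Simulation

end

/-! ### Unitary dilations and the distributed matrix -/

section

open Matrix ComplexConjugate

theorem norm_fromBlocks_transpose_le {m n : ℕ} (B : Matrix (Fin m) (Fin n) ℝ) (hB : ‖B‖ ≤ 1) :
    ‖(fromBlocks 0 B Bᵀ 0 : Matrix (Fin m ⊕ Fin n) (Fin m ⊕ Fin n) ℝ)‖ ≤ 1 := by
  rw [l2_opNorm_def]
  refine ContinuousLinearMap.opNorm_le_bound _ zero_le_one fun x => ?_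
  rw [one_mul]
  refine le_of_sq_le_sq ?_ (norm_nonneg _)
  let x₁ : EuclideanSpace ℝ (Fin m) := WithLp.toLp 2 fun a => x (Sum.inl a)
  let x₂ : EuclideanSpace ℝ (Fin n) := WithLp.toLp 2 fun j => x (Sum.inr j)
  have h1 : ‖(WithLp.toLp 2 (B *ᵥ x₂.ofLp) : EuclideanSpace ℝ (Fin m))‖ ≤ ‖x₂‖ :=
    (l2_opNorm_mulVec B x₂).trans (mul_le_of_le_one_left (norm_nonneg _) hB)
  have hBt : ‖Bᵀ‖ ≤ 1 := by
    have := l2_opNorm_conjTranspose B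
    rw [conjTranspose_eq_transpose_of_trivial] at this
    rwa [this]
  have h2 : ‖(WithLp.toLp 2 (Bᵀ *ᵥ x₁.ofLp) : EuclideanSpace ℝ (Fin n))‖ ≤ ‖x₁‖ :=
    (l2_opNorm_mulVec Bᵀ x₁).trans (mul_le_of_le_one_left (norm_nonneg _) hBt)
  have h3 := pow_le_pow_left₀ (norm_nonneg _) h1 2
  have h4 := pow_le_pow_left₀ (norm_nonneg _) h2 2
  rw [EuclideanSpace.norm_sq_eq, EuclideanSpace.norm_sq_eq] at h3 h4 ⊢
  have h5 : x.ofLp = Sum.elim x₁.ofLp x₂.ofLp := by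
    funext s
    rcases s with s | s <;> rfl
  have h6 : ((LinearMap.toContinuousLinearMap (toEuclideanLin
      (fromBlocks 0 B Bᵀ 0 : Matrix (Fin m ⊕ Fin n) (Fin m ⊕ Fin n) ℝ))) x).ofLp =
      Sum.elim (B *ᵥ x₂.ofLp) (Bᵀ *ᵥ x₁.ofLp) := by
    change (fromBlocks 0 B Bᵀ 0 *ᵥ x.ofLp) = _
    rw [h5, fromBlocks_mulVec]
    simp
  have h7 : ∀ f g : (Fin m ⊕ Fin n) → ℝ, f = g → ∑ i, ‖f i‖ ^ 2 = ∑ i, ‖g i‖ ^ 2 := by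
    rintro f _ rfl
    rfl
  refine (h7 _ _ h6).trans_le ?_
  rw [Fintype.sum_sum_type, Fintype.sum_sum_type]
  simp only [Sum.elim_inl, Sum.elim_inr]
  simp only [x₁, x₂] at h3 h4 ⊢
  linarith

/-- A real symmetric contraction `B` has a Hermitian unitary dilation, with blocks `B`,
`√(1 - B²)`, `√(1 - B²)`, `-B`. -/
theorem exists_hermitian_dilation {L : Type} [Fintype L] [DecidableEq L] (B : Matrix L L ℝ)
    (hB : Bᵀ = B) (hB1 : ‖B‖ ≤ 1) :
    ∃ V : Matrix.unitaryGroup (L ⊕ L) ℂ, V.1ᴴ = V.1 ∧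
      ∀ i j, V.1 (Sum.inl i) (Sum.inl j) = (B i j : ℂ) := by
  have hsa : IsSelfAdjoint B := by
    rw [IsSelfAdjoint, star_eq_conjTranspose, conjTranspose_eq_transpose_of_trivial, hB]
  have hspec : ∀ t ∈ spectrum ℝ B, t ^ 2 ≤ 1 := by
    intro t ht
    rw [sq_le_one_iff_abs_le_one, ← Real.norm_eq_abs]
    refine (spectrum.norm_le_norm_mul_of_mem ht).trans ?_
    have h1 : ‖(1 : Matrix L L ℝ)‖ ≤ 1 := by
      rw [← diagonal_one, l2_opNorm_diagonal]
      exact (pi_norm_le_iff_of_nonneg zero_le_one).2 fun i => by simp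
    exact mul_le_one₀ hB1 (norm_nonneg _) h1
  let S : Matrix L L ℝ := cfc (fun t : ℝ => Real.sqrt (1 - t ^ 2)) B
  have hcont : Continuous fun t : ℝ => Real.sqrt (1 - t ^ 2) := by fun_prop
  have hSsa : Sᵀ = S := by
    have : IsSelfAdjoint S := cfc_predicate _ _
    rwa [IsSelfAdjoint, star_eq_conjTranspose, conjTranspose_eq_transpose_of_trivial] at this
  have hcomm : S * B = B * S := by
    have h := cfc_commute_cfc (fun t : ℝ => Real.sqrt (1 - t ^ 2)) (fun t : ℝ => t) B
    rw [cfc_id' ℝ B] at h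
    exact h
  have hsum : B * B + S * S = 1 := by
    have h1 : S * S = cfc (fun t : ℝ => 1 - t ^ 2) B := by
      rw [← cfc_mul _ _ B hcont.continuousOn hcont.continuousOn]
      refine cfc_congr fun t ht => ?_
      exact Real.mul_self_sqrt (by linarith [hspec t ht])
    have h2 : B * B = cfc (fun t : ℝ => t ^ 2) B := by
      rw [cfc_pow_id B 2, sq]
    rw [h1, h2, ← cfc_add _ _ _ (by fun_prop) (by fun_prop)]
    simp only [add_sub_cancel]
    exact cfc_const_one ℝ B
  let V : Matrix (L ⊕ L) (L ⊕ L) ℝ := fromBlocks B S S (-B)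
  have hVt : Vᵀ = V := by
    simp only [V, fromBlocks_transpose, hB, hSsa, transpose_neg]
  have hVV : V * V = 1 := by
    simp only [V, fromBlocks_multiply, ← fromBlocks_one, hcomm]
    congr 1
    · simp [hcomm]
    · simp
    · rw [neg_mul_neg, add_comm, hsum]
  have hH : (V.map Complex.ofReal)ᴴ = V.map Complex.ofReal := by
    ext i j
    have : V j i = V i j := congrFun (congrFun hVt i) j
    simp [conjTranspose_apply, this]
  refine ⟨⟨V.map Complex.ofReal, ?_⟩, hH, fun i j => rfl⟩
  rw [mem_unitaryGroup_iff, star_eq_conjTranspose, hH]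
  have h1 := Matrix.map_mul (L := V) (M := V) (f := Complex.ofRealHom)
  rw [hVV] at h1
  refine h1.symm.trans ?_
  exact Matrix.map_one _ (by simp) (by simp)

section Walk

variable {r n : ℕ} {m : Fin r → ℕ}

/-- Index set of the Hermitian dilation of the matrix of party `i`. -/
abbrev Loc (m : Fin r → ℕ) (n : ℕ) (i : Fin r) : Type := Fin (m i) ⊕ Fin n

/-- Index set of the local systems of all the parties: party `i` acts on the summand `i`. The
second copy of `Loc m n i` belongs to the unitary dilation. -/
abbrev Sites (m : Fin r → ℕ) (n : ℕ) : Type := Σ i, Loc m n i ⊕ Loc m n i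

/-- The dilation of `A / a i`; for `a i = 0` also `A = 0`, and the dilation of zero is taken. -/
theorem exists_party_unitary (a : Fin r → ℝ) (i : Fin r) (A : Matrix (Fin (m i)) (Fin n) ℝ) :
    ∃ V : Matrix.unitaryGroup (Loc m n i ⊕ Loc m n i) ℂ, ‖A‖ ≤ a i → V.1ᴴ = V.1 ∧
      ∃ B : Matrix (Fin (m i)) (Fin n) ℝ, a i • B = A ∧
        ∀ s t, V.1 (Sum.inl s) (Sum.inl t) = (fromBlocks 0 B Bᵀ 0 s t : ℝ) := by
  by_cases hA : ‖A‖ ≤ a i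
  · have ha : 0 ≤ a i := (norm_nonneg A).trans hA
    let B := (a i)⁻¹ • A
    have hB : ‖B‖ ≤ 1 := by
      rw [norm_smul, norm_inv, Real.norm_of_nonneg ha]
      exact inv_mul_le_one_of_le₀ hA ha
    have haB : a i • B = A := by
      by_cases h0 : a i = 0
      · rw [h0] at hA
        rw [norm_le_zero_iff.1 hA]
        simp [B, norm_le_zero_iff.1 hA]
      · exact smul_inv_smul₀ h0 A
    obtain ⟨V, hV, hVB⟩ := exists_hermitian_dilation
      (fromBlocks 0 B Bᵀ 0 : Matrix (Loc m n i) (Loc m n i) ℝ)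
      (by simp [fromBlocks_transpose]) (norm_fromBlocks_transpose_le B hB)
    exact ⟨V, fun _ => ⟨hV, B, haB, hVB⟩⟩
  · exact ⟨1, fun h => (hA h).elim⟩

/-- The isometry that distributes a vector `(y, x)` to the parties: party `i` gets the part `y i`
and a copy of `x` with weight `w i`. -/
def distribute (w : Fin r → ℝ) : Matrix (Sites m n) (Idx m n) ℂ :=
  Matrix.of fun z s => Sum.elim
    (Sum.elim (fun b => if s = Sum.inl ⟨z.1, b⟩ then 1 else 0)
      (fun j => if s = Sum.inr j then (w z.1 : ℂ) else 0)) (fun _ => 0) z.2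

@[simp] theorem distribute_row (w : Fin r → ℝ) (i : Fin r) (b : Fin (m i)) (s : Idx m n) :
    distribute w ⟨i, Sum.inl (Sum.inl b)⟩ s = if s = Sum.inl ⟨i, b⟩ then 1 else 0 := rfl

@[simp] theorem distribute_column (w : Fin r → ℝ) (i : Fin r) (j : Fin n) (s : Idx m n) :
    distribute w ⟨i, Sum.inl (Sum.inr j)⟩ s = if s = Sum.inr j then (w i : ℂ) else 0 := rfl

@[simp] theorem distribute_dilation (w : Fin r → ℝ) (i : Fin r) (l : Loc m n i) (s : Idx m n) :
    distribute w ⟨i, Sum.inr l⟩ s = 0 := rfl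

theorem distribute_isometry (w : Fin r → ℝ) (hw : ∑ i, w i ^ 2 = 1) :
    (distribute (m := m) (n := n) w)ᴴ * distribute (m := m) (n := n) w = 1 := by
  have hw' : ∑ i, (w i : ℂ) * w i = 1 := by
    simp only [← sq]
    exact_mod_cast hw
  ext s t
  rw [mul_apply]
  simp only [conjTranspose_apply]
  rw [Fintype.sum_sigma]
  simp only [Fintype.sum_sum_type, distribute_row, distribute_column, distribute_dilation]
  rcases s with ⟨i, b⟩ | j <;> rcases t with ⟨i', b'⟩ | j'
  · by_cases h : (⟨i, b⟩ : Σ i, Fin (m i)) = ⟨i', b'⟩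
    · cases h
      simp only [Sum.inl.injEq, reduceCtorEq, if_false, star_zero, mul_zero,
        Finset.sum_const_zero, add_zero, one_apply_eq]
      rw [← Fintype.sum_sigma (fun z : Σ i, Fin (m i) =>
        star (if (⟨i, b⟩ : Σ i, Fin (m i)) = z then (1 : ℂ) else 0) *
          if (⟨i, b⟩ : Σ i, Fin (m i)) = z then (1 : ℂ) else 0)]
      rw [Finset.sum_eq_single ⟨i, b⟩] <;> simp +contextual [eq_comm]
    · rw [one_apply_ne (by simpa using h)]
      simp only [Sum.inl.injEq, reduceCtorEq, if_false, star_zero, mul_zero,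
        Finset.sum_const_zero, add_zero]
      refine Finset.sum_eq_zero fun k _ => Finset.sum_eq_zero fun c _ => ?_
      by_cases h1 : (⟨i, b⟩ : Σ i, Fin (m i)) = ⟨k, c⟩
      · rw [← h1, if_neg (Ne.symm h), mul_zero]
      · rw [if_neg h1, star_zero, zero_mul]
  · simp
  · simp
  · by_cases h : j = j'
    · subst h
      simp [one_apply, Finset.sum_ite_eq, hw']
    · have h2 : ∀ x, j' = x → ¬ j = x := fun x hx hj => h (hj.trans hx.symm)
      simp only [reduceCtorEq, if_false, star_zero, mul_zero, Finset.sum_const_zero,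
        add_zero, zero_add, Sum.inr.injEq]
      rw [one_apply_ne (by simpa using h)]
      refine Finset.sum_eq_zero fun k _ => Finset.sum_eq_zero fun c _ => ?_
      by_cases h1 : j = c
      · rw [if_neg (show ¬ j' = c from fun h3 => h (h1.trans h3.symm)), mul_zero]
      · rw [if_neg h1, star_zero, zero_mul]

end Walk

end

/-! ### Block encoding and qubitization -/

section

open Matrix ComplexConjugate

section Encoding

variable {r n : ℕ} {m : Fin r → ℕ}

theorem sum_sigma_ite_mul {β : Fin r → Type} [∀ i, Fintype (β i)] [DecidableEq (Σ i, β i)]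
    (z : Σ i, β i) (f : ∀ i, β i → ℂ) :
    ∑ i, ∑ b, (if z = ⟨i, b⟩ then (1 : ℂ) else 0) * f i b = f z.1 z.2 := by
  rw [← Fintype.sum_sigma (fun y : Σ i, β i => (if z = y then (1 : ℂ) else 0) * f y.1 y.2)]
  simp

theorem blockDiagonal'_mul_apply {β : Fin r → Type} [∀ i, Fintype (β i)] {I : Type}
    (M : ∀ i, Matrix (β i) (β i) ℂ) (J : Matrix (Σ i, β i) I ℂ) (i : Fin r) (l : β i) (s : I) :
    (blockDiagonal' M * J) ⟨i, l⟩ s = ∑ l', M i l l' * J ⟨i, l'⟩ s := by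
  rw [mul_apply, Fintype.sum_sigma, Finset.sum_eq_single i]
  · simp [blockDiagonal'_apply_eq]
  · intro j _ hj
    refine Finset.sum_eq_zero fun l' _ => ?_
    rw [blockDiagonal'_apply_ne _ _ _ (Ne.symm hj), zero_mul]
  · simp

/-- Compressing the dilations of the parties by the distributing isometry gives the Hermitian
dilation of the stacked matrix, divided by `α`: the weights `a i / α` turn the normalizations
`a i` of the parties into the common normalization `α`. -/
theorem distribute_compress (a : Fin r → ℝ) (α : ℝ) (A : ∀ i, Matrix (Fin (m i)) (Fin n) ℝ)
    (V : ∀ i, Matrix (Loc m n i ⊕ Loc m n i) (Loc m n i ⊕ Loc m n i) ℂ)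
    (hV : ∀ i, ∃ B : Matrix (Fin (m i)) (Fin n) ℝ, a i • B = A i ∧
      ∀ s t, V i (Sum.inl s) (Sum.inl t) = (fromBlocks 0 B Bᵀ 0 s t : ℝ)) :
    (distribute (m := m) (n := n) fun i => a i / α)ᴴ *
      (blockDiagonal' V * distribute (m := m) (n := n) fun i => a i / α) =
        (α : ℂ)⁻¹ • hermDilation A := by
  choose B hB hVB using hV
  have hAB : ∀ i b j, A i b j = a i * B i b j := by
    intro i b j
    rw [← hB i]
    rfl
  ext s t
  rw [mul_apply]
  simp only [conjTranspose_apply]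
  rw [Fintype.sum_sigma]
  simp only [blockDiagonal'_mul_apply, Fintype.sum_sum_type, distribute_row, distribute_column,
    distribute_dilation, mul_zero, star_zero, zero_mul, Finset.sum_const_zero, add_zero, hVB,
    fromBlocks_apply₁₁, fromBlocks_apply₁₂, fromBlocks_apply₂₁, fromBlocks_apply₂₂,
    Matrix.zero_apply, Complex.ofReal_zero, zero_add, transpose_apply, Matrix.smul_apply,
    smul_eq_mul, hermDilation,
    map_apply]
  rcases s with s | j <;> rcases t with t | j'
  · simp
  · simp only [reduceCtorEq, if_false, star_zero, zero_mul, Finset.sum_const_zero, add_zero,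
      Sum.inl.injEq, Sum.inr.injEq, fromBlocks_apply₁₂, apply_ite star, star_one]
    rw [sum_sigma_ite_mul s fun i b =>
      ∑ x, (B i b x : ℂ) * if j' = x then ((a i / α : ℝ) : ℂ) else 0]
    simp only [mul_ite, mul_zero, Finset.sum_ite_eq, Finset.mem_univ, if_true, stack, of_apply,
      hAB]
    push_cast
    ring
  · simp only [reduceCtorEq, if_false, star_zero, zero_mul, Finset.sum_const_zero, zero_add,
      Sum.inl.injEq, Sum.inr.injEq, fromBlocks_apply₂₁, apply_ite star, ite_mul,
      Finset.sum_ite_eq, Finset.mem_univ, if_true, stack, of_apply, hAB, transpose_apply]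
    have h1 : ∀ i, star ((a i / α : ℝ) : ℂ) * ∑ b, (B i b j : ℂ) *
        (if t = ⟨i, b⟩ then 1 else 0) = ∑ b, (if t = ⟨i, b⟩ then (1 : ℂ) else 0) *
          (((a i / α : ℝ) : ℂ) * B i b j) := by
      intro i
      rw [Finset.mul_sum]
      refine Finset.sum_congr rfl fun b _ => ?_
      rw [Complex.star_def, Complex.conj_ofReal]
      ring
    rw [Finset.sum_congr rfl fun i _ => h1 i,
      sum_sigma_ite_mul t fun i b => ((a i / α : ℝ) : ℂ) * (B i b j : ℂ)]
    push_cast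
    ring
  · simp

end Encoding

section Qubitization

variable {I Z : Type} [Fintype I] [DecidableEq I] [Fintype Z] [DecidableEq Z]

/-- The Hermitian unitary that exchanges `ℂ^I` with the range of the isometry `J`. -/
def exchangeRange (J : Matrix Z I ℂ) : Matrix (I ⊕ Z) (I ⊕ Z) ℂ :=
  fromBlocks 0 Jᴴ J (1 - J * Jᴴ)

theorem conjTranspose_exchangeRange (J : Matrix Z I ℂ) : (exchangeRange J)ᴴ = exchangeRange J := by
  simp [exchangeRange, fromBlocks_conjTranspose, conjTranspose_mul]

theorem exchangeRange_mul_self {J : Matrix Z I ℂ} (hJ : Jᴴ * J = 1) :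
    exchangeRange J * exchangeRange J = 1 := by
  have h1 : Jᴴ * (J * Jᴴ) = Jᴴ := by rw [← Matrix.mul_assoc, hJ, Matrix.one_mul]
  have h2 : J * Jᴴ * J = J := by rw [Matrix.mul_assoc, hJ, Matrix.mul_one]
  have h3 : J * Jᴴ * (J * Jᴴ) = J * Jᴴ := by rw [← Matrix.mul_assoc, h2]
  rw [exchangeRange, fromBlocks_multiply, ← fromBlocks_one]
  congr 1
  · simp [hJ]
  · simp [Matrix.mul_sub, h1]
  · simp [Matrix.sub_mul, h2]
  · simp [Matrix.sub_mul, Matrix.mul_sub, h3]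

/-- The reflection that fixes `ℂ^I` and negates `ℂ^Z`. -/
def signReflection (I Z : Type) [DecidableEq I] [DecidableEq Z] : Matrix (I ⊕ Z) (I ⊕ Z) ℂ :=
  fromBlocks 1 0 0 (-1)

theorem conjTranspose_signReflection : (signReflection I Z)ᴴ = signReflection I Z := by
  simp [signReflection, fromBlocks_conjTranspose]

theorem signReflection_mul_self : signReflection I Z * signReflection I Z = 1 := by
  simp [signReflection, fromBlocks_multiply]

/-- The Hermitian unitary block encoding of `Jᴴ V J`. -/
def blockEncoding (J : Matrix Z I ℂ) (V : Matrix Z Z ℂ) : Matrix (I ⊕ Z) (I ⊕ Z) ℂ :=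
  exchangeRange J * fromBlocks 1 0 0 V * exchangeRange J

theorem conjTranspose_blockEncoding (J : Matrix Z I ℂ) {V : Matrix Z Z ℂ} (hV : Vᴴ = V) :
    (blockEncoding J V)ᴴ = blockEncoding J V := by
  simp [blockEncoding, conjTranspose_mul, conjTranspose_exchangeRange, fromBlocks_conjTranspose, hV,
    Matrix.mul_assoc]

theorem blockEncoding_mul_self {J : Matrix Z I ℂ} (hJ : Jᴴ * J = 1) {V : Matrix Z Z ℂ}
    (hV : V * V = 1) : blockEncoding J V * blockEncoding J V = 1 := by
  have h1 : (fromBlocks 1 0 0 V : Matrix (I ⊕ Z) (I ⊕ Z) ℂ) * fromBlocks 1 0 0 V = 1 := by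
    simp [fromBlocks_multiply, hV]
  calc _ = exchangeRange J * fromBlocks 1 0 0 V * (exchangeRange J * exchangeRange J) *
        fromBlocks 1 0 0 V * exchangeRange J := by simp only [blockEncoding, Matrix.mul_assoc]
    _ = exchangeRange J * (fromBlocks 1 0 0 V * fromBlocks 1 0 0 V) * exchangeRange J := by
        rw [exchangeRange_mul_self hJ, Matrix.mul_one]; simp only [Matrix.mul_assoc]
    _ = 1 := by rw [h1, Matrix.mul_one, exchangeRange_mul_self hJ]

theorem toBlocks₁₁_blockEncoding (J : Matrix Z I ℂ) (V : Matrix Z Z ℂ) :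
    (blockEncoding J V).toBlocks₁₁ = Jᴴ * (V * J) := by
  simp [blockEncoding, exchangeRange, fromBlocks_multiply, Matrix.mul_assoc]

/-- For a block matrix `U`, the mean of `R U` and `U R`, where `R` is the sign reflection, is block
diagonal. -/
theorem signReflection_mean_mul_embMatrix (U : Matrix (I ⊕ Z) (I ⊕ Z) ℂ) :
    ((1 / 2 : ℂ) • (signReflection I Z * U + U * signReflection I Z)) *
        embMatrix (Sum.inl : I → I ⊕ Z) =
      embMatrix (Sum.inl : I → I ⊕ Z) * U.toBlocks₁₁ := by
  have h1 : (1 / 2 : ℂ) • (signReflection I Z * U + U * signReflection I Z) =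
      fromBlocks U.toBlocks₁₁ 0 0 (-U.toBlocks₂₂) := by
    conv_lhs => rw [← fromBlocks_toBlocks U]
    simp only [signReflection, fromBlocks_multiply, fromBlocks_add, fromBlocks_smul]
    congr 1
    · ext i j; simp; ring
    · ext i j; simp
    · ext i j; simp
    · ext i j; simp; ring
  rw [h1]
  ext s t
  rcases s with s | s <;> simp [mul_apply, embMatrix_apply]

open Polynomial in
theorem aeval_mul_of_intertwine {X' : Type} [Fintype X'] [DecidableEq X'] {M : Matrix X' X' ℂ}
    {H : Matrix I I ℂ} {E : Matrix X' I ℂ} (h : M * E = E * H) (p : ℂ[X]) :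
    aeval M p * E = E * aeval H p := by
  induction p using Polynomial.induction_on' with
  | add p q hp hq => rw [map_add, map_add, Matrix.add_mul, hp, hq, Matrix.mul_add]
  | monomial k c =>
    have hk : M ^ k * E = E * H ^ k := by
      induction k with
      | zero => simp
      | succ k ih => rw [pow_succ, Matrix.mul_assoc, h, ← Matrix.mul_assoc, ih, Matrix.mul_assoc,
          ← pow_succ]
    rw [aeval_monomial, aeval_monomial, ← Algebra.smul_def, ← Algebra.smul_def, Matrix.smul_mul, hk,
      Matrix.mul_smul]

open Polynomial in
/-- Qubitization: on `ℂ^I`, the mean of the walk operator `W = R U` and its inverse is the encoded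
block of `U`, so that the homogenization of `p` at `W` is, up to the power `W ^ d`, the polynomial
`p` of this block. -/
theorem aeval_walk_homogenize {U : Matrix (I ⊕ Z) (I ⊕ Z) ℂ} (hU : U * U = 1) {d : ℕ} {p : ℂ[X]}
    (hp : p.natDegree ≤ d) :
    aeval (signReflection I Z * U) (homogenize d p (C (1 / 2) * (X ^ 2 + 1))) *
      (U * signReflection I Z) ^ d * embMatrix (Sum.inl : I → I ⊕ Z) =
        embMatrix (Sum.inl : I → I ⊕ Z) * aeval U.toBlocks₁₁ p := by
  have hR : signReflection I Z * signReflection I Z = 1 := signReflection_mul_self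
  have h1 : signReflection I Z * U * (U * signReflection I Z) = 1 := by
    rw [Matrix.mul_assoc, ← Matrix.mul_assoc U, hU, Matrix.one_mul, hR]
  have h2 : U * signReflection I Z * (signReflection I Z * U) = 1 := by
    rw [Matrix.mul_assoc, ← Matrix.mul_assoc _ _ U, hR, Matrix.one_mul, hU]
  set W := signReflection I Z * U
  set W' := U * signReflection I Z
  have hq : aeval W (C (1 / 2) * (X ^ 2 + 1) : ℂ[X]) * W' = (1 / 2 : ℂ) • (W + W') := by
    rw [map_mul, aeval_C, map_add, map_pow, aeval_X, map_one, ← Algebra.smul_def,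
      Matrix.smul_mul, Matrix.add_mul, sq, Matrix.mul_assoc, h1, Matrix.mul_one, Matrix.one_mul]
  have hcomm : Commute W W' := h1.trans h2.symm
  have hpow : W' ^ d * W ^ d = 1 := by rw [← hcomm.symm.mul_pow, h2, one_pow]
  have hc : Commute (aeval W (homogenize d p (C (1 / 2) * (X ^ 2 + 1)))) (W' ^ d) := by
    refine Commute.pow_right ?_ d
    have h3 := (Commute.all (homogenize d p (C (1 / 2) * (X ^ 2 + 1))) X).map (aeval W)
    rw [aeval_X] at h3
    generalize aeval W (homogenize d p (C (1 / 2) * (X ^ 2 + 1))) = M at h3 ⊢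
    calc M * W' = W' * W * M * W' := by rw [h2, Matrix.one_mul]
      _ = W' * (M * (W * W')) := by
          rw [Matrix.mul_assoc W' W M, ← h3.eq, Matrix.mul_assoc W' (M * W) W',
            Matrix.mul_assoc M W W']
      _ = W' * M := by rw [h1, Matrix.mul_one]
  rw [hc.eq, aeval_homogenize hp _ h1 h2, hq, ← Matrix.mul_assoc, hpow, Matrix.one_mul]
  exact aeval_mul_of_intertwine (signReflection_mean_mul_embMatrix U) p

end Qubitization

end

/-! ### Communication cost of signal processing -/

section

open Matrix

section Blocks

variable {r : ℕ} {Λ : Fin r → Type} [∀ i, Fintype (Λ i)] [∀ i, DecidableEq (Λ i)]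

theorem extendAlong_inr {I Z : Type} [Fintype I] [DecidableEq I] [Fintype Z] [DecidableEq Z]
    (V : Matrix Z Z ℂ) :
    extendAlong (Sum.inr : Z → I ⊕ Z) V = fromBlocks 1 0 0 V := by
  ext s t
  rcases t with t | t
  · rw [extendAlong_apply_of_notMem _ _ _ (by simp)]
    rcases s with s | s <;> simp [one_apply]
  · rw [extendAlong_apply_self Sum.inr_injective]
    rcases s with s | s <;> simp

theorem extendAlong_sigma_mk (i : Fin r) (V : Matrix (Λ i) (Λ i) ℂ) :
    extendAlong (Sigma.mk i) V =
      blockDiagonal' (Function.update (fun j => (1 : Matrix (Λ j) (Λ j) ℂ)) i V) := by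
  ext ⟨j, l⟩ ⟨j', l'⟩
  by_cases hj' : j' = i
  · subst hj'
    rw [extendAlong_apply_self sigma_mk_injective]
    by_cases hj : j = j'
    · subst hj
      rw [blockDiagonal'_apply_eq, Function.update_self]
      simp
    · rw [blockDiagonal'_apply_ne _ _ _ hj]
      refine Finset.sum_eq_zero fun y _ => if_neg fun h => hj (congrArg Sigma.fst h)
  · rw [extendAlong_apply_of_notMem _ _ _ fun y h => hj' (congrArg Sigma.fst h).symm]
    by_cases hj : j = j'
    · subst hj
      rw [blockDiagonal'_apply_eq, Function.update_of_ne hj', one_apply]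
      simp
    · rw [blockDiagonal'_apply_ne _ _ _ hj, if_neg fun h => hj (congrArg Sigma.fst h)]

variable {X : Fin r → Type} {R : Type} [Fintype R] [DecidableEq R] {k : ℕ}
  {Y : Type} [Fintype Y] [DecidableEq Y] {enc : Y → R × (Fin k → Fin 2)}

/-- One exchange with each party performs a block diagonal unitary, in which party `i` supplies the
block `i`. -/
theorem Simulates.exchange_all [Nonempty R] (S : Finset (Fin k)) (henc : enc.Injective)
    (hsent : ∀ y, sent S (enc y) = 0) {act : (Σ i, Λ i) → Y} (hact : act.Injective)
    {code : ∀ i, Λ i → (S → Fin 2)} (hcode : ∀ i, (code i).Injective)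
    (hcode0 : ∀ i l, code i l ≠ 0) (V : ∀ i, X i → Matrix.unitaryGroup (Λ i) ℂ) :
    Simulates enc (r * (2 * S.card)) (fun x : ∀ i, X i =>
      extendAlong act (blockDiagonal' fun i => (V i (x i)).1)) := by
  have key : ∀ T : Finset (Fin r), Simulates enc (T.card * (2 * S.card)) (fun x : ∀ i, X i =>
      extendAlong act (blockDiagonal' fun i => if i ∈ T then (V i (x i)).1 else 1)) := by
    intro T
    induction T using Finset.induction_on with
    | empty =>
      convert Simulates.one (X := X) (enc := enc) using 2
      · simp
      · rw [← extendAlong_one act]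
        congr 1
        simp only [Finset.notMem_empty, if_false]
        exact blockDiagonal'_one
    | insert i T hi ih =>
      have h1 := Simulates.exchange (X := X) i S henc hsent
        (hact.comp (sigma_mk_injective (i := i))) (hcode i) (hcode0 i) (V i)
      have h2 := h1.mul ih
      rw [Finset.card_insert_of_notMem hi, Nat.succ_mul, add_comm]
      convert h2 using 2 with x
      rw [extendAlong_comp hact, ← extendAlong_mul hact, extendAlong_sigma_mk,
        ← blockDiagonal'_mul]
      congr 2
      funext j
      by_cases hj : j = i
      · subst hj
        simp [hi]
      · simp [hj]
  have h := key Finset.univ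
  simpa using h

end Blocks

section SignalProcessing

open Polynomial Kronecker

variable {r : ℕ} {X : Fin r → Type} {R : Type} [Fintype R] [DecidableEq R] {k : ℕ}
  {Y κ I : Type} [Fintype Y] [DecidableEq Y] [Fintype κ] [DecidableEq κ] [Fintype I]
  [DecidableEq I]

/-- The linear map `v ↦ ∑ c, M c v ⊗ |c⟩`. -/
def coinState (M : κ → Matrix Y I ℂ) : Matrix (Y × κ) I ℂ := Matrix.of fun y v => M y.2 y.1 v

/-- The operator that acts as `M` if the coin is in the state `c₀`. -/
abbrev ctrl (c₀ : κ) (M : Matrix Y Y ℂ) : Matrix (Y × κ) (Y × κ) ℂ :=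
  extendAlong (fun y => (y, c₀)) M

theorem injective_prod_right (c₀ : κ) : Function.Injective fun y : Y => (y, c₀) :=
  fun _ _ h => congrArg Prod.fst h

theorem one_kronecker_mul_coinState (U : Matrix κ κ ℂ) (M : κ → Matrix Y I ℂ) :
    ((1 : Matrix Y Y ℂ) ⊗ₖ U) * coinState M = coinState fun c => ∑ c', U c c' • M c' := by
  ext ⟨y, c⟩ v
  simp [mul_apply, coinState, Fintype.sum_prod_type, one_apply, Matrix.sum_apply, ite_mul,
    Finset.sum_ite_irrel]

theorem ctrl_mul_coinState (c₀ : κ) (W : Matrix Y Y ℂ) (M : κ → Matrix Y I ℂ) :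
    ctrl c₀ W * coinState M = coinState (Function.update M c₀ (W * M c₀)) := by
  ext ⟨y, c⟩ v
  have h : (ctrl c₀ W * coinState M) (y, c) v =
      (ctrl c₀ W *ᵥ fun s => coinState M s v) (y, c) := rfl
  rw [h]
  by_cases hc : c = c₀
  · subst hc
    rw [extendAlong_mulVec_apply_self (injective_prod_right c)]
    simp [coinState, mul_apply, mulVec, dotProduct]
  · rw [extendAlong_mulVec_apply_of_notMem _ _ (by simp [hc])]
    simp [coinState, hc]

variable {enc : Y × κ → R × (Fin k → Fin 2)}

theorem Simulates.ctrl_pow {q : ℕ} {c₀ : κ} {W : (∀ i, X i) → Matrix Y Y ℂ}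
    (h : Simulates enc q fun x => ctrl c₀ (W x)) (d : ℕ) :
    Simulates enc (d * q) fun x => ctrl c₀ (W x ^ d) := by
  induction d with
  | zero => simpa [extendAlong_one] using Simulates.one (X := X) (enc := enc)
  | succ d ih =>
    have h2 := ih.mul h
    rw [Nat.succ_mul]
    convert h2 using 2 with x
    rw [pow_succ]
    exact extendAlong_mul (injective_prod_right c₀) _ _

/-- Signal processing: a reachable family of polynomials, evaluated at an operator `W`, is performed
with `N` controlled applications of `W`. -/
theorem Reachable.simulates {c₀ : κ} {N : ℕ} {F : κ → ℂ[X]} (hF : Reachable c₀ N F)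
    (henc : enc.Injective) {q : ℕ} {W : (∀ i, X i) → Matrix Y Y ℂ}
    (hW : Simulates enc q fun x => ctrl c₀ (W x)) (E : (∀ i, X i) → Matrix Y I ℂ) :
    ∃ N' : (∀ i, X i) → Matrix (Y × κ) (Y × κ) ℂ, Simulates enc (N * q) N' ∧
      ∀ x, N' x * coinState (Pi.single c₀ (E x)) =
        coinState fun c => aeval (W x) (F c) * E x := by
  induction hF with
  | init =>
    refine ⟨_, by simpa using Simulates.one, fun x => ?_⟩
    rw [Matrix.one_mul]
    congr 1
    funext c
    by_cases hc : c = c₀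
    · subst hc; simp
    · simp [hc]
  | rotate U h ih =>
    obtain ⟨N', hN, hx⟩ := ih
    have hU : (1 : Matrix Y Y ℂ) ⊗ₖ U.1 ∈ Matrix.unitaryGroup (Y × κ) ℂ :=
      kronecker_mem_unitary (one_mem _) U.2
    refine ⟨_, by simpa using (Simulates.unitary henc ⟨_, hU⟩).mul hN, fun x => ?_⟩
    rw [Matrix.mul_assoc, hx, one_kronecker_mul_coinState]
    congr 1
    funext c
    simp [map_sum, Matrix.sum_mul, aeval_C, ← Algebra.smul_def]
  | signal h ih =>
    obtain ⟨N', hN, hx⟩ := ih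
    refine ⟨_, by simpa [Nat.succ_mul, add_comm] using hW.mul hN, fun x => ?_⟩
    rw [Matrix.mul_assoc, hx, ctrl_mul_coinState]
    congr 1
    funext c
    by_cases hc : c = c₀
    · subst hc; simp [Matrix.mul_assoc]
    · simp [hc]
  | mono h ih =>
    obtain ⟨N', hN, hx⟩ := ih
    exact ⟨N', hN.mono (Nat.mul_le_mul_right _ (Nat.le_succ _)), hx⟩

end SignalProcessing

end

/-! ### Accuracy of the final state -/

section

open Matrix ComplexConjugate

section Accuracy

variable {I Z B : Type} [Fintype I] [DecidableEq I] [Fintype Z] [DecidableEq Z] [Fintype B]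
  [DecidableEq B]

theorem norm_le_one_of_isometry {J : Matrix Z I ℂ} (hJ : Jᴴ * J = 1) : ‖J‖ ≤ 1 := by
  have h := l2_opNorm_conjTranspose_mul_self J
  have h1 : ‖(1 : Matrix I I ℂ)‖ ≤ 1 := by
    rw [← diagonal_one, l2_opNorm_diagonal]
    exact (pi_norm_le_iff_of_nonneg zero_le_one).2 fun i => by simp
  rw [hJ] at h
  nlinarith [norm_nonneg J]

theorem toBlocks₁₁_eq (U : Matrix (I ⊕ Z) (I ⊕ Z) ℂ) :
    U.toBlocks₁₁ = (embMatrix (Sum.inl : I → I ⊕ Z))ᴴ * (U * embMatrix (Sum.inl : I → I ⊕ Z)) := by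
  ext s t
  simp [mul_apply, embMatrix_apply, toBlocks₁₁]

theorem norm_toBlocks₁₁_le_one {U : Matrix (I ⊕ Z) (I ⊕ Z) ℂ} (hU : Uᴴ * U = 1) :
    ‖U.toBlocks₁₁‖ ≤ 1 := by
  have hE := norm_le_one_of_isometry
    (conjTranspose_embMatrix_mul_self (Sum.inl_injective (α := I) (β := Z)))
  rw [toBlocks₁₁_eq]
  refine (l2_opNorm_mul _ _).trans (mul_le_one₀ ?_ (norm_nonneg _) ((l2_opNorm_mul _ _).trans
    (mul_le_one₀ (norm_le_one_of_isometry hU) (norm_nonneg _) hE)))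
  rw [l2_opNorm_conjTranspose]
  exact hE

theorem abs_le_norm_of_eigenvector {H : Matrix I I ℂ} {t : ℝ} {e : EuclideanSpace ℂ I}
    (he : ‖e‖ = 1) (h : toEuclideanLin H e = (t : ℂ) • e) : |t| ≤ ‖H‖ := by
  have h1 : ‖(WithLp.toLp 2 (H *ᵥ e.ofLp) : EuclideanSpace ℂ I)‖ ≤ ‖H‖ * ‖e‖ :=
    l2_opNorm_mulVec H e
  have h2 : (WithLp.toLp 2 (H *ᵥ e.ofLp) : EuclideanSpace ℂ I) = (t : ℂ) • e := h
  have h3 : ‖(t : ℂ) • e‖ = |t| := by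
    rw [norm_smul, he, mul_one, Complex.norm_real, Real.norm_eq_abs]
  rw [h2, h3, he, mul_one] at h1
  exact h1

open Polynomial in
theorem aeval_eigenvector {H : Matrix I I ℂ} {t : ℂ} {e : EuclideanSpace ℂ I}
    (h : toEuclideanLin H e = t • e) (p : ℂ[X]) :
    toEuclideanLin (aeval H p) e = p.eval t • e := by
  have h' : H *ᵥ e.ofLp = t • e.ofLp := congrArg WithLp.ofLp h
  have key : ∀ k : ℕ, (H ^ k) *ᵥ e.ofLp = t ^ k • e.ofLp := by
    intro k
    induction k with
    | zero => simp
    | succ k ih =>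
      rw [pow_succ, ← mulVec_mulVec, h', mulVec_smul, ih, smul_smul, pow_succ, mul_comm]
  have h2 : aeval H p *ᵥ e.ofLp = p.eval t • e.ofLp := by
    induction p using Polynomial.induction_on' with
    | add p q hp hq => rw [map_add, add_mulVec, hp, hq, eval_add, add_smul]
    | monomial k c =>
      rw [aeval_monomial, ← Algebra.smul_def, smul_mulVec, key, eval_monomial, smul_smul]
  exact congrArg (WithLp.toLp 2) h2

theorem inner_tensor (x x' : EuclideanSpace ℂ B) (y y' : EuclideanSpace ℂ I) :
    inner ℂ (tensor x y) (tensor x' y') = inner ℂ x x' * inner ℂ y y' := by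
  simp only [PiLp.inner_apply, RCLike.inner_apply, tensor, Fintype.sum_prod_type,
    Finset.sum_mul_sum, map_mul]
  refine Finset.sum_congr rfl fun b _ => Finset.sum_congr rfl fun s _ => ?_
  ring

theorem inner_sum_tensor {ι : Type} [Fintype ι] (e : OrthonormalBasis ι ℂ (EuclideanSpace ℂ I))
    (c : ι → ℂ) (ξ η : ι → EuclideanSpace ℂ B) :
    inner ℂ (∑ u, c u • tensor (ξ u) (e u)) (∑ u, c u • tensor (η u) (e u)) =
      ∑ u, (‖c u‖ ^ 2 : ℝ) * inner ℂ (ξ u) (η u) := by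
  classical
  rw [sum_inner]
  refine Finset.sum_congr rfl fun u _ => ?_
  rw [inner_sum, Finset.sum_eq_single u]
  · rw [inner_smul_left, inner_smul_right, inner_tensor, orthonormal_iff_ite.1 e.orthonormal,
      if_pos rfl, mul_one, ← mul_assoc, Complex.conj_mul']
    push_cast
    rfl
  · intro u' _ hu
    rw [inner_smul_left, inner_smul_right, inner_tensor, orthonormal_iff_ite.1 e.orthonormal,
      if_neg (Ne.symm hu)]
    simp
  · simp

theorem norm_sum_tensor {ι : Type} [Fintype ι] (e : OrthonormalBasis ι ℂ (EuclideanSpace ℂ I))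
    {ξ : ι → EuclideanSpace ℂ B} (hξ : ∀ u, ‖ξ u‖ = 1) (v : EuclideanSpace ℂ I) :
    ‖∑ u, inner ℂ (e u) v • tensor (ξ u) (e u)‖ = ‖v‖ := by
  have h := inner_sum_tensor e (fun u => inner ℂ (e u) v) ξ ξ
  have h2 : ∀ u, inner ℂ (ξ u) (ξ u) = 1 := fun u => by
    rw [inner_self_eq_norm_sq_to_K, hξ]; simp
  simp only [h2, mul_one] at h
  rw [inner_self_eq_norm_sq_to_K] at h
  have h3 : ‖∑ u, inner ℂ (e u) v • tensor (ξ u) (e u)‖ ^ 2 = ∑ u, ‖inner ℂ (e u) v‖ ^ 2 := by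
    refine Complex.ofReal_injective ?_
    push_cast at h ⊢
    exact h
  rw [e.sum_sq_norm_inner_right] at h3
  exact (sq_eq_sq₀ (norm_nonneg _) (norm_nonneg _)).1 h3

open Polynomial in
/-- The overlap of the ideal final state with the state prepared by polynomials of `H`. -/
theorem re_inner_sum_tensor_ge {ι : Type} [Fintype ι]
    (e : OrthonormalBasis ι ℂ (EuclideanSpace ℂ I)) {H : Matrix I I ℂ} {t : ι → ℝ}
    (ht : ∀ u, toEuclideanLin H (e u) = (t u : ℂ) • e u) (p : B → ℂ[X])
    {ξ : ι → EuclideanSpace ℂ B} {δ : ℝ}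
    (h : ∀ u, 1 - δ ≤ (∑ b, conj (ξ u b) * (p b).eval (t u : ℂ)).re) (v : EuclideanSpace ℂ I) :
    (1 - δ) * ‖v‖ ^ 2 ≤ (inner ℂ (∑ u, inner ℂ (e u) v • tensor (ξ u) (e u))
      (WithLp.toLp 2 fun s : B × I => (aeval H (p s.1) *ᵥ v.ofLp) s.2 :
        EuclideanSpace ℂ (B × I))).re := by
  have hΦ : (WithLp.toLp 2 fun s : B × I => (aeval H (p s.1) *ᵥ v.ofLp) s.2 :
      EuclideanSpace ℂ (B × I)) = ∑ u, inner ℂ (e u) v •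
        tensor (WithLp.toLp 2 fun b => (p b).eval (t u : ℂ) : EuclideanSpace ℂ B) (e u) := by
    ext ⟨b, s⟩
    have h1 : toEuclideanLin (aeval H (p b)) v =
        ∑ u, inner ℂ (e u) v • (p b).eval (t u : ℂ) • e u := by
      conv_lhs => rw [← e.sum_repr' v]
      rw [map_sum]
      refine Finset.sum_congr rfl fun u _ => ?_
      rw [map_smul, aeval_eigenvector (ht u)]
    have h2 := congrArg (fun w : EuclideanSpace ℂ I => w s) h1
    simpa [tensor, toEuclideanLin] using h2
  rw [hΦ, inner_sum_tensor, Complex.re_sum, ← e.sum_sq_norm_inner_right v, Finset.mul_sum]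
  refine Finset.sum_le_sum fun u _ => ?_
  rw [Complex.re_ofReal_mul, mul_comm]
  refine mul_le_mul_of_nonneg_left ((h u).trans_eq ?_) (sq_nonneg _)
  simp [PiLp.inner_apply, mul_comm]

/-- Two vectors of equal norm and large overlap are close; the second one lives on the range of
`g`. -/
theorem norm_sub_embMatrix_sq_le {Y D : Type} [Fintype Y] [DecidableEq Y] [Fintype D]
    [DecidableEq D] {g : D → Y} (hg : g.Injective) (a : EuclideanSpace ℂ Y)
    (Ψ : EuclideanSpace ℂ D) {c δ : ℝ} (ha : ‖a‖ = c) (hΨ : ‖Ψ‖ = c)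
    (h : (1 - δ) * c ^ 2 ≤ (inner ℂ Ψ (WithLp.toLp 2 (a.ofLp ∘ g) : EuclideanSpace ℂ D)).re) :
    ‖a - WithLp.toLp 2 (embMatrix g *ᵥ Ψ.ofLp)‖ ^ 2 ≤ 2 * δ * c ^ 2 := by
  have hinner : inner ℂ a (WithLp.toLp 2 (embMatrix g *ᵥ Ψ.ofLp)) =
      inner ℂ (WithLp.toLp 2 (a.ofLp ∘ g) : EuclideanSpace ℂ D) Ψ := by
    simp only [PiLp.inner_apply, RCLike.inner_apply, mulVec, dotProduct, embMatrix_apply,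
      ite_mul, one_mul, zero_mul, Finset.sum_mul, Function.comp]
    rw [Finset.sum_comm]
    simp
  have h1 := norm_sub_sq (𝕜 := ℂ) a (WithLp.toLp 2 (embMatrix g *ᵥ Ψ.ofLp))
  rw [norm_embMatrix_mulVec hg, hinner, ha] at h1
  have h2 : ‖(WithLp.toLp 2 Ψ.ofLp : EuclideanSpace ℂ D)‖ = c := hΨ
  rw [h2] at h1
  rw [← inner_conj_symm, Complex.conj_re] at h
  have h3 : RCLike.re (inner ℂ (WithLp.toLp 2 (a.ofLp ∘ g) : EuclideanSpace ℂ D) Ψ) =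
    (inner ℂ (WithLp.toLp 2 (a.ofLp ∘ g) : EuclideanSpace ℂ D) Ψ).re := rfl
  rw [h1, h3]
  linarith

open Polynomial in
/-- For a unitary `W`, the conjugate reversal plays the role of the adjoint of `p(W)`. -/
theorem pow_mul_conjTranspose_aeval {W : Matrix Z Z ℂ} (hW : W * Wᴴ = 1) {N : ℕ} {p : ℂ[X]}
    (hp : p.natDegree ≤ N) : W ^ N * (aeval W p)ᴴ = aeval W (conjReflect N p) := by
  rw [aeval_eq_sum_range' (Nat.lt_succ_of_le hp),
    aeval_eq_sum_range' (Nat.lt_succ_of_le (natDegree_conjReflect_le hp)), conjTranspose_sum,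
    Finset.mul_sum, ← Finset.sum_range_reflect]
  refine Finset.sum_congr rfl fun j hj => ?_
  have hj' : j ≤ N := Nat.lt_succ_iff.1 (Finset.mem_range.1 hj)
  have h1 : N.succ - 1 - j = N - j := by omega
  have h2 : W ^ N = W ^ j * W ^ (N - j) := by rw [← pow_add]; congr 1; omega
  have hc : Commute W Wᴴ := hW.trans (mul_eq_one_comm.1 hW).symm
  have h3 : W ^ (N - j) * (W ^ (N - j))ᴴ = 1 := by
    rw [conjTranspose_pow, ← hc.mul_pow, hW, one_pow]
  rw [h1, conjTranspose_smul, Matrix.mul_smul, h2, Matrix.mul_assoc, h3, Matrix.mul_one]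
  simp [coeff_conjReflect, hj']

open Polynomial in
theorem sum_conjTranspose_aeval_mul_self {κ : Type} [Fintype κ] {W : Matrix Z Z ℂ}
    (hW : W * Wᴴ = 1) {N : ℕ} {F : κ → ℂ[X]} (hF : ∀ c, (F c).natDegree ≤ N)
    (h : ∑ c, F c * conjReflect N (F c) = X ^ N) :
    ∑ c, (aeval W (F c))ᴴ * aeval W (F c) = 1 := by
  have h1 := congrArg (aeval W) h
  simp only [map_sum, map_mul, map_pow, aeval_X, mul_comm (F _)] at h1
  simp only [← pow_mul_conjTranspose_aeval hW (hF _), Matrix.mul_assoc] at h1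
  rw [← Finset.mul_sum] at h1
  have hc : Commute W Wᴴ := hW.trans (mul_eq_one_comm.1 hW).symm
  have h3 : Wᴴ ^ N * W ^ N = 1 := by rw [← hc.symm.mul_pow, mul_eq_one_comm.1 hW, one_pow]
  have h4 := congrArg (Wᴴ ^ N * ·) h1
  simpa only [← Matrix.mul_assoc, h3, Matrix.one_mul] using h4

theorem conjTranspose_coinState_mul_self {κ : Type} [Fintype κ] (M : κ → Matrix Z I ℂ) :
    (coinState M)ᴴ * coinState M = ∑ c, (M c)ᴴ * M c := by
  ext s t
  simp only [mul_apply, conjTranspose_apply, coinState, of_apply, Fintype.sum_prod_type,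
    Matrix.sum_apply]
  exact Finset.sum_comm

open Polynomial in
/-- A family of unit norm on the circle gives an isometry when evaluated at a unitary. -/
theorem coinState_aeval_isometry {κ : Type} [Fintype κ] {W : Matrix Z Z ℂ} (hW : W * Wᴴ = 1)
    {N : ℕ} {F : κ → ℂ[X]} (hF : ∀ c, (F c).natDegree ≤ N)
    (h : ∑ c, F c * conjReflect N (F c) = X ^ N) {E : Matrix Z I ℂ} (hE : Eᴴ * E = 1) :
    (coinState fun c => aeval W (F c) * E)ᴴ * (coinState fun c => aeval W (F c) * E) = 1 := by
  rw [conjTranspose_coinState_mul_self]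
  have h1 : ∀ c, (aeval W (F c) * E)ᴴ * (aeval W (F c) * E) =
      Eᴴ * ((aeval W (F c))ᴴ * aeval W (F c)) * E := fun c => by
    simp only [conjTranspose_mul, Matrix.mul_assoc]
  simp only [h1]
  rw [← Matrix.sum_mul, ← Matrix.mul_sum, sum_conjTranspose_aeval_mul_self hW hF h, Matrix.mul_one,
    hE]

theorem norm_mulVec_of_isometry {J : Matrix Z I ℂ} (hJ : Jᴴ * J = 1) (v : EuclideanSpace ℂ I) :
    ‖(WithLp.toLp 2 (J *ᵥ v.ofLp) : EuclideanSpace ℂ Z)‖ = ‖v‖ := by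
  refine (sq_eq_sq₀ (norm_nonneg _) (norm_nonneg _)).1 ?_
  have h : ∀ {D : Type} [Fintype D] (w : EuclideanSpace ℂ D),
      ((‖w‖ ^ 2 : ℝ) : ℂ) = star w.ofLp ⬝ᵥ w.ofLp := by
    intro D _ w
    rw [EuclideanSpace.norm_sq_eq]
    push_cast
    simp only [dotProduct, Pi.star_apply, Complex.star_def, Complex.conj_mul']
  have h2 : ((‖(WithLp.toLp 2 (J *ᵥ v.ofLp) : EuclideanSpace ℂ Z)‖ ^ 2 : ℝ) : ℂ) =
      ((‖v‖ ^ 2 : ℝ) : ℂ) := by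
    rw [h, h, star_mulVec, ← dotProduct_mulVec, mulVec_mulVec, hJ, one_mulVec]
  exact_mod_cast h2

end Accuracy

end

/-! ### The protocol -/

section

open Matrix ComplexConjugate Polynomial

section Layout

variable {R Y : Type} [Fintype R] [DecidableEq R] [Fintype Y] [DecidableEq Y]

/-- Basis states outside the range of `g` are encoded by a fixed state of the register and a nonzero
string of ancilla qubits outside `S`. -/
theorem exists_encoding [Nonempty R] {g : R → Y} (hg : g.Injective) (b : ℕ) :
    ∃ (k : ℕ) (S : Finset (Fin k)) (enc : Y → R × (Fin k → Fin 2)), S.card = b ∧ enc.Injective ∧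
      (∀ y, sent S (enc y) = 0) ∧ ∀ s, enc (g s) = (s, 0) := by
  classical
  let str : Y → Fin (b + Fintype.card Y) → Fin 2 := fun y =>
    Pi.single (Fin.natAdd b (Fintype.equivFin Y y)) 1
  have hstr0 : ∀ y, str y ≠ 0 := fun y h => by
    have := congrFun h (Fin.natAdd b (Fintype.equivFin Y y))
    simp [str] at this
  have hstr : str.Injective := by
    intro y y' h
    have h1 := congrFun h (Fin.natAdd b (Fintype.equivFin Y y))
    simp only [str, Pi.single_eq_same, Pi.single_apply] at h1
    split_ifs at h1 with h2
    · simpa [Fin.ext_iff, ← Fin.ext_iff] using h2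
    · simp at h1
  let enc : Y → R × (Fin (b + Fintype.card Y) → Fin 2) := fun y =>
    if h : ∃ s, g s = y then (h.choose, 0) else (Classical.arbitrary R, str y)
  have h1 : ∀ s, enc (g s) = (s, 0) := fun s => by
    have h : ∃ s', g s' = g s := ⟨s, rfl⟩
    have h2 : h.choose = s := hg h.choose_spec
    simp only [enc, dif_pos h, h2]
  have h2 : ∀ y, (∀ s, g s ≠ y) → enc y = (Classical.arbitrary R, str y) := fun y hy => by
    simp only [enc, dif_neg (not_exists.2 hy)]
  refine ⟨_, Finset.univ.map (Fin.castAddEmb (Fintype.card Y)), enc, by simp, ?_, ?_, h1⟩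
  · intro y y' h
    by_cases hy : ∃ s, g s = y <;> by_cases hy' : ∃ s, g s = y'
    · obtain ⟨s, rfl⟩ := hy
      obtain ⟨s', rfl⟩ := hy'
      rw [h1, h1] at h
      exact congrArg (fun z => g z.1) h
    · obtain ⟨s, rfl⟩ := hy
      rw [h1, h2 y' (not_exists.1 hy')] at h
      exact (hstr0 y' (congrArg Prod.snd h).symm).elim
    · obtain ⟨s, rfl⟩ := hy'
      rw [h1, h2 y (not_exists.1 hy)] at h
      exact (hstr0 y (congrArg Prod.snd h)).elim
    · rw [h2 y (not_exists.1 hy), h2 y' (not_exists.1 hy')] at h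
      exact hstr (congrArg Prod.snd h)
  · intro y
    by_cases hy : ∃ s, g s = y
    · obtain ⟨s, rfl⟩ := hy
      rw [h1]
      rfl
    · rw [h2 y (not_exists.1 hy)]
      funext ⟨q, hq⟩
      obtain ⟨j, -, rfl⟩ := Finset.mem_map.1 hq
      simp only [sent, str, Pi.single_apply, Pi.zero_apply]
      rw [if_neg]
      intro h
      have := congrArg Fin.val h
      simp at this
      omega

theorem exists_nonzero_code {Λ T : Type} [Fintype Λ] [Fintype T] [Zero T]
    (h : Fintype.card Λ < Fintype.card T) :
    ∃ code : Λ → T, code.Injective ∧ ∀ l, code l ≠ 0 := by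
  classical
  have h1 : Fintype.card Λ ≤ Fintype.card {x : T // x ≠ 0} := by
    have := Set.card_ne_eq (0 : T)
    rw [show Fintype.card {x : T // x ≠ 0} = Fintype.card T - 1 from this]
    omega
  obtain ⟨f⟩ := Function.Embedding.nonempty_of_card_le h1
  exact ⟨fun l => (f l).1, Subtype.val_injective.comp f.injective, fun l => (f l).2⟩

theorem Protocol.withZeros_eq {r : ℕ} {X : Fin r → Type} (Q : Protocol X R)
    (Ψ : EuclideanSpace ℂ R) :
    Q.withZeros Ψ = WithLp.toLp 2 (embMatrix
      (fun s => (s, 0) : R → Basis R Q.ancillas Q.priv) *ᵥ Ψ.ofLp) := by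
  ext ⟨s, z⟩
  simp [Protocol.withZeros, mulVec, dotProduct, embMatrix_apply, Prod.ext_iff, ite_and]

end Layout

/-- On the unit circle `(z² + 1) / (2 z)` is the real part of `z`. -/
theorem eval_half_sq_add_one_div {z : ℂ} (hz : ‖z‖ = 1) :
    (C (1 / 2) * (X ^ 2 + 1) : ℂ[X]).eval z / z = (z.re : ℂ) := by
  have hz0 : z ≠ 0 := ne_zero_of_norm_eq_one hz
  have h1 : z * conj z = 1 := by rw [Complex.mul_conj', hz]; simp
  have h2 : (z.re : ℂ) = (z + conj z) / 2 := by
    rw [Complex.add_conj]; push_cast; ring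
  rw [h2, div_eq_iff hz0]
  simp only [eval_mul, eval_C, eval_add, eval_pow, eval_X, eval_one]
  linear_combination (-1 / 2 : ℂ) * h1

theorem natDegree_half_sq_add_one_le : (C (1 / 2) * (X ^ 2 + 1) : ℂ[X]).natDegree ≤ 2 := by
  compute_degree

theorem mem_unitaryGroup_of_hermitian {Y : Type} [Fintype Y] [DecidableEq Y] {M : Matrix Y Y ℂ}
    (h : Mᴴ = M) (h' : M * M = 1) : M ∈ unitaryGroup Y ℂ := by
  rw [mem_unitaryGroup_iff, star_eq_conjTranspose, h, h']

theorem coinState_single_mulVec {I Z : Type} [Fintype I] [DecidableEq I] [Fintype Z]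
    [DecidableEq Z] (v : EuclideanSpace ℂ I) :
    coinState (Pi.single (some 0) (embMatrix (Sum.inl : I → I ⊕ Z)) :
      Option (Fin 2) → Matrix (I ⊕ Z) I ℂ) *ᵥ v.ofLp =
    embMatrix (fun s : Fin 2 × I => ((Sum.inl s.2 : I ⊕ Z), some s.1)) *ᵥ
      (tensor (ket 0) v).ofLp := by
  ext ⟨y, c⟩
  simp only [mulVec, dotProduct, coinState, of_apply, embMatrix_apply, Fintype.sum_prod_type,
    tensor, ket]
  rcases y with s | z <;> rcases c with _ | c
  · simp
  · by_cases hc : c = 0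
    · subst hc
      simp [embMatrix_apply]
    · have : (some c : Option (Fin 2)) ≠ some 0 := by simpa using hc
      rw [Pi.single_eq_of_ne this]
      have hc1 : c = 1 := by omega
      subst hc1
      simp
  · simp
  · by_cases hc : c = 0
    · subst hc
      simp [embMatrix_apply]
    · have : (some c : Option (Fin 2)) ≠ some 0 := by simpa using hc
      rw [Pi.single_eq_of_ne this]
      simp

section Protocol

variable {r n : ℕ} {m : Fin r → ℕ}

/-- A protocol for gapped phase estimation from polynomials of degree at most `d` in the normalized
eigenvalue that are close to the states `γ`: their homogenizations at the walk operator, completed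
to a family of unit norm, are performed with `3 d` controlled uses of the walk operator or its
inverse, and each use costs one exchange of `b` qubits with each party. -/
theorem exists_gpe_protocol [Nonempty (Idx m n)] (a : Fin r → ℝ)
    (hα : 0 < Real.sqrt (∑ i, a i ^ 2)) {b d : ℕ} (hb : ∀ i, 2 * (m i + n) < 2 ^ b)
    {p : Fin 2 → ℂ[X]} (hp : ∀ c, (p c).natDegree ≤ d)
    (hp1 : ∀ t : ℝ, |t| ≤ 1 → ∑ c, ‖(p c).eval (t : ℂ)‖ ^ 2 < 1)
    {γ : ℝ → EuclideanSpace ℂ (Fin 2)} {φ ε δ : ℝ} (hγ : ∀ t, IsGPEState φ ε t (γ t))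
    (hov : ∀ t : ℝ, |t| ≤ 1 → 1 - δ ≤ (∑ c, conj (γ t c) * (p c).eval (t : ℂ)).re)
    (hε : 0 ≤ ε) (hδ : 2 * δ ≤ ε ^ 2) :
    ∃ Q : Protocol (fun i => Matrix (Fin (m i)) (Fin n) ℝ) (Fin 2 × Idx m n),
      Q.qubits ≤ 3 * d * (r * (2 * b)) ∧
        ∀ A : ∀ i, Matrix (Fin (m i)) (Fin n) ℝ, (∀ i, ‖A i‖ ≤ a i) →
          ImplementsGPE A (Real.sqrt (∑ i, a i ^ 2)) φ ε Q := by
  set α := Real.sqrt (∑ i, a i ^ 2) with hαdef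
  have hw : ∑ i, (a i / α) ^ 2 = 1 := by
    have h0 : 0 ≤ ∑ i, a i ^ 2 := Finset.sum_nonneg fun i _ => sq_nonneg _
    simp only [div_pow]
    rw [← Finset.sum_div, hαdef, Real.sq_sqrt h0]
    exact div_self (Real.sqrt_pos.1 hα).ne'
  let J : Matrix (Sites m n) (Idx m n) ℂ := distribute fun i => a i / α
  have hJ : Jᴴ * J = 1 := distribute_isometry _ hw
  choose V hV using fun (i : Fin r) (A : Matrix (Fin (m i)) (Fin n) ℝ) => exists_party_unitary a i A
  let D : (∀ i, Matrix (Fin (m i)) (Fin n) ℝ) → Matrix (Sites m n) (Sites m n) ℂ := fun A =>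
    blockDiagonal' fun i => (V i (A i)).1
  let U : (∀ i, Matrix (Fin (m i)) (Fin n) ℝ) →
      Matrix (Idx m n ⊕ Sites m n) (Idx m n ⊕ Sites m n) ℂ := fun A => blockEncoding J (D A)
  let E : Matrix (Idx m n ⊕ Sites m n) (Idx m n) ℂ := embMatrix Sum.inl
  have hE : Eᴴ * E = 1 := conjTranspose_embMatrix_mul_self Sum.inl_injective
  -- The coin consists of the output qubit of the register and a further level `none`, which carries
  -- the completing polynomial.
  let c₀ : Option (Fin 2) := some 0
  let g : Fin 2 × Idx m n → (Idx m n ⊕ Sites m n) × Option (Fin 2) :=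
    fun s => (Sum.inl s.2, some s.1)
  have hg : g.Injective := by
    rintro ⟨c, s⟩ ⟨c', s'⟩ h
    simp only [g, Prod.mk.injEq, Sum.inl.injEq, Option.some.injEq] at h
    exact Prod.ext h.2 h.1
  obtain ⟨k, S, enc, hS, henc, hsent, hencg⟩ := exists_encoding hg b
  have hcodes : ∀ i : Fin r, ∃ code : Loc m n i ⊕ Loc m n i → (S → Fin 2),
      code.Injective ∧ ∀ l, code l ≠ 0 := by
    intro i
    apply exists_nonzero_code
    have := hb i
    simp only [Fintype.card_sum, Fintype.card_fin, Fintype.card_fun, Fintype.card_coe, hS]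
    omega
  choose code hcode hcode0 using hcodes
  let act : Sites m n → (Idx m n ⊕ Sites m n) × Option (Fin 2) :=
    (fun y => (y, c₀)) ∘ (Sum.inr : Sites m n → Idx m n ⊕ Sites m n)
  have hact : act.Injective := (injective_prod_right c₀).comp Sum.inr_injective
  have hD : Simulates enc (r * (2 * b)) fun A => ctrl c₀ (fromBlocks 1 0 0 (D A)) := by
    have h := Simulates.exchange_all S henc hsent hact hcode hcode0 V
    rw [hS] at h
    convert h using 2 with A
    rw [extendAlong_comp (injective_prod_right c₀), extendAlong_inr]
  have hG : exchangeRange J ∈ unitaryGroup (Idx m n ⊕ Sites m n) ℂ :=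
    mem_unitaryGroup_of_hermitian (conjTranspose_exchangeRange J) (exchangeRange_mul_self hJ)
  have hR : signReflection (Idx m n) (Sites m n) ∈ unitaryGroup (Idx m n ⊕ Sites m n) ℂ :=
    mem_unitaryGroup_of_hermitian conjTranspose_signReflection signReflection_mul_self
  have hGs := Simulates.unitary (X := fun i => Matrix (Fin (m i)) (Fin n) ℝ) henc
    ⟨_, extendAlong_mem_unitaryGroup (injective_prod_right c₀) ⟨_, hG⟩⟩
  have hRs := Simulates.unitary (X := fun i => Matrix (Fin (m i)) (Fin n) ℝ) henc
    ⟨_, extendAlong_mem_unitaryGroup (injective_prod_right c₀) ⟨_, hR⟩⟩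
  have hU : Simulates enc (r * (2 * b)) fun A => ctrl c₀ (U A) := by
    have h := (hGs.mul hD).mul hGs
    simp only [zero_add, add_zero] at h
    convert h using 2 with A
    simp only [U, blockEncoding, extendAlong_mul (injective_prod_right c₀)]
  have hW : Simulates enc (r * (2 * b)) fun A => ctrl c₀ (signReflection _ _ * U A) := by
    have h := hRs.mul hU
    simp only [zero_add] at h
    convert h using 2 with A
    exact extendAlong_mul (injective_prod_right c₀) _ _
  have hW' : Simulates enc (r * (2 * b)) fun A => ctrl c₀ (U A * signReflection _ _) := by
    have h := hU.mul hRs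
    simp only [add_zero] at h
    convert h using 2 with A
    exact extendAlong_mul (injective_prod_right c₀) _ _
  obtain ⟨G, hGF, hGdeg, hGsum⟩ := exists_unit_completion (2 * d)
    (fun c => homogenize d (p c) (C (1 / 2) * (X ^ 2 + 1)))
    (fun c => natDegree_homogenize_le d (p c) natDegree_half_sq_add_one_le) (by
      intro z hz
      have hz0 : z ≠ 0 := ne_zero_of_norm_eq_one hz
      have h1 : ∀ c, ‖(homogenize d (p c) (C (1 / 2) * (X ^ 2 + 1))).eval z‖ =
          ‖(p c).eval (z.re : ℂ)‖ := by
        intro c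
        rw [eval_homogenize (hp c) _ hz0, eval_half_sq_add_one_div hz, norm_mul, norm_pow, hz,
          one_pow, one_mul]
      simp only [h1]
      exact hp1 _ ((Complex.abs_re_le_norm z).trans_eq hz))
  obtain ⟨N, hN, hNx⟩ := (reachable_of_unit c₀ (2 * d) G hGdeg hGsum).simulates henc hW
    (fun A => (U A * signReflection _ _) ^ d * E)
  -- First `d` uses of the inverse walk, then the signal processing.
  obtain ⟨l, hl, hop⟩ := hN.mul (hW'.ctrl_pow d)
  let Q : Protocol (fun i => Matrix (Fin (m i)) (Fin n) ℝ) (Fin 2 × Idx m n) :=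
    ⟨k, fun _ => 0, l⟩
  refine ⟨Q, hl.trans_eq (by ring), fun A hA ι _ e lam he => ?_⟩
  have hDD : (D A)ᴴ = D A := by
    simp only [D]
    rw [blockDiagonal'_conjTranspose]
    congr 1
    funext i
    exact (hV i (A i) (hA i)).1
  have hDD' : D A * D A = 1 := by
    simp only [D]
    rw [← blockDiagonal'_mul, ← blockDiagonal'_one]
    congr 1
    funext i
    have h := mem_unitaryGroup_iff.1 (V i (A i)).2
    rwa [star_eq_conjTranspose, (hV i (A i) (hA i)).1] at h
  have hUU : U A * U A = 1 := blockEncoding_mul_self hJ hDD'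
  have hUH : (U A)ᴴ = U A := conjTranspose_blockEncoding J hDD
  have hH : (U A).toBlocks₁₁ = (α : ℂ)⁻¹ • hermDilation A := by
    simp only [U]
    rw [toBlocks₁₁_blockEncoding]
    exact distribute_compress a α A _ fun i => (hV i (A i) (hA i)).2
  have het : ∀ u, toEuclideanLin (U A).toBlocks₁₁ (e u) = ((lam u / α : ℝ) : ℂ) • e u := by
    intro u
    rw [hH, map_smul, LinearMap.smul_apply, he, smul_smul]
    congr 1
    push_cast
    ring
  have ht : ∀ u, |lam u / α| ≤ 1 := fun u =>
    (abs_le_norm_of_eigenvector (e.orthonormal.1 u) (het u)).trans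
      (norm_toBlocks₁₁_le_one (by rw [hUH, hUU]))
  refine ⟨fun u => γ (lam u / α), fun u => hγ _, fun v => ?_⟩
  let W : Matrix (Idx m n ⊕ Sites m n) (Idx m n ⊕ Sites m n) ℂ := signReflection _ _ * U A
  let W' : Matrix (Idx m n ⊕ Sites m n) (Idx m n ⊕ Sites m n) ℂ := U A * signReflection _ _
  have hWH : Wᴴ = W' := by
    simp only [W, W', conjTranspose_mul, hUH, conjTranspose_signReflection]
  have hWW : W * Wᴴ = 1 := by
    rw [hWH]
    calc W * W' = signReflection _ _ * (U A * U A) * signReflection _ _ := by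
          simp only [W, W', Matrix.mul_assoc]
      _ = 1 := by rw [hUU, Matrix.mul_one, signReflection_mul_self]
  let M : Option (Fin 2) → Matrix (Idx m n ⊕ Sites m n) (Idx m n) ℂ := fun c =>
    aeval W (G c) * (W' ^ d * E)
  have hMiso : (coinState M)ᴴ * coinState M = 1 := by
    refine coinState_aeval_isometry hWW hGdeg hGsum ?_
    have h2 : (W' ^ d)ᴴ * W' ^ d = 1 := by
      rw [← hWH, conjTranspose_pow, conjTranspose_conjTranspose,
        ← (show Commute W Wᴴ from hWW.trans (mul_eq_one_comm.1 hWW).symm).mul_pow, hWW, one_pow]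
    rw [conjTranspose_mul, Matrix.mul_assoc, ← Matrix.mul_assoc _ _ E, h2, Matrix.one_mul, hE]
  have hMg : ∀ s : Fin 2 × Idx m n, (coinState M *ᵥ v.ofLp) (g s) =
      (aeval (U A).toBlocks₁₁ (p s.1) *ᵥ v.ofLp) s.2 := by
    rintro ⟨c, s⟩
    have h1 : M (some c) = E * aeval (U A).toBlocks₁₁ (p c) := by
      simp only [M, hGF]
      rw [← Matrix.mul_assoc]
      exact aeval_walk_homogenize hUU (hp c)
    have h2 : (coinState M *ᵥ v.ofLp) (g (c, s)) = (M (some c) *ᵥ v.ofLp) (Sum.inl s) := rfl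
    rw [h2, h1, ← mulVec_mulVec, embMatrix_mulVec_apply_self Sum.inl_injective]
  have hjg : (fun s => (s, 0) : _ → Basis (Fin 2 × Idx m n) k fun _ : Fin r => 0) =
      (joint ∘ enc) ∘ g := by
    funext s
    simp only [Function.comp, hencg, joint]
    rfl
  have hje : (joint (r := r) ∘ enc).Injective := joint_injective.comp henc
  have hz : ∀ Ψ : EuclideanSpace ℂ (Fin 2 × Idx m n), Q.withZeros Ψ =
      WithLp.toLp 2 (embMatrix (joint (r := r) ∘ enc) *ᵥ (embMatrix g *ᵥ Ψ.ofLp)) := by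
    intro Ψ
    rw [Protocol.withZeros_eq, mulVec_mulVec, embMatrix_mul_embMatrix, ← hjg]
  have hrun : Q.run A (tensor (ket 0) v) =
      WithLp.toLp 2 (embMatrix (joint (r := r) ∘ enc) *ᵥ (coinState M *ᵥ v.ofLp)) := by
    have h1 : Q.run A (tensor (ket 0) v) =
        WithLp.toLp 2 (stepsOp l A *ᵥ (Q.withZeros (tensor (ket 0) v)).ofLp) := rfl
    rw [h1, hz]
    congr 1
    rw [← coinState_single_mulVec, mulVec_mulVec, hop, ← mulVec_mulVec,
      mulVec_mulVec _ _ (coinState _)]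
    congr 2
    rw [Matrix.mul_assoc, ctrl_mul_coinState]
    refine Eq.trans ?_ (hNx A)
    congr 2
    funext c
    by_cases hc : c = c₀
    · subst hc; simp [c₀, E]
    · rw [Function.update_of_ne hc, Pi.single_eq_of_ne hc, Pi.single_eq_of_ne hc]
  let Ψ : EuclideanSpace ℂ (Fin 2 × Idx m n) :=
    ∑ u, inner ℂ (e u) v • tensor (γ (lam u / α)) (e u)
  have hmain := norm_sub_embMatrix_sq_le hg (WithLp.toLp 2 (coinState M *ᵥ v.ofLp)) Ψ
    (norm_mulVec_of_isometry hMiso v) (norm_sum_tensor e (fun u => (hγ _).norm_eq) v)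
    ((re_inner_sum_tensor_ge e het p (fun u => hov _ (ht u)) v).trans_eq (by
      congr 2
      ext s
      exact (hMg s).symm))
  have hdiff : ‖Q.run A (tensor (ket 0) v) - Q.withZeros Ψ‖ =
      ‖(WithLp.toLp 2 (coinState M *ᵥ v.ofLp) : EuclideanSpace ℂ _) -
        WithLp.toLp 2 (embMatrix g *ᵥ Ψ.ofLp)‖ := by
    rw [hrun, hz, ← WithLp.toLp_sub, ← mulVec_sub, norm_embMatrix_mulVec hje, WithLp.toLp_sub]
  rw [hdiff]
  refine (sq_le_sq₀ (norm_nonneg _) (by positivity)).1 (hmain.trans ?_)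
  rw [mul_pow]
  exact mul_le_mul_of_nonneg_right hδ (sq_nonneg _)

end Protocol

end

/-! ### Parameters and degenerate cases -/

section

open Matrix ComplexConjugate Polynomial Kronecker

section Protocol

variable {r n : ℕ} {m : Fin r → ℕ}

theorem IsGPEState.mono {φ ε ε' t : ℝ} {ξ : EuclideanSpace ℂ (Fin 2)} (h : IsGPEState φ ε t ξ)
    (hε : ε ≤ ε') : IsGPEState φ ε' t ξ :=
  ⟨h.norm_eq, fun ht => (h.large_pos ht).trans hε, fun ht => (h.small ht).trans hε,
    fun ht => (h.large_neg ht).trans hε⟩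

theorem sum_inner_smul_tensor {B I ι : Type} [Fintype I] [Fintype ι]
    (e : OrthonormalBasis ι ℂ (EuclideanSpace ℂ I)) (x : EuclideanSpace ℂ B)
    (v : EuclideanSpace ℂ I) : ∑ u, inner ℂ (e u) v • tensor x (e u) = tensor x v := by
  ext ⟨b, s⟩
  have h := congrArg (fun w : EuclideanSpace ℂ I => x b * w s) (e.sum_repr' v)
  simp only [WithLp.ofLp_sum, WithLp.ofLp_smul, Finset.sum_apply, Pi.smul_apply, smul_eq_mul,
    Finset.mul_sum] at h
  simp only [tensor, WithLp.ofLp_sum, WithLp.ofLp_smul, Finset.sum_apply, Pi.smul_apply,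
    smul_eq_mul]
  rw [← h]
  refine Finset.sum_congr rfl fun u _ => ?_
  ring

/-- If the stacked matrix has no entries, all eigenvalues are zero, and the referee rotates the
qubit to the state of a small eigenvalue without communication. -/
theorem exists_gpe_protocol_of_dilation_eq_zero (hzero : ∀ A : ∀ i, Matrix (Fin (m i)) (Fin n) ℝ,
    hermDilation A = 0) (α : ℝ) {φ ε : ℝ} (hφ : 0 < φ) (hε : 0 ≤ ε) :
    ∃ Q : Protocol (fun i => Matrix (Fin (m i)) (Fin n) ℝ) (Fin 2 × Idx m n),
      Q.qubits = 0 ∧ ∀ A, ImplementsGPE A α φ ε Q := by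
  let U : Matrix (Fin 2) (Fin 2) ℂ := !![0, Complex.I; Complex.I, 0]
  have hU : U ∈ unitaryGroup (Fin 2) ℂ := by
    rw [mem_unitaryGroup_iff, star_eq_conjTranspose]
    ext i j
    fin_cases i <;> fin_cases j <;> simp [U, mul_apply, Fin.sum_univ_two]
  have hU1 : U ⊗ₖ (1 : Matrix (Idx m n) (Idx m n) ℂ) ∈ unitaryGroup (Fin 2 × Idx m n) ℂ :=
    kronecker_mem_unitary hU (one_mem _)
  let enc : Fin 2 × Idx m n → (Fin 2 × Idx m n) × (Fin 0 → Fin 2) := fun s => (s, 0)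
  have henc : enc.Injective := fun s t h => congrArg Prod.fst h
  obtain ⟨l, hl, hop⟩ := Simulates.unitary (X := fun i => Matrix (Fin (m i)) (Fin n) ℝ) henc
    ⟨_, hU1⟩
  let Q : Protocol (fun i => Matrix (Fin (m i)) (Fin n) ℝ) (Fin 2 × Idx m n) :=
    ⟨0, fun _ => 0, l⟩
  refine ⟨Q, Nat.le_zero.1 hl, fun A ι _ e lam he => ?_⟩
  have hlam : ∀ u, lam u = 0 := by
    intro u
    have h := he u
    rw [hzero, map_zero, LinearMap.zero_apply] at h
    have h2 : e u ≠ 0 := e.orthonormal.ne_zero u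
    simpa [h2] using h.symm
  have hξ : ∀ t : ℝ, t = 0 → IsGPEState φ ε t (Complex.I • ket 1) := by
    rintro t rfl
    refine ⟨?_, fun h => absurd h.1 (by linarith), fun _ => by simpa using hε,
      fun h => absurd h.2 (by linarith)⟩
    simp [ket, norm_smul]
  refine ⟨fun _ => Complex.I • ket 1, fun u => hξ _ (by rw [hlam, zero_div]), fun v => ?_⟩
  have hUv : (U ⊗ₖ (1 : Matrix (Idx m n) (Idx m n) ℂ)) *ᵥ (tensor (ket 0) v).ofLp =
      (tensor (Complex.I • ket 1) v).ofLp := by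
    ext ⟨c, s⟩
    fin_cases c <;>
      simp [mulVec, dotProduct, Fintype.sum_prod_type, tensor, ket, U, one_apply]
  have hrun : Q.run A (tensor (ket 0) v) = Q.withZeros (tensor (Complex.I • ket 1) v) := by
    have h1 : Q.run A (tensor (ket 0) v) =
        WithLp.toLp 2 (stepsOp l A *ᵥ (Q.withZeros (tensor (ket 0) v)).ofLp) := rfl
    have h2 : (fun s => (s, 0) : _ → Basis (Fin 2 × Idx m n) 0 fun _ : Fin r => 0) =
      joint ∘ enc := rfl
    rw [h1, Protocol.withZeros_eq, Protocol.withZeros_eq, h2, mulVec_mulVec, hop, ← mulVec_mulVec,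
      hUv]
  rw [sum_inner_smul_tensor, hrun, sub_self, norm_zero]
  exact mul_nonneg hε (norm_nonneg v)

/-- `O(log (s n))` qubits have room for nonzero codes of two copies of an index set of size
`s + n`. -/
theorem exists_code_length {s n : ℕ} (hs : 1 ≤ s) (hn : 1 ≤ n) :
    ∃ b : ℕ, 2 * (s + n) < 2 ^ b ∧ (b : ℝ) ≤ 4 * max 1 (Real.logb 2 ((s : ℕ) * (n : ℝ))) := by
  refine ⟨Nat.log 2 (s * n) + 3, ?_, ?_⟩
  · have h1 : s * n < 2 ^ (Nat.log 2 (s * n) + 1) := Nat.lt_pow_succ_log_self one_lt_two _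
    have h2 : s + n ≤ s * n + 1 := by nlinarith
    have h3 : 1 ≤ s * n := Nat.mul_pos hs hn
    have h4 : 2 ^ (Nat.log 2 (s * n) + 3) = 4 * 2 ^ (Nat.log 2 (s * n) + 1) := by ring
    omega
  · have h1 := Real.natLog_le_logb (s * n) 2
    push_cast at h1 ⊢
    linarith [le_max_left 1 (Real.logb 2 ((s : ℝ) * n)), le_max_right 1 (Real.logb 2 ((s : ℝ) * n))]

/-- `O(log (1 / ε))` is a sufficient choice of the precision parameter `j`. -/
theorem exists_precision {ε : ℝ} (hε : 0 < ε) :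
    ∃ j : ℕ, 1 ≤ j ∧ 2 * (9 * (1 / 2 : ℝ) ^ j) ≤ ε ^ 2 ∧
      (j : ℝ) ≤ 8 * max 1 (Real.logb 2 (1 / ε)) := by
  set K := max 1 (Real.logb 2 (1 / ε)) with hK
  have hK1 : 1 ≤ K := le_max_left _ _
  refine ⟨⌈2 * K⌉₊ + 5, by omega, ?_, ?_⟩
  · have h1 : 1 / ε ≤ (2 : ℝ) ^ K := by
      rw [← Real.logb_le_iff_le_rpow one_lt_two (by positivity)]
      exact le_max_right _ _
    have h2 : (1 / ε) ^ 2 ≤ (2 : ℝ) ^ ⌈2 * K⌉₊ := by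
      calc (1 / ε) ^ 2 ≤ ((2 : ℝ) ^ K) ^ 2 := by gcongr
        _ = (2 : ℝ) ^ (2 * K) := by
          rw [← Real.rpow_natCast, ← Real.rpow_mul two_pos.le]
          congr 1
          push_cast
          ring
        _ ≤ (2 : ℝ) ^ ((⌈2 * K⌉₊ : ℕ) : ℝ) :=
          Real.rpow_le_rpow_of_exponent_le one_le_two (Nat.le_ceil _)
        _ = _ := Real.rpow_natCast _ _
    have h3 : (1 / 2 : ℝ) ^ ⌈2 * K⌉₊ ≤ ε ^ 2 := by
      rw [_root_.one_div_pow, one_div_le (by positivity) (by positivity), ← _root_.one_div_pow]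
      exact h2
    rw [pow_add]
    nlinarith [sq_nonneg ε]
  · have h1 := (Nat.ceil_lt_add_one (show 0 ≤ 2 * K by linarith)).le
    push_cast
    linarith

end Protocol

end

end Coordinator

theorem mainTheorem5 :
    ∃ C : ℝ, 0 < C ∧
      ∀ (r n : ℕ) (m : Fin r → ℕ) (a : Fin r → ℝ) (φ ε : ℝ),
        (∀ i, 0 ≤ a i) → 0 < Real.sqrt (∑ i, a i ^ 2) → 0 < φ → φ < 1 → 0 < ε →
        ∃ Q : Coordinator.Protocol (fun i => Matrix (Fin (m i)) (Fin n) ℝ)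
            (Fin 2 × Coordinator.Idx m n),
          (Q.qubits : ℝ) ≤
              C * ((r : ℝ) / φ) * max 1 (Real.logb 2 ((∑ i, m i : ℕ) * (n : ℝ))) *
                max 1 (Real.logb 2 (1 / ε)) ∧
          ∀ A : ∀ i, Matrix (Fin (m i)) (Fin n) ℝ,
            (∀ i, ‖A i‖ ≤ a i) →
            Coordinator.ImplementsGPE A (Real.sqrt (∑ i, a i ^ 2)) φ ε Q := by
  refine ⟨192000000, by norm_num, fun r n m a φ ε _ hα hφ hφ1 hε => ?_⟩
  have hL1 := le_max_left 1 (Real.logb 2 ((∑ i, m i : ℕ) * (n : ℝ)))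
  have hK1 := le_max_left 1 (Real.logb 2 (1 / ε))
  by_cases hmn : 1 ≤ ∑ i, m i ∧ 1 ≤ n
  · obtain ⟨b, hb, hbL⟩ := Coordinator.exists_code_length hmn.1 hmn.2
    obtain ⟨j, hj, hjε, hjK⟩ := Coordinator.exists_precision hε
    obtain ⟨γ, p, d, hd, hp, hγ, hp1, hov⟩ := Coordinator.exists_gpe_polynomials φ hφ hφ1 j hj
    have hne : Nonempty (Coordinator.Idx m n) := ⟨Sum.inr ⟨0, hmn.2⟩⟩
    have hbi : ∀ i, 2 * (m i + n) < 2 ^ b := fun i => by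
      have := Finset.single_le_sum (f := m) (fun i _ => Nat.zero_le _) (Finset.mem_univ i)
      omega
    obtain ⟨Q, hQ, hQA⟩ := Coordinator.exists_gpe_protocol a hα hbi hp hp1
      (fun t => (hγ t).mono (Real.sqrt_le_iff.2 ⟨hε.le, hjε⟩)) hov hε.le hjε
    refine ⟨Q, ?_, hQA⟩
    set L := max 1 (Real.logb 2 ((∑ i, m i : ℕ) * (n : ℝ)))
    set K := max 1 (Real.logb 2 (1 / ε))
    calc (Q.qubits : ℝ) ≤ 3 * d * (r * (2 * b)) := by exact_mod_cast hQ
      _ ≤ 3 * (1000000 * (8 * K) / φ) * (r * (2 * (4 * L))) := by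
        have : (d : ℝ) ≤ 1000000 * (8 * K) / φ := hd.trans (by gcongr)
        gcongr
      _ = 192000000 * ((r : ℝ) / φ) * L * K := by ring
  · have hzero : ∀ A : ∀ i, Matrix (Fin (m i)) (Fin n) ℝ, Coordinator.hermDilation A = 0 := by
      have hempty : ∀ (s : Σ i, Fin (m i)) (j : Fin n), False := by
        intro s j
        have h1 := Finset.single_le_sum (f := m) (fun i _ => Nat.zero_le _) (Finset.mem_univ s.1)
        exact hmn ⟨(Nat.pos_of_ne_zero (fun h => (Fin.cast h s.2).elim0)).trans_le h1,
          Nat.pos_of_ne_zero (fun h => (Fin.cast h j).elim0)⟩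
      intro A
      ext s t
      rcases s with s | j <;> rcases t with t | j'
      · simp [Coordinator.hermDilation]
      · exact (hempty s j').elim
      · exact (hempty t j).elim
      · simp [Coordinator.hermDilation]
    obtain ⟨Q, hQ, hQA⟩ := Coordinator.exists_gpe_protocol_of_dilation_eq_zero hzero
      (Real.sqrt (∑ i, a i ^ 2)) hφ hε.le
    refine ⟨Q, ?_, fun A _ => hQA A⟩
    rw [hQ, Nat.cast_zero]
    positivity
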